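/- Let $M$ be a smooth manifold of dimension $2n$ (Hausdorff, second countable) and let $D=\{Z_1,\dots,Z_N\}$ be a finite set of closed smooth hypersurfaces of $M$ that intersect transversely. Let ${}^{b}TM$ be the vector bundle whose sections are the vector fields tangent to every $Z\in D$. Let $\omega$ be a log symplectic form on $(M,D)$, that is, a section of $\wedge^2({}^{b}T^*M)$ with $d\omega=0$ and $\omega^n\neq 0$ everywhere. The class of $\omega$ in ${}^{b}H^2(M)\cong H^2(M)\oplus\bigoplus_s H^1(Z_s)\oplus\bigoplus_{s<t}H^0(Z_s\cap Z_t)$ has components $(a,b_s,c_{s,t})$. Here $c_{s,t}$ is the coefficient of $\frac{dx_s}{x_s}\wedge\frac{dx_t}{x_t}$ along $Z_s\cap Z_t$ (with $c_{t,s}=-c_{s,t}$). The class $b_s\in H^1(Z_s)$ is represented by the smooth part, on $Z_s$, of the residue of $\omega$ along $Z_s$, i.e. by the residue minus $d\big(\sum_{t\ne s}c_{s,t}\log|x_t|\big)$, where $x_t$ is a defining function of $Z_t$ and $c_{s,t}$ is extended by a function on $Z_s$ that is locally constant near $Z_s\cap Z_t$. Suppose that $\omega$ is partitionable: 1. if $b_s\neq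 0$, then $c_{i,s}=0$ for all $i\ne s$; 2. if $c_{s,t}\neq0$ ($s\ne t$), then $b_s$ and $b_t$ restrict to $0$ in $H^1(Z_s\cap Z_t)$, and $c_{s,j}=0$ for all $j\neq s,t$ and $c_{i,t}=0$ for all $i\neq s,t$. Suppose also that $M$ is compact, or that each nonzero class $c_{s,t}$ is nonzero on every connected component of $Z_s\cap Z_t$ (for example because $Z_s\cap Z_t$ is connected). Let $S\subseteq D$ be such that $\bigcap_{Z\in S}Z\ne\emptyset$, and let $X=\bigcap_{Z\in S}Z\setminus\bigcup_{Z\in D\setminus S}Z$. Two members $Z_s,Z_t$ of $S$ form a pair of type $x,y$ in the subpartition $\Lambda_S$ if $c_{s,t}\neq0$; a member of $S$ that forms no such pair with another member of $S$ is of type $z$ in $\Lambda_S$. Let $\ell$ be the number of hypersurfaces of type $z$ in $\Lambda_S$. Then $\omega$ induces an $\ell$-cosymplectic structure on $X$. That is, there are closed $1$-forms $\theta_j\in\Omega^1(X)$, one for each $Z_j$ of type $z$ in $\Lambda_S$, and a closed $2$-form $\beta\in\Omega^2(X)$ such that, for suitable defining functions $x_s$ of the $Z_s\in S$ (possibly defined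 only locally and up to sign, with $|x_s|$ globally defined), $$\omega|_X=\sum_{\{s,t\}}c_{s,t}\,\frac{dx_s}{x_s}\wedge\frac{dx_t}{x_t}+\sum_{j}\frac{dx_j}{x_j}\wedge\theta_j+\beta ,$$ where the first sum is over the pairs of type $x,y$ in $\Lambda_S$ and the second over the $Z_j$ of type $z$; moreover $\dim X=\ell+2m$ for some integer $m\geq 0$, and $$\Big(\bigwedge_j\theta_j\Big)\wedge\beta^{m}\neq0\quad\text{at every point of }X .$$ -/

import Mathlib

open scoped Manifold ContDiff Topology

noncomputable section

/-! ### Differentials of forms on a Lie algebroid, and wedge products -/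

section Algebra

variable {A V : Type*} [CommRing A] [Algebra ℝ A] [AddCommGroup V] [Module A V] [Bracket V V]

/-- The exterior differential `dα(u, v)` of a 1-form `α` on the module `V` of sections of a Lie
algebroid with the given anchor (the Cartan formula). -/
def extDOne (anchor : V → Derivation ℝ A A) (α : V →ₗ[A] A) (u v : V) : A :=
  anchor u (α v) - anchor v (α u) - α ⁅u, v⁆

/-- The exterior differential `d om (u, v, w)` of a 2-form `om` on the module `V` of sections of a Lie
algebroid with the given anchor (the Cartan formula). -/
def extDTwo (anchor : V → Derivation ℝ A A) (om : V →ₗ[A] V →ₗ[A] A) (u v w : V) : A :=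
  anchor u (om v w) - anchor v (om u w) + anchor w (om u v)
    - om ⁅u, v⁆ w + om ⁅u, w⁆ v - om ⁅v, w⁆ u

end Algebra

open Classical in
/-- The value of `(⋀ j, θ j) ∧ β ^ m` on the `card κ + 2 * m` vectors `v`, up to sign (the order of
the factors `θ j`) and the positive factor `2 ^ m` (the normalisation of the wedge product). -/
def wedgeEval {κ V : Type*} [Fintype κ] {m : ℕ} (θ : κ → V → ℝ) (β : V → V → ℝ)
    (v : κ ⊕ (Fin m × Fin 2) → V) : ℝ :=
  ∑ σ : Equiv.Perm (κ ⊕ (Fin m × Fin 2)),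
    ((Equiv.Perm.sign σ : ℤ) : ℝ) * (∏ j : κ, θ j (v (σ (Sum.inl j)))) *
      ∏ i : Fin m, β (v (σ (Sum.inr (i, 0)))) (v (σ (Sum.inr (i, 1))))

/-! ### Functions, vector fields and tangent vectors on a manifold of dimension `2 * n` -/

section Manifold

/-- The algebra of smooth real functions on `M`. -/
abbrev SmoothFun (n : ℕ) (M : Type*) [TopologicalSpace M]
    [ChartedSpace (EuclideanSpace ℝ (Fin (2 * n))) M] : Type _ :=
  C^∞⟮𝓡 (2 * n), M; ℝ⟯

/-- Smooth vector fields on `M`, as derivations of the algebra of smooth functions. They form a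
module over the smooth functions and a Lie algebra. -/
abbrev VField (n : ℕ) (M : Type*) [TopologicalSpace M]
    [ChartedSpace (EuclideanSpace ℝ (Fin (2 * n))) M] : Type _ :=
  Derivation ℝ (SmoothFun n M) (SmoothFun n M)

/-- Tangent vectors at `p`, as derivations at the point `p`. -/
abbrev TVec (n : ℕ) {M : Type*} [TopologicalSpace M]
    [ChartedSpace (EuclideanSpace ℝ (Fin (2 * n))) M] (p : M) : Type _ := PointDerivation (𝓡 (2 * n)) p

variable {n : ℕ} {M : Type*} [TopologicalSpace M]
  [ChartedSpace (EuclideanSpace ℝ (Fin (2 * n))) M] {ι : Type*}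

/-- The derivative of the function `f` in the direction of the tangent vector `w`. -/
def derivAlong {p : M} (w : TVec n p) (f : SmoothFun n M) : ℝ := w f

/-- The value at `p` of a vector field. -/
def valAt (u : VField n M) (p : M) : TVec n p := Derivation.evalAt p u

/-- `x` is a defining function of the hypersurface `Y` near the point `p` (if `p` is not on `Y`,
this says that `x` has no zeros near `p`, given that `Y` is closed). -/
def IsDefiningNear (Y : Set M) (p : M) (x : SmoothFun n M) : Prop :=
  (∀ᶠ q in 𝓝 p, q ∈ Y ↔ x q = 0) ∧ (p ∈ Y → mfderiv (𝓡 (2 * n)) 𝓘(ℝ, ℝ) x p ≠ 0)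

variable (n) in
/-- `Z` is a (real, smooth) normal crossing divisor: a family of closed embedded smooth
hypersurfaces which intersect transversely, i.e. the differentials of the defining functions of the
hypersurfaces through any point are linearly independent at that point. -/
def IsNormalCrossing (Z : ι → Set M) : Prop :=
  (∀ i, IsClosed (Z i)) ∧
  ∀ p : M, ∃ x : ι → SmoothFun n M, (∀ i, p ∈ Z i → IsDefiningNear (Z i) p (x i)) ∧
    LinearIndependent ℝ (M := TangentSpace (𝓡 (2 * n)) p →L[ℝ] ℝ)
      (fun i : {i // p ∈ Z i} => mfderiv (𝓡 (2 * n)) 𝓘(ℝ, ℝ) (x i) p)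

variable (n) in
/-- The sections of the log tangent bundle of `(M, Z)`: the vector fields tangent to each of the
hypersurfaces, i.e. preserving the functions that vanish on it. -/
def logVF (Z : ι → Set M) : Submodule (SmoothFun n M) (VField n M) where
  carrier := {u | ∀ (i : ι) (f : SmoothFun n M), (∀ q ∈ Z i, f q = 0) → ∀ q ∈ Z i, u f q = 0}
  add_mem' := by
    intro u v hu hv i f hf q hq
    simp [hu i f hf q hq, hv i f hf q hq]
  zero_mem' := by
    intro i f hf q hq
    simp
  smul_mem' := by
    intro g u hu i f hf q hq
    simp [hu i f hf q hq]

variable (n) in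
/-- The Lie bracket of vector fields tangent to the hypersurfaces. -/
instance logBracket (Z : ι → Set M) : Bracket (logVF n Z) (logVF n Z) where
  bracket u v := ⟨⁅(u : VField n M), (v : VField n M)⁆, by
    intro i f hf q hq
    rw [Derivation.commutator_apply]
    have h1 := u.2 i _ (v.2 i f hf) q hq
    have h2 := v.2 i _ (u.2 i f hf) q hq
    simp [h1, h2]⟩

variable (n) in
/-- The module of log 1-forms: sections of the dual of the log tangent bundle. -/
abbrev LogOneForm (Z : ι → Set M) : Type _ := logVF n Z →ₗ[SmoothFun n M] SmoothFun n M

variable (n) in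
/-- Bilinear forms on the log tangent bundle; log 2-forms are the alternating ones. -/
abbrev LogBilin (Z : ι → Set M) : Type _ :=
  logVF n Z →ₗ[SmoothFun n M] logVF n Z →ₗ[SmoothFun n M] SmoothFun n M

/-- `om` is a log symplectic form on `(M, Z)`: a log 2-form which is closed and satisfies
`om ^ n ≠ 0` at every point of `M` (also on the hypersurfaces) as a section of the top exterior power
of the dual of the log tangent bundle. -/
structure IsLogSymplectic (Z : ι → Set M) (om : LogBilin n Z) : Prop where
  alt : ∀ u, om u u = 0
  closed : ∀ u v w, extDTwo (fun u : logVF n Z => (u : VField n M)) om u v w = 0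
  nondegenerate : ∀ p : M, ∃ v : Empty ⊕ (Fin n × Fin 2) → logVF n Z,
    wedgeEval (m := n) (fun j : Empty => j.elim) (fun u w => om u w p) v ≠ 0

/-! ### Intersections of hypersurfaces and differential forms on them -/

/-- The tangent space at `p` of the intersection of the hypersurfaces in `S`, which is the
intersection of their tangent spaces (only meaningful for `p` in that intersection). -/
def strTangent (Z : ι → Set M) (S : Set ι) (p : M) : Submodule ℝ (TVec n p) where
  carrier := {w | ∀ s ∈ S, ∀ f : SmoothFun n M, (∀ q ∈ Z s, f q = 0) → derivAlong w f = 0}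
  add_mem' := by
    intro u v hu hv s hs f hf
    change derivAlong u f + derivAlong v f = 0
    rw [hu s hs f hf, hv s hs f hf, add_zero]
  zero_mem' := by
    intro s hs f hf
    rfl
  smul_mem' := by
    intro c u hu s hs f hf
    change c • derivAlong u f = 0
    rw [hu s hs f hf, smul_zero]

/-- The intersection of the hypersurfaces in `S`, away from the remaining hypersurfaces. -/
def openStratum (Z : ι → Set M) (S : Set ι) : Set M :=
  {p | ∀ i, p ∈ Z i ↔ i ∈ S}

/-- A log vector field is tangent to intersections of hypersurfaces at their points. -/
theorem logVF_at_mem (Z : ι → Set M) (S : Set ι) (p : M) (hp : ∀ s ∈ S, p ∈ Z s)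
    (u : logVF n Z) : valAt (u : VField n M) p ∈ strTangent Z S p := by
  intro s hs f hf
  exact u.2 s f hf p (hp s hs)

/-- Families of linear forms on the tangent spaces of the intersection of the hypersurfaces in
`S` (values at points outside of the submanifold under consideration are never used). -/
abbrev StrOneForm (n : ℕ) {M : Type*} [TopologicalSpace M]
    [ChartedSpace (EuclideanSpace ℝ (Fin (2 * n))) M] {ι : Type*} (Z : ι → Set M) (S : Set ι) :
    Type _ :=
  ∀ p : M, strTangent (n := n) Z S p →ₗ[ℝ] ℝ

/-- Families of bilinear forms on the tangent spaces of the intersection of the hypersurfaces in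
`S` (values at points outside of the submanifold under consideration are never used). -/
abbrev StrBilin (n : ℕ) {M : Type*} [TopologicalSpace M]
    [ChartedSpace (EuclideanSpace ℝ (Fin (2 * n))) M] {ι : Type*} (Z : ι → Set M) (S : Set ι) :
    Type _ :=
  ∀ p : M, strTangent (n := n) Z S p →ₗ[ℝ] strTangent (n := n) Z S p →ₗ[ℝ] ℝ

/-- `η` is a smooth closed 1-form on `Y`, where `Y` is a relatively open subset of the intersection
of the hypersurfaces in `S`: near each point of `Y` it is the restriction to `Y` of a smooth
1-form `α` on `M`, and the restriction of `dα` to `Y` vanishes there. -/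
def IsClosedOneFormOn (Z : ι → Set M) (S : Set ι) (Y : Set M) (η : StrOneForm n Z S) : Prop :=
  ∀ p ∈ Y, ∃ α : VField n M →ₗ[SmoothFun n M] SmoothFun n M, ∀ᶠ q in 𝓝 p, q ∈ Y →
    (∀ (u : VField n M) (hu : valAt u q ∈ strTangent Z S q), α u q = η q ⟨valAt u q, hu⟩) ∧
    (∀ u v : VField n M, valAt u q ∈ strTangent Z S q → valAt v q ∈ strTangent Z S q →
      extDOne id α u v q = 0)

/-- `β` is a smooth closed 2-form on `Y`, where `Y` is a relatively open subset of the intersection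
of the hypersurfaces in `S`: it is alternating, near each point of `Y` it is the restriction to `Y`
of a smooth 2-form `α` on `M`, and the restriction of `dα` to `Y` vanishes there. -/
def IsClosedTwoFormOn (Z : ι → Set M) (S : Set ι) (Y : Set M) (β : StrBilin n Z S) : Prop :=
  (∀ p ∈ Y, ∀ w, β p w w = 0) ∧
  ∀ p ∈ Y, ∃ α : VField n M →ₗ[SmoothFun n M] VField n M →ₗ[SmoothFun n M] SmoothFun n M,
    (∀ u, α u u = 0) ∧ ∀ᶠ q in 𝓝 p, q ∈ Y →
    (∀ (u v : VField n M) (hu : valAt u q ∈ strTangent Z S q) (hv : valAt v q ∈ strTangent Z S q),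
      α u v q = β q ⟨valAt u q, hu⟩ ⟨valAt v q, hv⟩) ∧
    (∀ u v w : VField n M, valAt u q ∈ strTangent Z S q → valAt v q ∈ strTangent Z S q →
      valAt w q ∈ strTangent Z S q → extDTwo id α u v w q = 0)

/-- `(θ, β)` is a `k`-cosymplectic structure on `Y` (a relatively open subset of the intersection of
the hypersurfaces in `S`), where `k` is the number of elements of `κ`: the `k` 1-forms `θ j` and the
2-form `β` are smooth and closed on `Y`, the dimension of `Y` is `k + 2 * m`, and
`(⋀ j, θ j) ∧ β ^ m` vanishes nowhere on `Y`. -/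
structure IsCosymplecticOn {κ : Type*} [Fintype κ] (Z : ι → Set M) (S : Set ι) (Y : Set M)
    (θ : κ → StrOneForm n Z S) (β : StrBilin n Z S) : Prop where
  closed_one : ∀ j, IsClosedOneFormOn Z S Y (θ j)
  closed_two : IsClosedTwoFormOn Z S Y β
  nonvanishing : ∃ m : ℕ, ∀ p ∈ Y,
    Module.finrank ℝ (strTangent (n := n) Z S p) = Fintype.card κ + 2 * m ∧
    ∃ v : κ ⊕ (Fin m × Fin 2) → strTangent (n := n) Z S p,
      wedgeEval (fun j w => θ j p w) (fun w w' => β p w w') v ≠ 0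

/-! ### Residues and the decomposition of the class of a log 2-form -/

/-- `dx/x (u)` extends smoothly across the zeros of `x` near `p`, with value `r` at `p`. -/
def HasDlogAt (x : SmoothFun n M) (u : VField n M) (p : M) (r : ℝ) : Prop :=
  ∃ k : SmoothFun n M, (∀ᶠ q in 𝓝 p, u x q = k q * x q) ∧ k p = r

open Classical in
/-- `u` represents at `p ∈ Z s` the canonical element `x_s ∂/∂x_s` of the fibre of the log tangent
bundle: the vector field `u` vanishes at `p`, and `dx/x (u)` is `1` at `p` for defining functions `x`
of `Z s`, and `0` for defining functions of the other hypersurfaces through `p`. -/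
def IsEulerAt (Z : ι → Set M) (s : ι) (p : M) (u : logVF n Z) : Prop :=
  valAt (u : VField n M) p = 0 ∧
  ∀ t, p ∈ Z t → ∀ x : SmoothFun n M, IsDefiningNear (Z t) p x →
    HasDlogAt x u p (if t = s then 1 else 0)

open Classical in
/-- The component `c_{s,t}` of the class of the closed log 2-form `om`, as a locally constant function
on `Z s ∩ Z t`: the coefficient of `dx_s/x_s ∧ dx_t/x_t`, which is the value of `om` on
`x_s ∂/∂x_s` and `x_t ∂/∂x_t` and does not depend on choices. -/
def cCoeff {Z : ι → Set M} (om : LogBilin n Z) (s t : ι) (p : M) : ℝ :=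
  if h : ∃ e : logVF n Z × logVF n Z, IsEulerAt Z s p e.1 ∧ IsEulerAt Z t p e.2 then
    om h.choose.1 h.choose.2 p
  else 0

/-- `s ≠ t` and the class `c_{s,t}` in `H⁰(Z s ∩ Z t)` is nonzero. -/
def CNonzero {Z : ι → Set M} (om : LogBilin n Z) (s t : ι) : Prop :=
  s ≠ t ∧ ∃ p ∈ Z s ∩ Z t, cCoeff om s t p ≠ 0

/-- `ρ = |x|` is the absolute value of a defining function `x` of `Z s` (on all of `M`, where `x` may
be defined only locally and up to sign, so that it also exists if `Z s` is one-sided or does not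
separate `M`), and `lam` is the closed log 1-form `dx/x = d log ρ`. -/
def IsDlogDefining (Z : ι → Set M) (s : ι) (ρ : M → ℝ) (lam : LogOneForm n Z) : Prop :=
  ∀ p : M, ∃ x : SmoothFun n M, IsDefiningNear (Z s) p x ∧ (∀ᶠ q in 𝓝 p, ρ q = |x q|) ∧
    ∀ u : logVF n Z, ∀ᶠ q in 𝓝 p, lam u q * x q = (u : VField n M) x q

open Classical in
/-- The closed 1-form `η` on `Z s` represents the component `b_s` in `H¹(Z s)` of the class of the
closed log 2-form `om`: there are functions `ρ t = |x_t|` for defining functions `x_t` of `Z t` such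
that the residue `v ↦ om (x_s ∂/∂x_s, v)` of `om` along `Z s` is `d (∑_{t ≠ s} c t * log ρ t) + η` on
`Z s`. Here `c t` is a smooth function which on `Z s` is locally constant near `Z s ∩ Z t`, with
value `c_{s,t}` (it may be taken constant when `c_{s,t}` is constant). -/
def RepresentsB [Fintype ι] {Z : ι → Set M} (om : LogBilin n Z) (s : ι)
    (η : StrOneForm n Z {s}) : Prop :=
  IsClosedOneFormOn Z {s} (Z s) η ∧
  ∃ (ρ : ι → M → ℝ) (lam : ι → LogOneForm n Z) (c : ι → SmoothFun n M),
    (∀ t, IsDlogDefining Z t (ρ t) (lam t)) ∧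
    (∀ t, t ≠ s → ∀ p ∈ Z s ∩ Z t, ∀ᶠ q in 𝓝 p, q ∈ Z s → c t q = cCoeff om s t p) ∧
    ∀ (p : M) (hp : p ∈ Z s) (e v : logVF n Z), IsEulerAt Z s p e →
      om e v p =
        (∑ t with t ≠ s, (c t p * lam t v p + (v : VField n M) (c t) p * Real.log (ρ t p)))
        + η p ⟨valAt (v : VField n M) p,
            logVF_at_mem Z {s} p (fun _ hi => (Set.mem_singleton_iff.mp hi) ▸ hp) v⟩

/-- For `s ∈ T`, the pullback of the class `b_s` to the de Rham cohomology `H¹` of the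
intersection of the hypersurfaces in `T` is zero: a representing 1-form is exact there. -/
def BVanishesOn [Fintype ι] {Z : ι → Set M} (om : LogBilin n Z) (s : ι) (T : Set ι) : Prop :=
  ∃ η : StrOneForm n Z {s}, RepresentsB om s η ∧
    ∃ f : SmoothFun n M, ∀ p, (∀ t ∈ T, p ∈ Z t) →
      ∀ (w : TVec n p) (hw : w ∈ strTangent Z {s} p), w ∈ strTangent Z T p →
        η p ⟨w, hw⟩ = derivAlong w f

/-- The conditions on the components `b_s ∈ H¹(Z s)` and `c_{s,t} ∈ H⁰(Z s ∩ Z t)` of the class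
of `om` that make a log symplectic form partitionable. -/
structure IsPartitionable [Fintype ι] {Z : ι → Set M} (om : LogBilin n Z) : Prop where
  of_b_ne_zero : ∀ s, ¬ BVanishesOn om s {s} → ∀ i, ¬ CNonzero om i s
  of_c_ne_zero : ∀ s t, CNonzero om s t →
    BVanishesOn om s {s, t} ∧ BVanishesOn om t {s, t} ∧
    (∀ j, j ≠ t → ¬ CNonzero om s j) ∧ (∀ i, i ≠ s → ¬ CNonzero om i t)

open Classical in
/-- The hypersurfaces of type `z` in the subpartition of `S`: those which do not form a pair of
type `x`, `y` (that is, `c_{s,t} ≠ 0`) with another member of `S`. These are the ones of type `z`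
in the whole divisor (not in a pair at all, as `b_s ≠ 0`), and the members of a pair whose
counterpart is not in `S`. -/
def typeZ {Z : ι → Set M} (om : LogBilin n Z) (S : Finset ι) : Finset ι :=
  {s ∈ S | ∀ t ∈ S, ¬ CNonzero om s t}

open Classical in
/-- The forms `(θ, β)` on the intersection `X` of the hypersurfaces in `S`, away from the others, are
induced by `om`: for suitable defining functions `x_s` (possibly up to sign, as above),
`om = ∑ c_{s,t} dx_s/x_s ∧ dx_t/x_t + ∑ dx_j/x_j ∧ θ_j + β` along `X`, where the first sum is over
the unordered pairs `{s, t}` of type `x`, `y` in `S` and the second over the `j` of type `z`. -/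
def IsInducedOn {Z : ι → Set M} (om : LogBilin n Z) (S : Finset ι)
    (θ : typeZ om S → StrOneForm n Z S) (β : StrBilin n Z S) : Prop :=
  ∃ (ρ : ι → M → ℝ) (lam : ι → LogOneForm n Z),
    (∀ s ∈ S, IsDlogDefining Z s (ρ s) (lam s)) ∧
    ∀ (p : M) (hp : p ∈ openStratum Z S) (u v : logVF n Z),
      let u' : strTangent Z S p :=
        ⟨valAt (u : VField n M) p, logVF_at_mem Z S p (fun i hi => (hp i).mpr hi) u⟩
      let v' : strTangent Z S p :=
        ⟨valAt (v : VField n M) p, logVF_at_mem Z S p (fun i hi => (hp i).mpr hi) v⟩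
      om u v p =
        (∑ s ∈ S, ∑ t ∈ S with CNonzero om s t, cCoeff om s t p * (lam s u p * lam t v p))
        + (∑ j : typeZ om S, (lam j u p * θ j p v' - lam j v p * θ j p u'))
        + β p u' v'

end Manifold

end

open scoped Manifold ContDiff Topology

set_option linter.unusedSectionVars false

noncomputable section

/-! ### Hadamard's lemma -/

section Hadamard

universe u

variable {E F : Type u} [NormedAddCommGroup E] [NormedSpace ℝ E] [NormedAddCommGroup F]
  [NormedSpace ℝ F]

/-! Write `λ_s = dx_s/x_s` and let `e_s = x_s ∂/∂x_s` be the Euler field of `Z s`. Any choice of log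
forms `λ_s` expands `ω` along the stratum into terms `λ_s ∧ λ_t`, terms `λ_s ∧ θ_s` and a smooth
part `β`. Here `θ_s` is the contraction `ω(e_s, ·)` on vectors that every `λ_t` annihilates. The
point is to choose the `λ_s` so that `θ_s = 0` whenever `s` has its partner in `S`.

Suppose `c_{s,t} ≠ 0`. Partitionability kills the other coefficients `c_{s,j}` and makes `b_s` exact
on `Z s ∩ Z t`. There the residue of `ω` along `Z s` is therefore `c λ_t + dg` with `g` smooth
(`IsPartitionable.exists_residue_eq`). If `c` vanishes nowhere on `Z s ∩ Z t`, replacing `x_t` by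
`x_t exp(g/c)` turns the residue into `c λ_t` exactly (`IsPartitionable.exists_residue_eq_dlog`).
Each `t` has at most one partner, so these modifications do not interfere.

That `c` has no zero is a hypothesis in one case. In the compact case it is proved by a maximum
principle (`IsPartitionable.cCoeff_ne_zero`). The zero set of the locally constant `c` is compact
and open in `Z s ∩ Z t`. At a maximum of `g` on it both `c` and `dg` vanish, so `ω(e_s, ·) = 0`,
against nondegeneracy.

Closedness of `θ_s` and `β` is read off from `dω = 0` in coordinates adapted to the hypersurfaces:
the fields `∂_j` tangent to the stratum commute with the whole log frame, and the derivative along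
`y_s ∂_s` vanishes where `y_s = 0`.

For nonvanishing, suppose `∑ a_j θ_j + β(w, ·) = 0` and all `θ_j(w) = 0`. Lift `w` to a log vector
with `λ_j`-component `a_j` for `j` of type `z` and `0` for paired indices. The lift lies in the
kernel of `ω`, so `a = 0` and `w = 0`. By linear algebra (`exists_wedgeEval_ne_zero`) this
injectivity gives the parity of the dimension and `(⋀ θ_j) ∧ β^m ≠ 0`.

Vector fields are derivations, so pointwise calculus rests on Hadamard's lemma and on coordinates in
which the hypersurfaces are coordinate hyperplanes (`AdaptedFrame`). -/

theorem hasFDerivAt_integral_of_contDiff_one [FiniteDimensional ℝ E] [CompleteSpace F]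
    {f : ℝ → E → F} (hf : ContDiff ℝ 1 (fun p : ℝ × E => f p.1 p.2)) (z : E) :
    HasFDerivAt (fun z => ∫ t in (0 : ℝ)..1, f t z) (∫ t in (0 : ℝ)..1, fderiv ℝ (f t) z) z := by
  have hfd : ∀ t z, HasFDerivAt (f t) (fderiv ℝ (f t) z) z := fun t z =>
    (((hf.comp (contDiff_prodMk_right t)).differentiable one_ne_zero) z).hasFDerivAt
  have hcont : Continuous (fun p : ℝ × E => fderiv ℝ (f p.1) p.2) := by
    have : ContDiff ℝ 0 (fun p : ℝ × E => fderiv ℝ (f p.1) p.2) := by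
      apply ContDiff.fderiv (m := 1) (n := 0) (f := fun (p : ℝ × E) (z : E) => f p.1 z)
      · exact hf.comp ((contDiff_fst.comp contDiff_fst).prodMk contDiff_snd)
      · exact contDiff_snd
      · simp
    exact this.continuous
  obtain ⟨C, hC⟩ := ((isCompact_Icc (a := (0 : ℝ)) (b := 1)).prod
    (isCompact_closedBall z 1)).exists_bound_of_continuousOn hcont.continuousOn
  have hcf : ∀ z, Continuous (fun t => f t z) := fun z =>
    hf.continuous.comp (Continuous.prodMk_left z)
  refine intervalIntegral.hasFDerivAt_integral_of_dominated_of_fderiv_le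
    (F := fun z t => f t z) (F' := fun z t => fderiv ℝ (f t) z) (bound := fun _ => C)
    (Metric.closedBall_mem_nhds z one_pos) (.of_forall fun y => ?_) ?_ ?_ ?_ ?_ ?_
  · exact (hcf y).aestronglyMeasurable
  · exact (hcf z).intervalIntegrable _ _
  · exact (hcont.comp (Continuous.prodMk_left z)).aestronglyMeasurable
  · refine .of_forall fun t ht y hy => ?_
    rw [Set.uIoc_of_le zero_le_one] at ht
    exact hC (t, y) ⟨⟨ht.1.le, ht.2⟩, hy⟩
  · exact intervalIntegrable_const
  · exact .of_forall fun t _ y _ => hfd t y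

/-- Differentiation under the integral gains one order at a time. `F` is quantified inside the
induction because the derivative takes values in `E →L[ℝ] F`; this is also why `E` and `F` share a
universe. -/
theorem contDiff_integral_nat [FiniteDimensional ℝ E] (m : ℕ) :
    ∀ {F : Type u} [NormedAddCommGroup F] [NormedSpace ℝ F] [CompleteSpace F] {f : ℝ → E → F},
      ContDiff ℝ ∞ (fun p : ℝ × E => f p.1 p.2) →
        ContDiff ℝ m (fun z => ∫ t in (0 : ℝ)..1, f t z) := by
  induction m with
  | zero =>
    intro F _ _ _ f hf
    exact contDiff_zero.2 (continuous_iff_continuousAt.2 fun z =>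
      (hasFDerivAt_integral_of_contDiff_one (hf.of_le (by simp)) z).continuousAt)
  | succ m ih =>
    intro F _ _ _ f hf
    refine contDiff_succ_iff_hasFDerivAt.2 ⟨_, ih (f := fun t z => fderiv ℝ (f t) z) ?_,
      hasFDerivAt_integral_of_contDiff_one (hf.of_le (by simp))⟩
    apply ContDiff.fderiv (m := ∞) (n := ∞) (f := fun (p : ℝ × E) (z : E) => f p.1 z)
    · exact hf.comp ((contDiff_fst.comp contDiff_fst).prodMk contDiff_snd)
    · exact contDiff_snd
    · simp

theorem contDiff_integral [FiniteDimensional ℝ E] [CompleteSpace F] {f : ℝ → E → F}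
    (hf : ContDiff ℝ ∞ (fun p : ℝ × E => f p.1 p.2)) :
    ContDiff ℝ ∞ (fun z => ∫ t in (0 : ℝ)..1, f t z) :=
  contDiff_infty.2 fun m => contDiff_integral_nat m hf

/-- Here `g z` is the mean of the derivative over the segment from `a z` to `z`. A constant `a`
gives the first-order expansion at a point; setting one coordinate to zero gives division by that
coordinate. -/
theorem exists_contDiff_sub_eq [FiniteDimensional ℝ E] {f : E → ℝ} (hf : ContDiff ℝ ∞ f)
    {a : E → E} (ha : ContDiff ℝ ∞ a) :
    ∃ g : E → E →L[ℝ] ℝ, ContDiff ℝ ∞ g ∧ (∀ z, f z = f (a z) + g z (z - a z)) ∧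
      ∀ z, a z = z → g z = fderiv ℝ f z := by
  have hs : ContDiff ℝ ∞ (fun p : ℝ × E => fderiv ℝ f (a p.2 + p.1 • (p.2 - a p.2))) := by
    have h1 : ContDiff ℝ ∞ (fderiv ℝ f) := hf.fderiv_right (by simp)
    have h2 : ContDiff ℝ ∞ (fun p : ℝ × E => a p.2) := ha.comp contDiff_snd
    exact h1.comp (h2.add (contDiff_fst.smul (contDiff_snd.sub h2)))
  refine ⟨_, contDiff_integral (f := fun t z => fderiv ℝ f (a z + t • (z - a z))) hs, ?_, ?_⟩
  · intro z
    have hd : ∀ t : ℝ, HasDerivAt (fun t : ℝ => f (a z + t • (z - a z)))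
        (fderiv ℝ f (a z + t • (z - a z)) (z - a z)) t := by
      intro t
      have h1 : HasDerivAt (fun t : ℝ => a z + t • (z - a z)) (z - a z) t := by
        simpa using ((hasDerivAt_id t).smul_const (z - a z)).const_add (a z)
      exact ((hf.differentiable (by simp)) _).hasFDerivAt.comp_hasDerivAt t h1
    have hc : Continuous (fun t : ℝ => fderiv ℝ f (a z + t • (z - a z))) :=
      hs.continuous.comp (Continuous.prodMk_left z)
    have h2 := intervalIntegral.integral_eq_sub_of_hasDerivAt (fun t _ => hd t)
      ((hc.clm_apply continuous_const).intervalIntegrable 0 1)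
    rw [← ContinuousLinearMap.intervalIntegral_apply (hc.intervalIntegrable 0 1)] at h2
    rw [h2]
    simp
  · intro z hz
    simp [hz]

variable {κ : Type u} [Fintype κ] [DecidableEq κ]

theorem exists_contDiff_eq_add_sum {f : (κ → ℝ) → ℝ} (hf : ContDiff ℝ ∞ f) (z₀ : κ → ℝ) :
    ∃ h : κ → (κ → ℝ) → ℝ, (∀ k, ContDiff ℝ ∞ (h k)) ∧
      (∀ z, f z = f z₀ + ∑ k, (z k - z₀ k) * h k z) ∧
      ∀ k, h k z₀ = fderiv ℝ f z₀ (Pi.single k 1) := by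
  obtain ⟨g, hg, h1, h2⟩ := exists_contDiff_sub_eq hf (a := fun _ => z₀) contDiff_const
  refine ⟨fun k z => g z (Pi.single k 1), fun k => hg.clm_apply contDiff_const, fun z => ?_,
    fun k => by simp only [h2 z₀ rfl]⟩
  rw [h1 z]
  congr 1
  have := LinearMap.pi_apply_eq_sum_univ (g z : (κ → ℝ) →ₗ[ℝ] ℝ) (z - z₀)
  simpa [← Pi.single_apply, Pi.single_comm] using this

theorem exists_contDiff_eq_mul {f : (κ → ℝ) → ℝ} (hf : ContDiff ℝ ∞ f) (i : κ) :
    ∃ g : (κ → ℝ) → ℝ, ContDiff ℝ ∞ g ∧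
      ∀ z, f z = f (Function.update z i 0) + z i * g z := by
  have ha : ContDiff ℝ ∞ (fun z : κ → ℝ => Function.update z i 0) := by
    rw [contDiff_pi]
    intro j
    rcases eq_or_ne j i with rfl | hj
    · simpa using contDiff_const
    · simpa [Function.update_of_ne hj] using contDiff_apply ℝ ℝ j
  obtain ⟨g, hg, h1, -⟩ := exists_contDiff_sub_eq hf ha
  refine ⟨fun z => g z (Pi.single i 1), hg.clm_apply contDiff_const, fun z => ?_⟩
  conv_lhs => rw [h1 z]
  congr 1
  have : z - Function.update z i 0 = z i • (Pi.single i 1 : κ → ℝ) := by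
    ext j
    rcases eq_or_ne j i with rfl | hj
    · simp
    · simp [hj]
  rw [this, map_smul, smul_eq_mul]

end Hadamard

/-! ### Linear algebra of alternating forms -/

section LinearAlgebra

universe u

variable {V : Type*} [AddCommGroup V] [Module ℝ V]

/-- The product of the values of a bilinear form on `n` pairs of vectors, as a multilinear map. -/
def pairProd (n : ℕ) (B : V →ₗ[ℝ] V →ₗ[ℝ] ℝ) :
    MultilinearMap ℝ (fun _ : Empty ⊕ (Fin n × Fin 2) => V) ℝ where
  toFun v := ∏ i : Fin n, B (v (Sum.inr (i, 0))) (v (Sum.inr (i, 1)))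
  map_update_add' m c x y := by
    rcases c with c | ⟨i₀, ε⟩
    · exact c.elim
    have key : ∀ z : V, ∏ i ∈ Finset.univ.erase i₀,
        B (Function.update m (Sum.inr (i₀, ε)) z (Sum.inr (i, 0)))
          (Function.update m (Sum.inr (i₀, ε)) z (Sum.inr (i, 1))) =
        ∏ i ∈ Finset.univ.erase i₀, B (m (Sum.inr (i, 0))) (m (Sum.inr (i, 1))) := by
      intro z
      refine Finset.prod_congr rfl fun i hi => ?_
      have hi' := Finset.ne_of_mem_erase hi
      rw [Function.update_of_ne (by simp [hi']), Function.update_of_ne (by simp [hi'])]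
    simp only [← Finset.mul_prod_erase _ _ (Finset.mem_univ i₀), key]
    fin_cases ε <;> simp [add_mul]
  map_update_smul' m c r x := by
    rcases c with c | ⟨i₀, ε⟩
    · exact c.elim
    have key : ∀ z : V, ∏ i ∈ Finset.univ.erase i₀,
        B (Function.update m (Sum.inr (i₀, ε)) z (Sum.inr (i, 0)))
          (Function.update m (Sum.inr (i₀, ε)) z (Sum.inr (i, 1))) =
        ∏ i ∈ Finset.univ.erase i₀, B (m (Sum.inr (i, 0))) (m (Sum.inr (i, 1))) := by
      intro z
      refine Finset.prod_congr rfl fun i hi => ?_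
      have hi' := Finset.ne_of_mem_erase hi
      rw [Function.update_of_ne (by simp [hi']), Function.update_of_ne (by simp [hi'])]
    simp only [← Finset.mul_prod_erase _ _ (Finset.mem_univ i₀), key]
    fin_cases ε <;> simp [mul_assoc]

/-- Being an alternatization, the top power of a bilinear form is determined by its value on a
single basis. -/
theorem alternatization_pairProd {n : ℕ} (B : V →ₗ[ℝ] V →ₗ[ℝ] ℝ)
    (v : Empty ⊕ (Fin n × Fin 2) → V) :
    MultilinearMap.alternatization (pairProd n B) v =
      wedgeEval (m := n) (fun j : Empty => j.elim) (fun u w => B u w) v := by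
  classical
  rw [MultilinearMap.alternatization_apply]
  simp only [wedgeEval]
  refine Finset.sum_congr (by congr!) fun σ _ => ?_
  simp only [pairProd, MultilinearMap.domDomCongr_apply, MultilinearMap.coe_mk, Units.smul_def,
    zsmul_eq_mul, Finset.univ_eq_empty, Finset.prod_empty, mul_one]
  congr!

/-- If the top power of an alternating form does not vanish, the form is nondegenerate. -/
theorem eq_zero_of_wedgeEval_ne_zero [FiniteDimensional ℝ V] {n : ℕ}
    (hV : Module.finrank ℝ V = 2 * n) {B : V →ₗ[ℝ] V →ₗ[ℝ] ℝ} (hB : ∀ u, B u u = 0)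
    {v : Empty ⊕ (Fin n × Fin 2) → V}
    (hv : wedgeEval (m := n) (fun j : Empty => j.elim) (fun u w => B u w) v ≠ 0)
    {e : V} (he : ∀ w, B e w = 0) : e = 0 := by
  by_contra hne
  have he' : ∀ w, B w e = 0 := fun w => by
    have := hB (w + e)
    simpa [hB, he] using this
  have hli : LinearIndepOn ℝ id ({e} : Set V) := by
    simpa using LinearIndependent.of_subsingleton (R := ℝ) (v := fun x : ({e} : Set V) => (x : V))
      ⟨e, rfl⟩ hne
  let b := Module.Basis.extend hli
  have hcard : Nat.card (hli.extend (Set.subset_univ _)) = Nat.card (Empty ⊕ (Fin n × Fin 2)) := by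
    rw [← Module.finrank_eq_nat_card_basis b, hV]
    simp [mul_comm]
  have : Finite (hli.extend (Set.subset_univ _)) := Module.Finite.finite_basis b
  obtain ⟨φ⟩ := (Finite.card_eq).1 hcard
  let b' := b.reindex φ
  obtain ⟨i₀, hi₀⟩ : ∃ i, b' i = e := by
    refine ⟨φ ⟨e, hli.subset_extend _ rfl⟩, ?_⟩
    simp [b', b]
  classical
  have h1 : MultilinearMap.alternatization (pairProd n B) b' = 0 := by
    rw [MultilinearMap.alternatization_apply]
    refine Finset.sum_eq_zero fun σ _ => ?_
    suffices pairProd n B (fun i => b' (σ i)) = 0 by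
      rw [MultilinearMap.domDomCongr_apply, this, smul_zero]
    -- The kernel vector `e` fills one slot of one pair, and the factor of that pair is zero.
    rcases h : σ.symm i₀ with c | ⟨i, ε⟩
    · exact c.elim
    have h' : b' (σ (Sum.inr (i, ε))) = e := by rw [← h, σ.apply_symm_apply, hi₀]
    refine Finset.prod_eq_zero (Finset.mem_univ i) ?_
    obtain rfl | rfl : ε = 0 ∨ ε = 1 := by fin_cases ε <;> simp
    · exact (congrArg (fun z => B z _) h').trans (he _)
    · exact (congrArg (B _) h').trans (he' _)
  apply hv
  rw [← alternatization_pairProd, AlternatingMap.eq_smul_basis_det b'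
    (MultilinearMap.alternatization (pairProd n B)), h1, zero_smul]
  rfl

/-- An alternating nondegenerate form has a symplectic basis. -/
theorem exists_symplectic_family (d : ℕ) :
    ∀ {V : Type u} [AddCommGroup V] [Module ℝ V] [FiniteDimensional ℝ V]
      (β : V →ₗ[ℝ] V →ₗ[ℝ] ℝ), (∀ u, β u u = 0) → (∀ e, (∀ w, β e w = 0) → e = 0) →
      Module.finrank ℝ V = d → ∃ (m : ℕ) (v : Fin m → Fin 2 → V), d = 2 * m ∧
        (∀ i j, i ≠ j → ∀ a b, β (v i a) (v j b) = 0) ∧ ∀ i, β (v i 0) (v i 1) = 1 := by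
  induction d using Nat.strong_induction_on with
  | _ d ih =>
  intro V _ _ _ β hβ hnd hd
  rcases Nat.eq_zero_or_pos d with rfl | hpos
  · exact ⟨0, fun i => i.elim0, rfl, fun i => i.elim0, fun i => i.elim0⟩
  have : Nontrivial V := Module.nontrivial_of_finrank_pos (R := ℝ) (hd ▸ hpos)
  obtain ⟨a, ha⟩ := exists_ne (0 : V)
  obtain ⟨b₀, hb₀⟩ : ∃ b, β a b ≠ 0 := by
    by_contra! h
    exact ha (hnd a h)
  obtain ⟨b, hab⟩ : ∃ b, β a b = 1 := ⟨(β a b₀)⁻¹ • b₀, by simp [hb₀]⟩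
  have hskew : ∀ u w, β u w = -β w u := fun u w => by
    have := hβ (u + w)
    simp only [map_add, LinearMap.add_apply, hβ] at this
    linarith
  have hba : β b a = -1 := by rw [hskew, hab]
  let φ : V →ₗ[ℝ] ℝ × ℝ := (β a).prod (β b)
  have hφ : Function.Surjective φ := by
    rintro ⟨r, s⟩
    exact ⟨r • b - s • a, by simp [φ, hab, hba, hβ]⟩
  let W := LinearMap.ker φ
  have hW : ∀ w, w ∈ W ↔ β a w = 0 ∧ β b w = 0 := fun w => by simp [W, φ]
  have hrank := LinearMap.finrank_range_add_finrank_ker φ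
  rw [LinearMap.range_eq_top.2 hφ, finrank_top, Module.finrank_prod, Module.finrank_self, hd]
    at hrank
  obtain ⟨m, v, hm, hv, hv1⟩ := ih (Module.finrank ℝ W) (by simp only [W]; omega)
    (β.domRestrict₁₂ W W) (fun u => hβ u) (by
      intro e he
      refine Subtype.ext (hnd e fun x => ?_)
      -- This is the projection of `x` to the orthogonal complement `W` of the hyperbolic plane
      -- spanned by `a` and `b`. It shows that `β` stays nondegenerate on `W`.
      have hx : x - β x b • a + β x a • b ∈ W := by
        rw [hW]
        constructor
        · simp [hab, hβ, hskew a x]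
        · simp [hba, hβ, hskew b x]
      have h1 : β e (x - β x b • a + β x a • b) = 0 := he ⟨_, hx⟩
      have h2 := (hW e).1 e.2
      rw [hskew a, hskew b] at h2
      simpa [neg_eq_zero.1 h2.1, neg_eq_zero.1 h2.2] using h1) rfl
  refine ⟨m + 1, Fin.cons ![a, b] fun i c => (v i c : V), by simp only [W] at hm; omega, ?_, ?_⟩
  · intro i j
    have h0 : ∀ (w : W) (c : Fin 2), β (![a, b] c) w = 0 ∧ β w (![a, b] c) = 0 := by
      intro w c
      rw [hskew w]
      fin_cases c <;> simp [(hW w).1 w.2]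
    refine Fin.cases ?_ (fun i => ?_) i <;> refine Fin.cases ?_ (fun j => ?_) j
    · simp
    · intro _ c e
      exact (h0 _ c).1
    · intro _ c e
      exact (h0 _ e).2
    · intro hij c e
      exact hv i j (fun h => hij (by rw [h])) c e
  · intro i
    refine Fin.cases ?_ (fun i => ?_) i
    · simpa using hab
    · exact hv1 i

/-- A nonzero product forces `σ` to carry pairs to pairs, so `σ` is a permutation `τ` of the pairs
combined with flips `ε i` inside them. Acting on both members, `τ` contributes `sign τ ^ 2 = 1`.
Each flip changes the sign of `σ` and of one factor, so the signs cancel. -/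
theorem sign_mul_prod_eq_one_of_symplectic {m : ℕ} {β : V →ₗ[ℝ] V →ₗ[ℝ] ℝ} (hβ : ∀ u, β u u = 0)
    {v : Fin m → Fin 2 → V} (hv : ∀ i j, i ≠ j → ∀ a b, β (v i a) (v j b) = 0)
    (hv1 : ∀ i, β (v i 0) (v i 1) = 1) (σ : Equiv.Perm (Fin m × Fin 2))
    (hσ : ∏ i, β (v (σ (i, 0)).1 (σ (i, 0)).2) (v (σ (i, 1)).1 (σ (i, 1)).2) ≠ 0) :
    ((Equiv.Perm.sign σ : ℤ) : ℝ) *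
      ∏ i, β (v (σ (i, 0)).1 (σ (i, 0)).2) (v (σ (i, 1)).1 (σ (i, 1)).2) = 1 := by
  have h1 : ∀ i, (σ (i, 0)).1 = (σ (i, 1)).1 := by
    intro i
    by_contra hne
    exact hσ (Finset.prod_eq_zero (Finset.mem_univ i) (hv _ _ hne _ _))
  have h1' : ∀ i c, (σ (i, c)).1 = (σ (i, 0)).1 := by
    intro i c
    fin_cases c
    · rfl
    · exact (h1 i).symm
  have hτ : Function.Bijective fun i => (σ (i, 0)).1 := by
    rw [← Finite.surjective_iff_bijective]
    intro j
    refine ⟨(σ.symm (j, 0)).1, ?_⟩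
    dsimp only
    rw [← h1' _ (σ.symm (j, 0)).2]
    simp
  have hε : ∀ i, Function.Bijective fun c => (σ (i, c)).2 := by
    intro i
    rw [← Finite.injective_iff_bijective]
    intro c c' h
    have : σ (i, c) = σ (i, c') := Prod.ext (by rw [h1' i c, h1' i c']) h
    simpa using σ.injective this
  let τ : Equiv.Perm (Fin m) := Equiv.ofBijective _ hτ
  let ε : Fin m → Equiv.Perm (Fin 2) := fun i => Equiv.ofBijective _ (hε i)
  have hdec : σ = Equiv.prodCongrLeft (fun _ : Fin 2 => τ) * Equiv.prodCongrRight ε := by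
    ext1 ⟨i, c⟩
    exact Prod.ext (h1' i c) rfl
  have hsign : Equiv.Perm.sign σ = ∏ i, Equiv.Perm.sign (ε i) := by
    conv_lhs => rw [hdec]
    rw [Equiv.Perm.sign_mul, Equiv.Perm.sign_prodCongrRight, Equiv.Perm.sign_prodCongrLeft]
    simp
  have hterm : ∀ i, β (v (σ (i, 0)).1 (σ (i, 0)).2) (v (σ (i, 1)).1 (σ (i, 1)).2) =
      ((Equiv.Perm.sign (ε i) : ℤ) : ℝ) := by
    intro i
    rw [← h1 i]
    change β (v _ (ε i 0)) (v _ (ε i 1)) = _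
    generalize ε i = e
    generalize (σ (i, 0)).1 = j
    have hj : β (v j 1) (v j 0) = -1 := by
      have := hβ (v j 0 + v j 1)
      simp only [map_add, LinearMap.add_apply, hβ, hv1] at this
      linarith
    obtain rfl | rfl : e = 1 ∨ e = Equiv.swap 0 1 := by revert e; decide
    · simp [hv1]
    · simp [hj]
  simp only [hterm, hsign]
  push_cast
  rw [← Finset.prod_mul_distrib]
  refine Finset.prod_eq_one fun i _ => ?_
  rcases Int.units_eq_one_or (Equiv.Perm.sign (ε i)) with h | h <;> simp [h]

/-- Every summand is nonnegative and the identity contributes `1`: duality of `θ` and `f` leaves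
only permutations that fix the first block pointwise. -/
theorem wedgeEval_pos_of_symplectic {κ : Type*} [Fintype κ] [DecidableEq κ] {m : ℕ}
    {θ : κ → V →ₗ[ℝ] ℝ} {β : V →ₗ[ℝ] V →ₗ[ℝ] ℝ} (hβ : ∀ u, β u u = 0) {f : κ → V}
    (hf : ∀ i j, θ i (f j) = if i = j then 1 else 0) {v : Fin m → Fin 2 → V}
    (hθv : ∀ j i a, θ j (v i a) = 0) (hv : ∀ i j, i ≠ j → ∀ a b, β (v i a) (v j b) = 0)
    (hv1 : ∀ i, β (v i 0) (v i 1) = 1) :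
    0 < wedgeEval (fun j w => θ j w) (fun u w => β u w)
      (Sum.elim f fun x : Fin m × Fin 2 => v x.1 x.2) := by
  classical
  set g : κ ⊕ (Fin m × Fin 2) → V := Sum.elim f fun x : Fin m × Fin 2 => v x.1 x.2 with hg
  let T : Equiv.Perm (κ ⊕ (Fin m × Fin 2)) → ℝ := fun σ =>
    ((Equiv.Perm.sign σ : ℤ) : ℝ) * (∏ j : κ, θ j (g (σ (Sum.inl j)))) *
      ∏ i : Fin m, β (g (σ (Sum.inr (i, 0)))) (g (σ (Sum.inr (i, 1))))
  have hnonneg : ∀ σ, 0 ≤ T σ := by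
    intro σ
    simp only [T]
    by_cases h0 : ∀ j, σ (Sum.inl j) = Sum.inl j
    · obtain ⟨⟨σ₁, σ₂⟩, rfl⟩ := Equiv.Perm.mem_sumCongrHom_range_of_perm_mapsTo_inl (σ := σ) (by
        rintro _ ⟨j, rfl⟩
        exact ⟨j, (h0 j).symm⟩)
      have h1 : σ₁ = 1 := by
        ext1 j
        simpa using h0 j
      subst h1
      by_cases h2 : ∏ i, β (v (σ₂ (i, 0)).1 (σ₂ (i, 0)).2) (v (σ₂ (i, 1)).1 (σ₂ (i, 1)).2) = 0
      · simp [hg, h2]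
      · have := sign_mul_prod_eq_one_of_symplectic hβ hv hv1 σ₂ h2
        simp [hg, hf, this]
    · push Not at h0
      obtain ⟨j, hj⟩ := h0
      have : θ j (g (σ (Sum.inl j))) = 0 := by
        rcases h : σ (Sum.inl j) with k | ⟨i, a⟩
        · have hjk : j ≠ k := fun hjk => hj (by rw [h, hjk])
          simp [hg, hf, hjk]
        · simp [hg, hθv]
      rw [Finset.prod_eq_zero (Finset.mem_univ j) this]
      simp
  have hone : T 1 = 1 := by simp [T, hg, hf, hv1]
  have hsum : wedgeEval (fun j w => θ j w) (fun u w => β u w) g = ∑ σ, T σ := by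
    simp only [wedgeEval, T]
    congr!
  rw [hsum]
  calc (0 : ℝ) < T 1 := hone ▸ zero_lt_one
    _ ≤ _ := Finset.single_le_sum (fun σ _ => hnonneg σ) (Finset.mem_univ _)

/-- If `(a, w) ↦ ∑ a j * θ j + β w` is injective on the common kernel of the `θ j`, then
`(⋀ j, θ j) ∧ β ^ m` does not vanish, for `m` half of the complementary dimension. -/
theorem exists_wedgeEval_ne_zero [FiniteDimensional ℝ V] {κ : Type*} [Fintype κ]
    {θ : κ → V →ₗ[ℝ] ℝ} {β : V →ₗ[ℝ] V →ₗ[ℝ] ℝ} (hβ : ∀ u, β u u = 0)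
    (H : ∀ (a : κ → ℝ) (w : V), (∀ w', ∑ j, a j * θ j w' + β w w' = 0) → (∀ j, θ j w = 0) →
      a = 0 ∧ w = 0) :
    ∃ m : ℕ, Module.finrank ℝ V = Fintype.card κ + 2 * m ∧
      ∃ v : κ ⊕ (Fin m × Fin 2) → V, wedgeEval (fun j w => θ j w) (fun u w => β u w) v ≠ 0 := by
  classical
  have hsurj : Function.Surjective (LinearMap.pi θ) := by
    rw [← LinearMap.range_eq_top]
    by_contra hne
    -- A proper range would yield a nontrivial linear relation among the `θ j`, which `H` with `w =
    -- 0` excludes.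
    obtain ⟨g, hg, hg'⟩ := Submodule.exists_le_ker_of_lt_top _ (lt_top_iff_ne_top.2 hne)
    have hga : ∀ x : κ → ℝ, g x = ∑ j, g (Pi.single j 1) * x j := fun x => by
      have := LinearMap.pi_apply_eq_sum_univ g x
      simpa [← Pi.single_apply, Pi.single_comm, mul_comm] using this
    have h0 := (H (fun j => g (Pi.single j 1)) 0 (fun w' => by
      have := hg' (LinearMap.mem_range_self (LinearMap.pi θ) w')
      rw [LinearMap.mem_ker, hga] at this
      simpa using this) (by simp)).1
    apply hg
    ext1 j
    ext
    simpa using congrFun h0 j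
  let K := LinearMap.ker (LinearMap.pi θ)
  have hK : ∀ w, w ∈ K ↔ ∀ j, θ j w = 0 := fun w => by
    simp [K, LinearMap.mem_ker, funext_iff]
  obtain ⟨m, v, hd, hv, hv1⟩ := exists_symplectic_family (Module.finrank ℝ K)
    (β.domRestrict₁₂ K K) (fun u => hβ u) (by
      intro e he
      -- A form vanishing on the common kernel of the `θ j` is a combination of them, so `H` applies
      -- with the negated coefficients.
      have : β e ∈ Submodule.span ℝ (Set.range θ) := by
        apply FiniteDimensional.mem_span_of_iInf_ker_le_ker
        intro w hw
        have hw' : w ∈ K := by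
          rw [hK]
          simpa using hw
        exact he ⟨w, hw'⟩
      obtain ⟨c, hc⟩ := (Submodule.mem_span_range_iff_exists_fun ℝ).1 this
      have := (H (fun j => -c j) e (fun w' => by rw [← hc]; simp) ((hK _).1 e.2)).2
      exact Subtype.ext this) rfl
  refine ⟨m, ?_, ?_⟩
  · have := LinearMap.finrank_range_add_finrank_ker (LinearMap.pi θ)
    rw [LinearMap.range_eq_top.2 hsurj, finrank_top, Module.finrank_fintype_fun_eq_card] at this
    rw [← hd, ← this]
  · choose f hf using fun j => hsurj (Pi.single j 1)
    refine ⟨Sum.elim f fun x : Fin m × Fin 2 => (v x.1 x.2 : V), ne_of_gt ?_⟩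
    refine wedgeEval_pos_of_symplectic (v := fun i a => (v i a : V)) hβ ?_ ?_ ?_ ?_
    · intro i j
      simpa [Pi.single_apply] using congrFun (hf j) i
    · intro j i a
      exact (hK _).1 (v i a).2 j
    · exact fun i j hij a b => hv i j hij a b
    · exact fun i => hv1 i

end LinearAlgebra

/-! ### Germs of smooth functions, tangent vectors and vector fields -/

section Germs

variable {n : ℕ} {M : Type*} [TopologicalSpace M]
  [ChartedSpace (EuclideanSpace ℝ (Fin (2 * n))) M]

theorem derivAlong_add {p : M} (w : TVec n p) (f g : SmoothFun n M) :
    derivAlong w (f + g) = derivAlong w f + derivAlong w g :=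
  map_add w _ _

theorem derivAlong_sub {p : M} (w : TVec n p) (f g : SmoothFun n M) :
    derivAlong w (f - g) = derivAlong w f - derivAlong w g :=
  map_sub w _ _

theorem derivAlong_sum {p : M} (w : TVec n p) {α : Type*} (s : Finset α)
    (f : α → SmoothFun n M) : derivAlong w (∑ i ∈ s, f i) = ∑ i ∈ s, derivAlong w (f i) :=
  map_sum w _ _

theorem derivAlong_mul {p : M} (w : TVec n p) (f g : SmoothFun n M) :
    derivAlong w (f * g) = f p * derivAlong w g + g p * derivAlong w f :=
  Derivation.leibniz w _ _

theorem derivAlong_algebraMap {p : M} (w : TVec n p) (r : ℝ) :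
    derivAlong w (algebraMap ℝ (SmoothFun n M) r) = 0 :=
  Derivation.map_algebraMap w r

@[simp]
theorem derivAlong_valAt (u : VField n M) (p : M) (f : SmoothFun n M) :
    derivAlong (valAt u p) f = u f p :=
  rfl

theorem TVec.ext_derivAlong {p : M} {w w' : TVec n p}
    (h : ∀ f : SmoothFun n M, derivAlong w f = derivAlong w' f) : w = w' :=
  Derivation.ext h

variable [T2Space M] [IsManifold (𝓡 (2 * n)) ∞ M]

theorem contMDiff_mul_of_tsupport {χ f : M → ℝ} {U : Set M} (hU : IsOpen U)
    (hχ : ContMDiff (𝓡 (2 * n)) 𝓘(ℝ, ℝ) ∞ χ) (hχU : tsupport χ ⊆ U)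
    (hf : ContMDiffOn (𝓡 (2 * n)) 𝓘(ℝ, ℝ) ∞ f U) :
    ContMDiff (𝓡 (2 * n)) 𝓘(ℝ, ℝ) ∞ (fun q => χ q * f q) := by
  apply contMDiff_of_tsupport
  intro q hq
  have hq' : q ∈ tsupport χ := tsupport_mul_subset_left hq
  exact (hχ q).mul ((hf q (hχU hq')).contMDiffAt (hU.mem_nhds (hχU hq')))

/-- The product of a cut-off function with a function which is smooth near its support. -/
def cutoffMul (χ : SmoothFun n M) {f : M → ℝ} {U : Set M} (hU : IsOpen U) (hχU : tsupport χ ⊆ U)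
    (hf : ContMDiffOn (𝓡 (2 * n)) 𝓘(ℝ, ℝ) ∞ f U) : SmoothFun n M :=
  ⟨fun q => χ q * f q, contMDiff_mul_of_tsupport hU χ.contMDiff hχU hf⟩

theorem exists_cutoff {p : M} {U : Set M} (hU : U ∈ 𝓝 p) :
    ∃ χ : SmoothFun n M, (∀ᶠ q in 𝓝 p, χ q = 1) ∧ tsupport χ ⊆ U := by
  obtain ⟨b, -, hb⟩ := (SmoothBumpFunction.nhds_basis_tsupport (I := 𝓡 (2 * n)) p).mem_iff.1 hU
  exact ⟨⟨b, b.contMDiff⟩, b.eventuallyEq_one, hb⟩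

theorem exists_smoothFun_eventuallyEq {p : M} {U : Set M} (hU : IsOpen U) (hp : p ∈ U) {f : M → ℝ}
    (hf : ContMDiffOn (𝓡 (2 * n)) 𝓘(ℝ, ℝ) ∞ f U) :
    ∃ g : SmoothFun n M, ∀ᶠ q in 𝓝 p, g q = f q := by
  obtain ⟨χ, h1, h2⟩ := exists_cutoff (n := n) (hU.mem_nhds hp)
  refine ⟨cutoffMul χ hU h2 hf, ?_⟩
  filter_upwards [h1] with q hq
  simp [cutoffMul, hq]

/-- Derivations are local: with `χ` supported where `f` vanishes and equal to `1` near `p`, the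
Leibniz rule for `χ * f = 0` leaves only `derivAlong w f`. -/
theorem derivAlong_eq_zero_of_eventually {p : M} (w : TVec n p) {f : SmoothFun n M}
    (hf : ∀ᶠ q in 𝓝 p, f q = 0) : derivAlong w f = 0 := by
  obtain ⟨χ, h1, h2⟩ := exists_cutoff (n := n) hf
  have h : χ * f = 0 := by
    ext q
    by_cases hq : q ∈ tsupport χ
    · simp [show f q = 0 from h2 hq]
    · simp [image_eq_zero_of_notMem_tsupport hq]
  have h3 := derivAlong_mul w χ f
  rw [h, h1.self_of_nhds, hf.self_of_nhds] at h3
  have h0 : derivAlong w (0 : SmoothFun n M) = 0 := map_zero w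
  rw [h0] at h3
  linarith

theorem derivAlong_congr {p : M} (w : TVec n p) {f g : SmoothFun n M}
    (h : ∀ᶠ q in 𝓝 p, f q = g q) : derivAlong w f = derivAlong w g := by
  rw [← sub_eq_zero, ← derivAlong_sub]
  exact derivAlong_eq_zero_of_eventually w (h.mono fun q hq => by simp [hq])

theorem VField.apply_congr (u : VField n M) {p : M} {f g : SmoothFun n M}
    (h : ∀ᶠ q in 𝓝 p, f q = g q) : u f p = u g p :=
  derivAlong_congr (valAt u p) h

end Germs

/-! ### Coordinates adapted to the hypersurfaces -/

section AdaptedFrame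

variable {n : ℕ} {M : Type*} [TopologicalSpace M]
  [ChartedSpace (EuclideanSpace ℝ (Fin (2 * n))) M] {ι : Type*}

variable (n) in
/-- Functions `y` which are coordinates on the open set `U`, with coordinate vector fields `D`,
such that `y i = 0` is the equation of `Z i` in `U` for `i ∈ T`, and `U` does not meet the other
hypersurfaces. -/
structure AdaptedFrame (Z : ι → Set M) (T : Finset ι) (d : ℕ) where
  U : Set M
  isOpen_U : IsOpen U
  y : T ⊕ Fin d → SmoothFun n M
  D : T ⊕ Fin d → VField n M
  mem_iff : ∀ q ∈ U, ∀ i : T, q ∈ Z i ↔ y (Sum.inl i) q = 0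
  notMem : ∀ q ∈ U, ∀ i ∉ T, q ∉ Z i
  mfderiv_ne_zero : ∀ q ∈ U, ∀ i : T, mfderiv (𝓡 (2 * n)) 𝓘(ℝ, ℝ) (y (Sum.inl i)) q ≠ 0
  D_self : ∀ q ∈ U, ∀ k, D k (y k) q = 1
  D_ne : ∀ q ∈ U, ∀ k l, k ≠ l → D k (y l) q = 0
  derivAlong_eq : ∀ q ∈ U, ∀ (w : TVec n q) (f : SmoothFun n M),
    derivAlong w f = ∑ k, derivAlong w (y k) * D k f q
  exists_mul : ∀ (i : T) (f : SmoothFun n M), (∀ q ∈ U, q ∈ Z i → f q = 0) →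
    ∃ g : SmoothFun n M, ∀ q ∈ U, f q = g q * y (Sum.inl i) q
  -- A Fermat principle for coordinate directions along the intersection. The extremum may be that
  -- of a function constant on the intersection, so this also gives tangency to the hypersurfaces.
  D_eq_zero : ∀ q ∈ U, ∀ (k : T ⊕ Fin d) (T' : Set ι) (f : SmoothFun n M),
    (∀ i ∈ T', q ∈ Z i) → (∀ i : T, k = Sum.inl i → (i : ι) ∉ T') →
    IsLocalMaxOn f {r | ∀ i ∈ T', r ∈ Z i} q → D k f q = 0
  inl_mem : ∀ i : T, y (Sum.inl i) • D (Sum.inl i) ∈ logVF n Z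
  inr_mem : ∀ j : Fin d, D (Sum.inr j) ∈ logVF n Z

/-! ### Coordinate vector fields multiplied by a cut-off -/

section Construction

variable [T2Space M] [IsManifold (𝓡 (2 * n)) ∞ M] {κ : Type*} [Fintype κ] [DecidableEq κ]

/-- The coordinate vector field `∂/∂z_k` of the coordinates `R`, multiplied with a cut-off
function. -/
def coordVField (R : OpenPartialHomeomorph M (κ → ℝ))
    (hR : ContMDiffOn (𝓡 (2 * n)) 𝓘(ℝ, κ → ℝ) ∞ R R.source)
    (hR' : ContMDiffOn 𝓘(ℝ, κ → ℝ) (𝓡 (2 * n)) ∞ R.symm R.target)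
    (χ : SmoothFun n M) (hχ : tsupport χ ⊆ R.source) (k : κ) : VField n M :=
  have hc : ∀ f : SmoothFun n M, ContDiffOn ℝ ∞ (f ∘ R.symm) R.target := fun f =>
    contMDiffOn_iff_contDiffOn.1 (f.contMDiff.comp_contMDiffOn hR')
  have hd : ∀ f : SmoothFun n M, ∀ q ∈ R.source, DifferentiableAt ℝ (f ∘ R.symm) (R q) :=
    fun f q hq => ((hc f).contDiffAt (R.open_target.mem_nhds (R.map_source hq))).differentiableAt
      (by simp)
  -- Outside `R.source` the expression `fderiv ℝ (f ∘ R.symm) (R q)` has no meaning; the cut-off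
  -- makes the product zero there.
  have h0 : ∀ q, q ∉ R.source → χ q = 0 := fun q hq =>
    image_eq_zero_of_notMem_tsupport fun h => hq (hχ h)
  let e : κ → ℝ := Pi.single k 1
  have hadd : ∀ (f g : SmoothFun n M) (q : M), χ q * fderiv ℝ (f ∘ R.symm + g ∘ R.symm) (R q) e =
      χ q * fderiv ℝ (f ∘ R.symm) (R q) e + χ q * fderiv ℝ (g ∘ R.symm) (R q) e := by
    intro f g q
    by_cases hq : q ∈ R.source
    · rw [fderiv_add (hd f q hq) (hd g q hq), _root_.add_apply, mul_add]
    · simp [h0 q hq]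
  have hsmul : ∀ (r : ℝ) (f : SmoothFun n M) (q : M),
      χ q * fderiv ℝ (r • (f ∘ R.symm)) (R q) e =
      r * (χ q * fderiv ℝ (f ∘ R.symm) (R q) e) := by
    intro r f q
    by_cases hq : q ∈ R.source
    · rw [fderiv_const_smul (hd f q hq), _root_.smul_apply, smul_eq_mul]
      ring
    · simp [h0 q hq]
  have hmul : ∀ (f g : SmoothFun n M) (q : M),
      χ q * fderiv ℝ ((f ∘ R.symm) * (g ∘ R.symm)) (R q) e =
      f q * (χ q * fderiv ℝ (g ∘ R.symm) (R q) e) +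
        g q * (χ q * fderiv ℝ (f ∘ R.symm) (R q) e) := by
    intro f g q
    by_cases hq : q ∈ R.source
    · rw [fderiv_mul (hd f q hq) (hd g q hq)]
      simp [R.left_inv hq]
      ring
    · simp [h0 q hq]
  Derivation.mk'
    { toFun := fun f => cutoffMul χ R.open_source hχ
        (f := fun q => fderiv ℝ (f ∘ R.symm) (R q) e) (by
          have h1 : ContDiffOn ℝ ∞ (fun z => fderiv ℝ (f ∘ R.symm) z e) R.target :=
            ((hc f).fderiv_of_isOpen R.open_target (by simp)).clm_apply contDiffOn_const
          exact h1.contMDiffOn.comp hR fun q hq => R.map_source hq)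
      map_add' := fun f g => ContMDiffMap.ext (hadd f g)
      map_smul' := fun r f => ContMDiffMap.ext (hsmul r f) }
    (fun f g => ContMDiffMap.ext (hmul f g))

end Construction

end AdaptedFrame

/-! ### Charts with prescribed first coordinates -/

section Charts

variable {n : ℕ} {M : Type*} [TopologicalSpace M]
  [ChartedSpace (EuclideanSpace ℝ (Fin (2 * n))) M] [IsManifold (𝓡 (2 * n)) ∞ M]

/-- Independent linear forms are part of a system of linear coordinates. -/
theorem exists_equiv_of_linearIndependent {E : Type*} [NormedAddCommGroup E] [NormedSpace ℝ E]
    [FiniteDimensional ℝ E] {τ : Type*} [Fintype τ] {a : τ → E →L[ℝ] ℝ}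
    (ha : LinearIndependent ℝ a) :
    ∃ (d : ℕ) (A : E ≃L[ℝ] (τ ⊕ Fin d → ℝ)), Fintype.card τ + d = Module.finrank ℝ E ∧
      ∀ i v, A v (Sum.inl i) = a i v := by
  let b₀ := Module.Basis.sumExtend ha
  have hfin : Finite (τ ⊕ Module.Basis.sumExtendIndex ha) := Module.Finite.finite_basis b₀
  have : Finite (Module.Basis.sumExtendIndex ha) := 
    Finite.of_injective (Sum.inr : _ → τ ⊕ Module.Basis.sumExtendIndex ha) Sum.inr_injective
  obtain ⟨N, ⟨φ⟩⟩ := Finite.exists_equiv_fin (Module.Basis.sumExtendIndex ha)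
  let b := b₀.reindex ((Equiv.refl τ).sumCongr φ)
  have hb : ∀ i, b (Sum.inl i) = a i := by
    intro i
    simp only [b, b₀, Module.Basis.sumExtend, Module.Basis.reindex_apply]
    simp
    rfl
  have hdual : Module.finrank ℝ (E →L[ℝ] ℝ) = Module.finrank ℝ E := by
    rw [← (LinearMap.toContinuousLinearMap (𝕜 := ℝ) (E := E) (F' := ℝ)).finrank_eq]
    exact Subspace.dual_finrank_eq
  have hcard : Fintype.card τ + N =
      Module.finrank ℝ E := by
    rw [← hdual, Module.finrank_eq_card_basis b, Fintype.card_sum, Fintype.card_fin]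
  let A₀ : E →L[ℝ] (τ ⊕ Fin N → ℝ) :=
    ContinuousLinearMap.pi fun k => b k
  have hinj : LinearMap.ker A₀.toLinearMap = ⊥ := by
    rw [LinearMap.ker_eq_bot']
    intro v hv
    have h1 : ∀ k, b k v = 0 := fun k => congrFun hv k
    rw [SeparatingDual.eq_zero_iff_forall_dual_eq_zero (R := ℝ)]
    intro g
    have h2 := congrArg (fun g' : E →L[ℝ] ℝ => g' v) (b.sum_repr g)
    simp only [_root_.sum_apply, _root_.smul_apply, h1, smul_zero,
      Finset.sum_const_zero] at h2
    exact h2.symm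
  refine ⟨_, (LinearEquiv.ofInjectiveOfFinrankEq A₀.toLinearMap (LinearMap.ker_eq_bot.1 hinj)
    (by simp [← hcard])).toContinuousLinearEquiv, hcard, fun i v => ?_⟩
  change b (Sum.inl i) v = a i v
  rw [hb]

theorem exists_coordinates {p : M} {τ : Type*} [Fintype τ] {x : τ → SmoothFun n M}
    (hx : LinearIndependent ℝ (M := TangentSpace (𝓡 (2 * n)) p →L[ℝ] ℝ)
      (fun i => mfderiv (𝓡 (2 * n)) 𝓘(ℝ, ℝ) (x i) p)) {W : Set M} (hW : W ∈ 𝓝 p) :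
    ∃ (d : ℕ) (R : OpenPartialHomeomorph M (τ ⊕ Fin d → ℝ)), Fintype.card τ + d = 2 * n ∧
      p ∈ R.source ∧ R.source ⊆ W ∧ ContMDiffOn (𝓡 (2 * n)) 𝓘(ℝ, τ ⊕ Fin d → ℝ) ∞ R R.source ∧
      ContMDiffOn 𝓘(ℝ, τ ⊕ Fin d → ℝ) (𝓡 (2 * n)) ∞ R.symm R.target ∧
      ∀ q ∈ R.source, ∀ i, R q (Sum.inl i) = x i q := by
  let φ := chartAt (EuclideanSpace ℝ (Fin (2 * n))) p
  have hφ : ContMDiffOn (𝓡 (2 * n)) 𝓘(ℝ, EuclideanSpace ℝ (Fin (2 * n))) ∞ φ φ.source :=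
    contMDiffOn_chart
  have hφ' : ContMDiffOn 𝓘(ℝ, EuclideanSpace ℝ (Fin (2 * n))) (𝓡 (2 * n)) ∞ φ.symm φ.target :=
    contMDiffOn_chart_symm
  have hp : p ∈ φ.source := mem_chart_source _ p
  have hpt : φ p ∈ φ.target := φ.map_source hp
  have hxs : ∀ i, ContDiffOn ℝ ∞ (x i ∘ φ.symm) φ.target := fun i =>
    contMDiffOn_iff_contDiffOn.1 ((x i).contMDiff.comp_contMDiffOn hφ')
  have hfd : ∀ i, mfderiv (𝓡 (2 * n)) 𝓘(ℝ, ℝ) (x i) p = fderiv ℝ (x i ∘ φ.symm) (φ p) := by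
    intro i
    rw [((x i).contMDiff.mdifferentiableAt (by simp)).mfderiv]
    simp [writtenInExtChartAt, φ]
    rfl
  have ha : LinearIndependent ℝ fun i => fderiv ℝ (x i ∘ φ.symm) (φ p) := by
    have := hx
    simp only [hfd] at this
    exact this
  obtain ⟨d, A, hd, hA⟩ := exists_equiv_of_linearIndependent ha
  rw [finrank_euclideanSpace_fin] at hd
  -- The given functions are completed by linear coordinates. The derivative of `Ψ` at `φ p` is the
  -- isomorphism `A`, so the inverse function theorem applies.
  let Ψ : EuclideanSpace ℝ (Fin (2 * n)) → τ ⊕ Fin d → ℝ := fun z =>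
    Sum.elim (fun i => x i (φ.symm z)) (fun j => A z (Sum.inr j))
  have hΨ : ContDiffOn ℝ ∞ Ψ φ.target := by
    rw [contDiffOn_pi]
    rintro (i | j)
    · exact hxs i
    · exact ((contDiff_apply ℝ ℝ (Sum.inr j : τ ⊕ Fin d)).comp A.contDiff).contDiffOn
  have hΨ' : HasFDerivAt Ψ (A : EuclideanSpace ℝ (Fin (2 * n)) →L[ℝ] τ ⊕ Fin d → ℝ) (φ p) := by
    rw [hasFDerivAt_pi']
    rintro (i | j)
    · have h1 := (((hxs i).contDiffAt (φ.open_target.mem_nhds hpt)).differentiableAt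
        (by simp)).hasFDerivAt
      have h2 : (ContinuousLinearMap.proj (R := ℝ) (φ := fun _ : τ ⊕ Fin d => ℝ) (Sum.inl i)).comp
          (A : EuclideanSpace ℝ (Fin (2 * n)) →L[ℝ] τ ⊕ Fin d → ℝ) =
          fderiv ℝ (x i ∘ φ.symm) (φ p) := by
        ext v
        exact hA i v
      rw [h2]
      exact h1
    · exact ((ContinuousLinearMap.proj (R := ℝ) (φ := fun _ : τ ⊕ Fin d => ℝ)
        (Sum.inr j)).comp (A : EuclideanSpace ℝ (Fin (2 * n)) →L[ℝ] τ ⊕ Fin d → ℝ)).hasFDerivAt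
  have hΨp := hΨ.contDiffAt (φ.open_target.mem_nhds hpt)
  let G := hΨp.toOpenPartialHomeomorph Ψ hΨ' (by simp)
  have hG : ∀ z, G z = Ψ z := fun z => rfl
  -- The inverse function theorem gives smoothness of the inverse only where the derivative is
  -- invertible; restricting to the open set of such points makes `R.symm` smooth on its whole
  -- target.
  let O := φ.target ∩ fderiv ℝ Ψ ⁻¹' Set.range
    ((↑) : (EuclideanSpace ℝ (Fin (2 * n)) ≃L[ℝ] (τ ⊕ Fin d → ℝ)) → _ →L[ℝ] _)
  have hO : IsOpen O := (hΨ.continuousOn_fderiv_of_isOpen φ.open_target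
    (by simp)).isOpen_inter_preimage φ.open_target ContinuousLinearEquiv.isOpen
  let R := (φ.trans (G.restrOpen O hO)).restrOpen (interior W) isOpen_interior
  have hRs : ∀ q, q ∈ R.source ↔ (q ∈ φ.source ∧ φ q ∈ G.source ∧ φ q ∈ O) ∧ q ∈ interior W := by
    intro q
    simp [R]
  have hRq : ∀ q, R q = Ψ (φ q) := fun q => rfl
  have hRz : ∀ z, R.symm z = φ.symm (G.symm z) := fun z => rfl
  refine ⟨d, R, hd, ?_, ?_, ?_, ?_, ?_⟩
  · rw [hRs]
    exact ⟨⟨hp, hΨp.mem_toOpenPartialHomeomorph_source hΨ' _, hpt, A, hΨ'.fderiv.symm⟩,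
      mem_interior_iff_mem_nhds.2 hW⟩
  · intro q hq
    exact interior_subset ((hRs q).1 hq).2
  · exact hΨ.contMDiffOn.comp (hφ.mono fun q hq => ((hRs q).1 hq).1.1)
      fun q hq => φ.map_source ((hRs q).1 hq).1.1
  · intro z hz
    have h1 := (hRs _).1 (R.map_target hz)
    have h2 : z ∈ G.target ∧ G.symm z ∈ O := by
      have : z ∈ (G.restrOpen O hO).target := hz.1.1
      have h3 := (G.restrOpen O hO).map_target this
      have h4 := (G.restrOpen O hO).right_inv this
      rw [OpenPartialHomeomorph.restrOpen_source] at h3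
      exact ⟨h4 ▸ G.map_source h3.1, h3.2⟩
    obtain ⟨B, hB⟩ := h2.2.2
    have hzt := φ.open_target.mem_nhds h2.2.1
    have h3 : ContDiffAt ℝ ∞ G.symm z := by
      refine G.contDiffAt_symm h2.1 (f₀' := B) ?_ (hΨ.contDiffAt hzt)
      rw [hB]
      exact ((hΨ.contDiffAt hzt).differentiableAt (by simp)).hasFDerivAt
    exact (((hφ' _ h2.2.1).contMDiffAt hzt).comp z h3.contMDiffAt).contMDiffWithinAt
  · intro q hq i
    change x i (φ.symm (φ q)) = x i q
    rw [φ.left_inv ((hRs q).1 hq).1.1]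

end Charts

/-! ### Existence of adapted frames -/

section ExistsFrame

universe u

variable {n : ℕ} {M : Type*} [TopologicalSpace M]
  [ChartedSpace (EuclideanSpace ℝ (Fin (2 * n))) M] {ι : Type u}

/-- The coordinate derivatives of a function at a local maximum on a coordinate plane vanish in the
directions of the plane. -/
theorem fderiv_coord_eq_zero_of_isLocalMaxOn {κ : Type*} [Fintype κ] [DecidableEq κ]
    (R : OpenPartialHomeomorph M (κ → ℝ)) {q : M} (hq : q ∈ R.source) {f : M → ℝ}
    (hf : DifferentiableAt ℝ (f ∘ R.symm) (R q)) {Y : Set M} (k : κ)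
    (hY : ∀ q' ∈ R.source, (∀ l, l ≠ k → R q' l = R q l) → q' ∈ Y) (hmax : IsLocalMaxOn f Y q) :
    fderiv ℝ (f ∘ R.symm) (R q) (Pi.single k 1) = 0 := by
  let γ : ℝ → κ → ℝ := fun t => R q + t • Pi.single k 1
  have hγ : HasDerivAt γ (Pi.single k 1) 0 := by
    have := ((hasDerivAt_id (0 : ℝ)).smul_const (Pi.single k (1 : ℝ) : κ → ℝ)).const_add (R q)
    simpa only [id, one_smul] using! this
  have hγ0 : γ 0 = R q := by simp [γ]
  have h1 : HasDerivAt (fun t => (f ∘ R.symm) (γ t))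
      (fderiv ℝ (f ∘ R.symm) (R q) (Pi.single k 1)) 0 := by
    have h2 : HasFDerivAt (f ∘ R.symm) (fderiv ℝ (f ∘ R.symm) (R q)) (γ 0) := by
      rw [hγ0]
      exact hf.hasFDerivAt
    exact h2.comp_hasDerivAt 0 hγ
  refine IsLocalMax.hasDerivAt_eq_zero ?_ h1
  have htend : Filter.Tendsto (fun t => R.symm (γ t)) (𝓝 0) (𝓝[Y] q) := by
    rw [tendsto_nhdsWithin_iff]
    constructor
    · have h2 := (R.continuousAt_symm (R.map_source hq)).tendsto
      rw [R.left_inv hq] at h2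
      refine h2.comp ?_
      rw [← hγ0]
      exact hγ.continuousAt.tendsto
    · have h3 : ∀ᶠ t in 𝓝 (0 : ℝ), γ t ∈ R.target :=
        hγ.continuousAt.eventually (hγ0 ▸ R.open_target.mem_nhds (R.map_source hq))
      filter_upwards [h3] with t ht
      refine hY _ (R.map_target ht) fun l hl => ?_
      rw [R.right_inv ht]
      simp [γ, hl]
  have h4 := htend.eventually hmax
  simpa only [IsLocalMax, IsMaxFilter, Function.comp, hγ0, R.left_inv hq] using! h4

/-- The Hadamard lemmas above concern functions on the whole space. The gap between `r` and `r₀`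
leaves room for a bump function. -/
theorem exists_contDiff_eq_on_ball {κ : Type*} [Fintype κ] {c : κ → ℝ} {r r₀ : ℝ} (hr : 0 < r)
    (hr₀ : r < r₀) {f : (κ → ℝ) → ℝ} {O : Set (κ → ℝ)} (hO : IsOpen O)
    (hsub : Metric.ball c r₀ ⊆ O) (hf : ContDiffOn ℝ ∞ f O) :
    ∃ g : (κ → ℝ) → ℝ, ContDiff ℝ ∞ g ∧ ∀ z ∈ Metric.ball c r, g z = f z := by
  let B : ContDiffBump c := ⟨r, (r + r₀) / 2, hr, by linarith⟩
  refine ⟨fun z => B z * f z, ?_, fun z hz => ?_⟩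
  · rw [← contMDiff_iff_contDiff]
    apply contMDiff_of_tsupport
    intro z hz
    have h1 : z ∈ tsupport B := tsupport_mul_subset_left hz
    rw [B.tsupport_eq, Metric.mem_closedBall] at h1
    have h2 : z ∈ O := hsub (by
      rw [Metric.mem_ball]
      have : B.rOut = (r + r₀) / 2 := rfl
      linarith)
    exact (B.contDiff.contDiffAt.mul (hf.contDiffAt (hO.mem_nhds h2))).contMDiffAt
  · simp only
    rw [B.one_of_mem_closedBall (Metric.ball_subset_closedBall hz), one_mul]

variable [T2Space M] [IsManifold (𝓡 (2 * n)) ∞ M]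

/-- Complete the defining functions to a chart `R` and take for the domain the preimage `V r` of a
small ball on which the cut-off `χ` equals `1`. There the globally defined `y` and `D` are honest
coordinates and coordinate fields. -/
theorem exists_adaptedFrame_of_linearIndependent [Fintype ι] {Z : ι → Set M}
    (hZ : ∀ i, IsClosed (Z i)) {p : M} {T : Finset ι} (hp : ∀ i, p ∈ Z i ↔ i ∈ T)
    {x : T → SmoothFun n M} (hx : ∀ i : T, ∀ᶠ q in 𝓝 p, q ∈ Z i ↔ x i q = 0)
    (hli : LinearIndependent ℝ (M := TangentSpace (𝓡 (2 * n)) p →L[ℝ] ℝ)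
      (fun i => mfderiv (𝓡 (2 * n)) 𝓘(ℝ, ℝ) (x i) p)) :
    ∃ (d : ℕ) (F : AdaptedFrame n Z T d), T.card + d = 2 * n ∧ p ∈ F.U ∧
      ∀ i, F.y (Sum.inl i) = x i := by
  classical
  have hW : {q | (∀ i : T, q ∈ Z i ↔ x i q = 0) ∧ ∀ i ∉ T, q ∉ Z i} ∈ 𝓝 p := by
    refine (Filter.eventually_all.2 hx).and (Filter.eventually_all.2 fun i => ?_)
    by_cases hi : i ∈ T
    · simp [hi]
    · have : (Z i)ᶜ ∈ 𝓝 p := (hZ i).isOpen_compl.mem_nhds fun h => hi ((hp i).1 h)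
      filter_upwards [this] with q hq _ using hq
  obtain ⟨d, R, hd, hpR, hRW, hR, hR', hRx⟩ := exists_coordinates hli hW
  have hRc : ∀ f : SmoothFun n M, ContDiffOn ℝ ∞ (f ∘ R.symm) R.target := fun f =>
    contMDiffOn_iff_contDiffOn.1 (f.contMDiff.comp_contMDiffOn hR')
  have hRd : ∀ f : SmoothFun n M, ∀ q ∈ R.source, DifferentiableAt ℝ (f ∘ R.symm) (R q) :=
    fun f q hq => ((hRc f).contDiffAt (R.open_target.mem_nhds (R.map_source hq))).differentiableAt
      (by simp)
  obtain ⟨r₀, hr₀, hball⟩ := Metric.isOpen_iff.1 R.open_target (R p) (R.map_source hpR)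
  let V : ℝ → Set M := fun r => R.source ∩ R ⁻¹' Metric.ball (R p) r
  have hVo : ∀ r, IsOpen (V r) := fun r => R.isOpen_inter_preimage Metric.isOpen_ball
  have hVp : ∀ r > 0, p ∈ V r := fun r hr => ⟨hpR, Metric.mem_ball_self hr⟩
  obtain ⟨χ, hχ1, hχ⟩ := exists_cutoff (n := n) ((hVo r₀).mem_nhds (hVp r₀ hr₀))
  have hχR : tsupport χ ⊆ R.source := hχ.trans Set.inter_subset_left
  have hχ0 : ∀ q, q ∉ R.source → χ q = 0 := fun q hq =>
    image_eq_zero_of_notMem_tsupport fun h => hq (hχR h)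
  obtain ⟨r, hr, hrr, hχV⟩ : ∃ r > 0, r < r₀ ∧ ∀ q ∈ V r, χ q = 1 := by
    have h1 : ∀ᶠ z in 𝓝 (R p), χ (R.symm z) = 1 := by
      have := (R.continuousAt_symm (R.map_source hpR)).tendsto
      rw [R.left_inv hpR] at this
      exact this.eventually hχ1
    obtain ⟨r₁, hr₁, h2⟩ := Metric.eventually_nhds_iff_ball.1 h1
    refine ⟨min r₁ (r₀ / 2), by positivity, (min_le_right _ _).trans_lt (by linarith), ?_⟩
    rintro q ⟨hq, hq'⟩
    have := h2 _ (Metric.ball_subset_ball (min_le_left _ _) hq')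
    rwa [R.left_inv hq] at this
  let y : T ⊕ Fin d → SmoothFun n M := Sum.elim x fun j =>
    cutoffMul χ R.open_source hχR (f := fun q => R q (Sum.inr j)) fun q hq =>
      (contMDiffWithinAt_pi_space.1 (hR q hq)) (Sum.inr j)
  have hy : ∀ q ∈ V r, ∀ k, y k q = R q k := by
    rintro q hq (i | j)
    · exact (hRx q hq.1 i).symm
    · change χ q * R q (Sum.inr j) = _
      rw [hχV q hq, one_mul]
  let D := coordVField R hR hR' χ hχR
  have hD : ∀ k f q, D k f q = χ q * fderiv ℝ (f ∘ R.symm) (R q) (Pi.single k 1) :=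
    fun k f q => rfl
  have hext : ∀ f : SmoothFun n M, ∃ g : (T ⊕ Fin d → ℝ) → ℝ, ContDiff ℝ ∞ g ∧
      (∀ q ∈ V r, g (R q) = f q) ∧
      ∀ q ∈ V r, ∀ k, fderiv ℝ g (R q) (Pi.single k 1) = D k f q := by
    intro f
    obtain ⟨g, hg, hgf⟩ := exists_contDiff_eq_on_ball hr hrr R.open_target hball (hRc f)
    refine ⟨g, hg, fun q hq => ?_, fun q hq k => ?_⟩
    · rw [hgf _ hq.2, Function.comp, R.left_inv hq.1]
    · rw [hD, hχV q hq, one_mul]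
      congr 1
      apply Filter.EventuallyEq.fderiv_eq
      filter_upwards [Metric.isOpen_ball.mem_nhds hq.2] with z hz using hgf z hz
  have hpull : ∀ g : (T ⊕ Fin d → ℝ) → ℝ, ContDiff ℝ ∞ g →
      ∃ f : SmoothFun n M, ∀ q ∈ V r, f q = g (R q) := by
    intro g hg
    refine ⟨cutoffMul χ R.open_source hχR (f := g ∘ R) (hg.contMDiff.comp_contMDiffOn hR), ?_⟩
    intro q hq
    change χ q * g (R q) = _
    rw [hχV q hq, one_mul]
  have hDy : ∀ q ∈ V r, ∀ k l, D k (y l) q = (Pi.single k 1 : T ⊕ Fin d → ℝ) l := by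
    intro q hq k l
    rw [hD, hχV q hq, one_mul]
    have h1 : y l ∘ R.symm =ᶠ[𝓝 (R q)]
        (ContinuousLinearMap.proj (R := ℝ) (φ := fun _ : T ⊕ Fin d => ℝ) l) := by
      filter_upwards [Metric.isOpen_ball.mem_nhds hq.2] with z hz
      have hz' : z ∈ R.target := hball (Metric.ball_subset_ball hrr.le hz)
      have h2 : R.symm z ∈ V r := ⟨R.map_target hz', by
        rw [Set.mem_preimage, R.right_inv hz']
        exact hz⟩
      rw [Function.comp, hy _ h2, R.right_inv hz']
      rfl
    rw [h1.fderiv_eq, ContinuousLinearMap.fderiv]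
    rfl
  have hDmax : ∀ (q : M) (k : T ⊕ Fin d) (T' : Set ι) (f : SmoothFun n M),
      (∀ i ∈ T', q ∈ Z i) → (∀ i : T, k = Sum.inl i → (i : ι) ∉ T') →
      IsLocalMaxOn f {r | ∀ i ∈ T', r ∈ Z i} q → D k f q = 0 := by
    intro q k T' f hq hk hmax
    rw [hD]
    by_cases hqR : q ∈ R.source
    · rw [fderiv_coord_eq_zero_of_isLocalMaxOn R hqR (hRd f q hqR) k ?_ hmax, mul_zero]
      intro q' hq' hqq' i hi
      have hiT : i ∈ T := by
        by_contra h
        exact (hRW hqR).2 i h (hq i hi)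
      rw [(hRW hq').1 ⟨i, hiT⟩, ← hRx q' hq', hqq' _ fun h => hk ⟨i, hiT⟩ h.symm hi, hRx q hqR]
      exact ((hRW hqR).1 ⟨i, hiT⟩).1 (hq i hi)
    · rw [hχ0 q hqR, zero_mul]
  have hDvan : ∀ (q : M) (k : T ⊕ Fin d) (i : ι) (f : SmoothFun n M), q ∈ Z i →
      (∀ i' : T, k = Sum.inl i' → (i' : ι) ≠ i) → (∀ q' ∈ Z i, f q' = 0) → D k f q = 0 := by
    intro q k i f hq hk hf
    refine hDmax q k {i} f (by simpa using hq) (by simpa using hk) ?_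
    -- A function vanishing on `Z i` is constant there, hence has a local maximum on `Z i` at each
    -- of its points.
    filter_upwards [self_mem_nhdsWithin] with q' hq'
    rw [hf q hq, hf q' (hq' i rfl)]
  refine ⟨d, ⟨V r, hVo r, y, D, ?_, ?_, ?_, ?_, ?_, ?_, ?_, ?_, ?_, ?_⟩, by simpa using hd, hVp r hr,
    fun i => rfl⟩
  · exact fun q hq i => (hRW hq.1).1 i
  · exact fun q hq i hi => (hRW hq.1).2 i hi
  · intro q hq i hi
    have h1 := hDy q hq (Sum.inl i) (Sum.inl i)
    have h2 : HasMFDerivAt (𝓡 (2 * n)) 𝓘(ℝ, ℝ) (y (Sum.inl i)) (R.symm (R q)) 0 := by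
      rw [R.left_inv hq.1, ← hi]
      exact ((y (Sum.inl i)).contMDiff.mdifferentiableAt (by simp)).hasMFDerivAt
    have hRt := R.map_source hq.1
    have h3 := h2.comp (R q) (((hR' _ hRt).contMDiffAt (R.open_target.mem_nhds hRt)).mdifferentiableAt
      (by simp)).hasMFDerivAt
    have h4 : fderiv ℝ (y (Sum.inl i) ∘ R.symm) (R q) = 0 := by
      rw [← mfderiv_eq_fderiv, h3.mfderiv]
      exact ContinuousLinearMap.zero_comp _
    rw [hD, h4, Pi.single_eq_same] at h1
    simp at h1
  · intro q hq k
    rw [hDy q hq, Pi.single_eq_same]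
  · intro q hq k l hkl
    rw [hDy q hq, Pi.single_eq_of_ne hkl.symm]
  · intro q hq w f
    obtain ⟨g, hg, hgf, hgD⟩ := hext f
    obtain ⟨h, hh, hgh, hhD⟩ := exists_contDiff_eq_add_sum hg (R q)
    choose h' hh' using fun k => hpull (h k) (hh k)
    let c : T ⊕ Fin d → SmoothFun n M := fun k => algebraMap ℝ _ (y k q)
    have hc : ∀ k q', c k q' = y k q := fun k q' => rfl
    -- Hadamard's expansion at `q`. A derivation kills the constants, and the factors `y k - c k`
    -- vanish at `q`, so only the first-order terms survive.
    have h1 : ∀ᶠ q' in 𝓝 q, f q' =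
        (algebraMap ℝ (SmoothFun n M) (f q) + ∑ k, (y k - c k) * h' k) q' := by
      filter_upwards [(hVo r).mem_nhds hq] with q' hq'
      rw [← hgf q' hq', hgh, hgf q hq]
      simp only [ContMDiffMap.coe_add, Pi.add_apply]
      congr 1
      rw [← ContMDiffMap.coeFnAddMonoidHom_apply, map_sum, Finset.sum_apply]
      refine Finset.sum_congr rfl fun k _ => ?_
      simp [hc, hy q hq, hy q' hq', hh' k q' hq']
    rw [derivAlong_congr w h1, derivAlong_add, derivAlong_algebraMap, zero_add, derivAlong_sum]
    refine Finset.sum_congr rfl fun k _ => ?_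
    rw [derivAlong_mul, derivAlong_sub, derivAlong_algebraMap, ← hgD q hq, ← hhD, ← hh' k q hq]
    simp [hc, mul_comm]
  · intro i f hf
    obtain ⟨g, hg, hgf, -⟩ := hext f
    obtain ⟨h, hh, hgh⟩ := exists_contDiff_eq_mul hg (Sum.inl i)
    obtain ⟨h', hh'⟩ := hpull h hh
    refine ⟨h', fun q hq => ?_⟩
    have hpi : R p (Sum.inl i) = 0 := by
      rw [hRx p hpR]
      exact ((hRW hpR).1 i).1 ((hp i).2 i.2)
    -- The ball is taken in the sup norm and its centre has `i`-th coordinate `0`, so replacing that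
    -- coordinate by `0` stays inside it.
    have hz : Function.update (R q) (Sum.inl i) 0 ∈ Metric.ball (R p) r := by
      have hq2 := hq.2
      rw [Set.mem_preimage, Metric.mem_ball, dist_pi_lt_iff hr] at hq2
      rw [Metric.mem_ball, dist_pi_lt_iff hr]
      intro k
      rcases eq_or_ne k (Sum.inl i) with rfl | hk
      · simpa [hpi] using hr
      · simpa [hk] using hq2 k
    have hz' := hball (Metric.ball_subset_ball hrr.le hz)
    have hq' : R.symm (Function.update (R q) (Sum.inl i) 0) ∈ V r :=
      ⟨R.map_target hz', by rwa [Set.mem_preimage, R.right_inv hz']⟩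
    have h0 : g (Function.update (R q) (Sum.inl i) 0) = 0 := by
      rw [← R.right_inv hz', hgf _ hq']
      apply hf _ hq'
      rw [(hRW hq'.1).1, ← hRx _ hq'.1, R.right_inv hz']
      simp
    rw [← hgf q hq, hgh, h0, zero_add, hh' q hq, hy q hq, mul_comm]
  · exact fun q _ => hDmax q
  · intro i i' f hf q hq
    change y (Sum.inl i) q * D (Sum.inl i) f q = 0
    by_cases hii : (i : ι) = i'
    · subst hii
      by_cases hqR : q ∈ R.source
      · have : y (Sum.inl i) q = 0 := ((hRW hqR).1 i).1 hq
        rw [this, zero_mul]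
      · rw [hD, hχ0 q hqR, zero_mul, mul_zero]
    · rw [hDvan q _ i' f hq (by rintro j hj; cases hj; exact hii) hf, mul_zero]
  · intro j i f hf q hq
    exact hDvan q _ i f hq (by simp) hf

end ExistsFrame

section Frames

universe u

variable {n : ℕ} {M : Type*} [TopologicalSpace M]
  [ChartedSpace (EuclideanSpace ℝ (Fin (2 * n))) M] {ι : Type u} {Z : ι → Set M}

/-! ### Defining functions -/

/-- The differential of a smooth function, as a linear form. -/
def diffAt (f : SmoothFun n M) (p : M) : TangentSpace (𝓡 (2 * n)) p →L[ℝ] ℝ :=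
  mfderiv (𝓡 (2 * n)) 𝓘(ℝ, ℝ) f p

theorem diffAt_mul_of_eq_zero {p : M} (g f : SmoothFun n M) (hf : f p = 0) :
    diffAt (g * f) p = g p • diffAt f p := by
  have h := (g.contMDiff.mdifferentiableAt (x := p) (by simp)).hasMFDerivAt.mul
    (f.contMDiff.mdifferentiableAt (x := p) (by simp)).hasMFDerivAt
  have key : ∀ A B : TangentSpace (𝓡 (2 * n)) p →L[ℝ] ℝ, g p • A + f p • B = g p • A := by
    intro A B
    rw [hf, zero_smul, add_zero]
  exact h.mfderiv.trans (key (diffAt f p) (diffAt g p))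

theorem diffAt_congr {p : M} {x x' : SmoothFun n M} (h : ∀ᶠ q in 𝓝 p, x' q = x q) :
    diffAt x' p = diffAt x p :=
  Filter.EventuallyEq.mfderiv_eq h

theorem IsDefiningNear.eq_zero {Y : Set M} {p : M} {x : SmoothFun n M}
    (hx : IsDefiningNear Y p x) (hp : p ∈ Y) : x p = 0 :=
  hx.1.self_of_nhds.1 hp

theorem IsDefiningNear.mul_left {Y : Set M} {p : M} {g x : SmoothFun n M}
    (hx : IsDefiningNear Y p x) (hg : g p ≠ 0) : IsDefiningNear Y p (g * x) := by
  refine ⟨?_, fun hp h0 => hx.2 hp ?_⟩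
  · filter_upwards [hx.1, g.contMDiff.continuous.continuousAt.eventually_ne hg] with q h1 h2
    rw [h1]
    simp [h2]
  · have h1 := (diffAt_mul_of_eq_zero g x (hx.eq_zero hp)).symm.trans h0
    exact (smul_eq_zero.1 h1).resolve_left hg

variable [T2Space M] [IsManifold (𝓡 (2 * n)) ∞ M]

theorem exists_inv_eventually {p : M} {g : SmoothFun n M} (hg : g p ≠ 0) :
    ∃ g' : SmoothFun n M, ∀ᶠ q in 𝓝 p, g q * g' q = 1 := by
  have hU : IsOpen {q | g q ≠ 0} := isOpen_ne_fun g.contMDiff.continuous continuous_const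
  obtain ⟨g', hg'⟩ := exists_smoothFun_eventuallyEq (n := n) hU hg
    (f := fun q => (g q)⁻¹) fun q hq => ((contDiffAt_inv ℝ hq).contMDiffAt.comp q
      g.contMDiff.contMDiffAt).contMDiffWithinAt
  refine ⟨g', ?_⟩
  filter_upwards [hg', hU.mem_nhds hg] with q h1 h2
  rw [h1, mul_inv_cancel₀ h2]

/-- Tangency is tested on functions vanishing on a whole hypersurface; cutting off makes it
applicable to functions that vanish on it only near `p`. -/
theorem exists_eq_of_vanishing_near {p : M} {Y : Set M} {f : SmoothFun n M}
    (hf : ∀ᶠ q in 𝓝 p, q ∈ Y → f q = 0) :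
    ∃ g : SmoothFun n M, (∀ q ∈ Y, g q = 0) ∧ ∀ᶠ q in 𝓝 p, g q = f q := by
  obtain ⟨χ, h1, h2⟩ := exists_cutoff (n := n) hf
  refine ⟨χ * f, fun q hq => ?_, ?_⟩
  · by_cases h : q ∈ tsupport χ
    · simp [h2 h hq]
    · simp [image_eq_zero_of_notMem_tsupport h]
  · filter_upwards [h1] with q hq
    simp [hq]

theorem derivAlong_eq_zero_of_mem_strTangent {S : Set ι} {p : M} {w : TVec n p}
    (hw : w ∈ strTangent Z S p) {s : ι} (hs : s ∈ S) {f : SmoothFun n M}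
    (hf : ∀ᶠ q in 𝓝 p, q ∈ Z s → f q = 0) : derivAlong w f = 0 := by
  obtain ⟨g, hg, hgf⟩ := exists_eq_of_vanishing_near hf
  rw [← derivAlong_congr w hgf]
  exact hw s hs g hg

theorem logVF_apply_eq_zero (u : logVF n Z) {s : ι} {p : M} (hp : p ∈ Z s) {f : SmoothFun n M}
    (hf : ∀ᶠ q in 𝓝 p, q ∈ Z s → f q = 0) : (u : VField n M) f p = 0 :=
  derivAlong_eq_zero_of_mem_strTangent (S := {s}) (logVF_at_mem Z {s} p (by simpa using hp) u)
    (Set.mem_singleton s) hf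

/-! ### Division by the equation of a hypersurface -/

namespace AdaptedFrame

variable {T : Finset ι} {d : ℕ} (F : AdaptedFrame n Z T d)

theorem mem_nhds {q : M} (hq : q ∈ F.U) : F.U ∈ 𝓝 q :=
  F.isOpen_U.mem_nhds hq

theorem mem_of_mem {q : M} (hq : q ∈ F.U) {i : ι} (hi : q ∈ Z i) : i ∈ T := by
  by_contra h
  exact F.notMem q hq i h hi

/-- Off the hypersurface one divides. On it, differentiating `f * y = 0` along the dual coordinate
field gives `f = 0`. No density argument is needed. -/
theorem eventually_eq_zero_of_mul {q : M} (hq : q ∈ F.U) (i : T) {f : SmoothFun n M}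
    (hf : ∀ᶠ r in 𝓝 q, f r * F.y (Sum.inl i) r = 0) : ∀ᶠ r in 𝓝 q, f r = 0 := by
  filter_upwards [hf.eventually_nhds, F.mem_nhds hq] with r hr hrU
  have h1 : derivAlong (valAt (F.D (Sum.inl i)) r) (f * F.y (Sum.inl i)) = 0 :=
    derivAlong_eq_zero_of_eventually _ hr
  rw [derivAlong_mul, derivAlong_valAt, F.D_self r hrU] at h1
  rcases mul_eq_zero.1 hr.self_of_nhds with h | h
  · exact h
  · simpa [h] using h1

theorem exists_mul_eventually {q : M} (hq : q ∈ F.U) (i : T) {f : SmoothFun n M}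
    (hf : ∀ᶠ r in 𝓝 q, r ∈ Z i → f r = 0) :
    ∃ g : SmoothFun n M, ∀ᶠ r in 𝓝 q, f r = g r * F.y (Sum.inl i) r := by
  obtain ⟨f', hf', hff'⟩ := exists_eq_of_vanishing_near hf
  obtain ⟨g, hg⟩ := F.exists_mul i f' fun r _ hr => hf' r hr
  refine ⟨g, ?_⟩
  filter_upwards [hff', F.mem_nhds hq] with r h1 h2
  rw [← h1, hg r h2]

theorem isDefiningNear {q : M} (hq : q ∈ F.U) (i : T) :
    IsDefiningNear (Z i) q (F.y (Sum.inl i)) :=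
  ⟨Filter.mem_of_superset (F.mem_nhds hq) fun r hr => F.mem_iff r hr i,
    fun _ => F.mfderiv_ne_zero q hq i⟩

/-- Division gives `x = g * y`. At `q` this yields `dx = g q • dy`, so `g q = 0` would contradict
`dx ≠ 0`. -/
theorem exists_unit_mul {q : M} (hq : q ∈ F.U) {i : T} (hi : q ∈ Z i) {x : SmoothFun n M}
    (hx : IsDefiningNear (Z i) q x) :
    ∃ g : SmoothFun n M, g q ≠ 0 ∧ ∀ᶠ r in 𝓝 q, x r = g r * F.y (Sum.inl i) r := by
  obtain ⟨g, hg⟩ := F.exists_mul_eventually hq i (f := x) (hx.1.mono fun r hr => hr.1)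
  refine ⟨g, fun h0 => hx.2 hi ?_, hg⟩
  have h1 := diffAt_mul_of_eq_zero g (F.y (Sum.inl i)) (((F.mem_iff q hq i).1 hi))
  rw [h0, zero_smul] at h1
  exact (diffAt_congr (x := g * F.y (Sum.inl i)) hg).trans h1

end AdaptedFrame

/-! ### Adapted frames with given defining functions -/

theorem IsNormalCrossing.exists_adaptedFrame_aux [Fintype ι] (hZ : IsNormalCrossing n Z) {p : M}
    {T : Finset ι} (hp : ∀ i, p ∈ Z i ↔ i ∈ T) :
    ∃ (d : ℕ) (F : AdaptedFrame n Z T d), T.card + d = 2 * n ∧ p ∈ F.U ∧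
      LinearIndependent ℝ (fun i : T => diffAt (F.y (Sum.inl i)) p) := by
  obtain ⟨x, hx, hli⟩ := hZ.2 p
  have hli' : LinearIndependent ℝ (fun i : T => diffAt (x i) p) :=
    hli.comp (fun i : T => (⟨i, (hp i).2 i.2⟩ : {i // p ∈ Z i})) fun i j h =>
      Subtype.ext (congrArg (fun z : {i // p ∈ Z i} => (z : ι)) h)
  obtain ⟨d, F, hd, hpU, hy⟩ := exists_adaptedFrame_of_linearIndependent hZ.1 hp
    (x := fun i => x i) (fun i => (hx i ((hp i).2 i.2)).1) hli'
  refine ⟨d, F, hd, hpU, ?_⟩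
  simpa only [hy] using hli'

/-- Any defining functions of the hypersurfaces through a point are part of a system of adapted
coordinates. -/
theorem IsNormalCrossing.exists_adaptedFrame [Fintype ι] (hZ : IsNormalCrossing n Z) {p : M}
    {T : Finset ι} (hp : ∀ i, p ∈ Z i ↔ i ∈ T) {x : T → SmoothFun n M}
    (hx : ∀ i : T, IsDefiningNear (Z i) p (x i)) :
    ∃ (d : ℕ) (F : AdaptedFrame n Z T d), T.card + d = 2 * n ∧ p ∈ F.U ∧
      ∀ i, F.y (Sum.inl i) = x i := by
  obtain ⟨d, F, -, hpU, hli⟩ := hZ.exists_adaptedFrame_aux hp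
  choose g hg hgx using fun i : T => F.exists_unit_mul hpU ((hp i).2 i.2) (hx i)
  refine exists_adaptedFrame_of_linearIndependent hZ.1 hp (fun i => (hx i).1) ?_
  have h := hli.units_smul fun i => Units.mk0 (g i p) (hg i)
  have h1 : (fun i => diffAt (x i) p) =
      (fun i => Units.mk0 (g i p) (hg i)) • fun i : T => diffAt (F.y (Sum.inl i)) p := by
    ext1 i
    exact (diffAt_congr (x := g i * F.y (Sum.inl i)) (hgx i)).trans
      (diffAt_mul_of_eq_zero _ _ ((F.mem_iff p hpU i).1 ((hp i).2 i.2)))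
  rw [← h1] at h
  exact h

/-- Any defining function of a hypersurface is part of a system of adapted coordinates. -/
theorem IsNormalCrossing.exists_adaptedFrame_of_isDefiningNear [Fintype ι]
    (hZ : IsNormalCrossing n Z) {p : M} {s : ι} (hs : p ∈ Z s) {x : SmoothFun n M}
    (hx : IsDefiningNear (Z s) p x) :
    ∃ (T : Finset ι) (d : ℕ) (F : AdaptedFrame n Z T d) (hsT : s ∈ T), p ∈ F.U ∧
      F.y (Sum.inl ⟨s, hsT⟩) = x := by
  classical
  obtain ⟨x', hx', -⟩ := hZ.2 p
  let T : Finset ι := {i | p ∈ Z i}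
  have hT : ∀ i, p ∈ Z i ↔ i ∈ T := fun i => by simp [T]
  obtain ⟨d, F, -, hpU, hy⟩ := hZ.exists_adaptedFrame hT (x := fun i => if i = s then x else x' i)
    (by
      intro i
      split_ifs with h
      · rw [h]
        exact hx
      · exact hx' i ((hT i).2 i.2))
  exact ⟨T, d, F, (hT s).1 hs, hpU, by simp [hy]⟩

theorem IsNormalCrossing.exists_adaptedFrame_of_mem [Fintype ι] (hZ : IsNormalCrossing n Z) (p : M) :
    ∃ (T : Finset ι) (d : ℕ) (F : AdaptedFrame n Z T d), p ∈ F.U ∧ ∀ i, p ∈ Z i ↔ i ∈ T := by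
  classical
  let T : Finset ι := {i | p ∈ Z i}
  have hT : ∀ i, p ∈ Z i ↔ i ∈ T := fun i => by simp [T]
  obtain ⟨d, F, -, hpU, -⟩ := hZ.exists_adaptedFrame_aux hT
  exact ⟨T, d, F, hpU, hT⟩

theorem IsNormalCrossing.eventually_eq_zero_of_mul [Fintype ι] (hZ : IsNormalCrossing n Z) {p : M}
    {s : ι} {x : SmoothFun n M} (hx : IsDefiningNear (Z s) p x) {f : SmoothFun n M}
    (hf : ∀ᶠ q in 𝓝 p, f q * x q = 0) : ∀ᶠ q in 𝓝 p, f q = 0 := by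
  by_cases hp : p ∈ Z s
  · obtain ⟨T, d, F, hsT, hpU, rfl⟩ := hZ.exists_adaptedFrame_of_isDefiningNear hp hx
    exact F.eventually_eq_zero_of_mul hpU _ hf
  · have h0 : x p ≠ 0 := fun h => hp (hx.1.self_of_nhds.2 h)
    filter_upwards [hf, x.contMDiff.continuous.continuousAt.eventually_ne h0] with q h1 h2
    exact (mul_eq_zero.1 h1).resolve_right h2

/-- Tangency makes `u x` vanish on `Z s`, hence divisible by `x`. The quotient is `dx/x (u)`, smooth
across the hypersurface. -/
theorem IsNormalCrossing.exists_apply_eq_mul [Fintype ι] (hZ : IsNormalCrossing n Z) {p : M}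
    {s : ι} {x : SmoothFun n M} (hx : IsDefiningNear (Z s) p x) (u : logVF n Z) :
    ∃ k : SmoothFun n M, ∀ᶠ q in 𝓝 p, (u : VField n M) x q = k q * x q := by
  by_cases hp : p ∈ Z s
  · obtain ⟨T, d, F, hsT, hpU, rfl⟩ := hZ.exists_adaptedFrame_of_isDefiningNear hp hx
    refine F.exists_mul_eventually hpU ⟨s, hsT⟩ ?_
    filter_upwards [F.mem_nhds hpU] with q hq hqs
    exact logVF_apply_eq_zero u hqs
      (Filter.mem_of_superset (F.mem_nhds hq) fun r hr => (F.mem_iff r hr ⟨s, hsT⟩).1)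
  · have h0 : x p ≠ 0 := fun h => hp (hx.1.self_of_nhds.2 h)
    obtain ⟨g, hg⟩ := exists_inv_eventually h0
    refine ⟨(u : VField n M) x * g, ?_⟩
    filter_upwards [hg] with q hq
    simp only [ContMDiffMap.coe_mul, Pi.mul_apply]
    rw [mul_assoc, mul_comm (g q), hq, mul_one]

end Frames

section Tensoriality

universe u

variable {n : ℕ} {M : Type*} [TopologicalSpace M]
  [ChartedSpace (EuclideanSpace ℝ (Fin (2 * n))) M] {ι : Type u} {Z : ι → Set M}

/-! ### Frames of the log tangent bundle and values of log forms -/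

theorem SmoothFun.sum_apply {α : Type*} (s : Finset α) (f : α → SmoothFun n M) (q : M) :
    (∑ i ∈ s, f i) q = ∑ i ∈ s, f i q := by
  rw [← ContMDiffMap.coeFnAddMonoidHom_apply, map_sum, Finset.sum_apply]
  rfl

theorem logVF_sum_apply {α : Type*} (s : Finset α) (u : α → logVF n Z) (f : SmoothFun n M) (q : M) :
    ((∑ i ∈ s, u i : logVF n Z) : VField n M) f q = ∑ i ∈ s, (u i : VField n M) f q := by
  rw [AddSubmonoidClass.coe_finsetSum, ← Derivation.coeFnAddMonoidHom_apply, map_sum,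
    Finset.sum_apply, SmoothFun.sum_apply]
  rfl

theorem logVF_smul_apply (g : SmoothFun n M) (u : logVF n Z) (f : SmoothFun n M) (q : M) :
    ((g • u : logVF n Z) : VField n M) f q = g q * (u : VField n M) f q :=
  rfl

theorem logVF_sub_apply (u v : logVF n Z) (f : SmoothFun n M) (q : M) :
    ((u - v : logVF n Z) : VField n M) f q = (u : VField n M) f q - (v : VField n M) f q :=
  rfl

theorem logVF_add_apply (u v : logVF n Z) (f : SmoothFun n M) (q : M) :
    ((u + v : logVF n Z) : VField n M) f q = (u : VField n M) f q + (v : VField n M) f q :=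
  rfl

theorem logVF_bracket_apply (u v : logVF n Z) (f : SmoothFun n M) (q : M) :
    ((⁅u, v⁆ : logVF n Z) : VField n M) f q =
      (u : VField n M) ((v : VField n M) f) q - (v : VField n M) ((u : VField n M) f) q := by
  change (⁅(u : VField n M), (v : VField n M)⁆ : VField n M) f q = _
  rw [Derivation.commutator_apply]
  rfl

variable [T2Space M] [IsManifold (𝓡 (2 * n)) ∞ M]

/-- Linearity over smooth functions makes log forms local: `χ • u = 0` for a cut-off `χ` equal to
`1` near `q`. -/
theorem logOneForm_eq_zero_of_eventually (α : LogOneForm n Z) {u : logVF n Z} {q : M}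
    (hu : ∀ᶠ r in 𝓝 q, ∀ f : SmoothFun n M, (u : VField n M) f r = 0) : α u q = 0 := by
  obtain ⟨χ, h1, h2⟩ := exists_cutoff (n := n) hu
  have h3 : χ • u = 0 := by
    apply Subtype.ext
    ext f r
    change χ r * (u : VField n M) f r = 0
    by_cases hr : r ∈ tsupport χ
    · rw [show (u : VField n M) f r = 0 from h2 hr f, mul_zero]
    · rw [image_eq_zero_of_notMem_tsupport hr, zero_mul]
  have h4 : χ q * α u q = 0 := by
    have := congrArg (fun f : SmoothFun n M => f q) (α.map_smul χ u)
    rw [h3, map_zero] at this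
    exact this.symm
  rwa [h1.self_of_nhds, one_mul] at h4

theorem logOneForm_congr (α : LogOneForm n Z) {u v : logVF n Z} {q : M}
    (h : ∀ᶠ r in 𝓝 q, ∀ f : SmoothFun n M, (u : VField n M) f r = (v : VField n M) f r) :
    α u q = α v q := by
  have h1 := logOneForm_eq_zero_of_eventually α (u := u - v) (q := q) (by
    filter_upwards [h] with r hr f
    rw [logVF_sub_apply, hr f, sub_self])
  have h2 : α (u - v) = α u - α v := map_sub α u v
  rw [h2] at h1
  exact sub_eq_zero.1 h1

namespace AdaptedFrame

variable {T : Finset ι} {d : ℕ} (F : AdaptedFrame n Z T d)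

/-- The frame of the log tangent bundle given by `y i • ∂/∂y i` for `i ∈ T` and the other coordinate
vector fields. -/
def E : T ⊕ Fin d → logVF n Z :=
  Sum.elim (fun i => ⟨_, F.inl_mem i⟩) fun j => ⟨_, F.inr_mem j⟩

theorem E_inl_apply (i : T) (f : SmoothFun n M) (q : M) :
    (F.E (Sum.inl i) : VField n M) f q = F.y (Sum.inl i) q * F.D (Sum.inl i) f q :=
  rfl

theorem E_inr_apply (j : Fin d) (f : SmoothFun n M) (q : M) :
    (F.E (Sum.inr j) : VField n M) f q = F.D (Sum.inr j) f q :=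
  rfl

theorem exists_coef_inl (u : logVF n Z) (i : T) : ∃ k : SmoothFun n M,
    ∀ q ∈ F.U, (u : VField n M) (F.y (Sum.inl i)) q = k q * F.y (Sum.inl i) q :=
  F.exists_mul i _ fun _ hq hqi => logVF_apply_eq_zero u hqi
    (Filter.mem_of_superset (F.mem_nhds hq) fun r hr => (F.mem_iff r hr i).1)

/-- The coefficients of a log vector field with respect to the frame `E`. -/
def coef (u : logVF n Z) : T ⊕ Fin d → SmoothFun n M :=
  Sum.elim (fun i => (F.exists_coef_inl u i).choose) fun j => (u : VField n M) (F.y (Sum.inr j))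

theorem coef_inl_mul (u : logVF n Z) (i : T) {q : M} (hq : q ∈ F.U) :
    F.coef u (Sum.inl i) q * F.y (Sum.inl i) q = (u : VField n M) (F.y (Sum.inl i)) q :=
  ((F.exists_coef_inl u i).choose_spec q hq).symm

theorem coef_inr (u : logVF n Z) (j : Fin d) :
    F.coef u (Sum.inr j) = (u : VField n M) (F.y (Sum.inr j)) :=
  rfl

theorem coef_inl_eq {u : logVF n Z} {i : T} {q : M} (hq : q ∈ F.U) {k : SmoothFun n M}
    (hk : ∀ᶠ r in 𝓝 q, (u : VField n M) (F.y (Sum.inl i)) r = k r * F.y (Sum.inl i) r) :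
    ∀ᶠ r in 𝓝 q, F.coef u (Sum.inl i) r = k r := by
  have h := F.eventually_eq_zero_of_mul hq i (f := F.coef u (Sum.inl i) - k) (by
    filter_upwards [hk, F.mem_nhds hq] with r h1 h2
    have h3 := F.coef_inl_mul u i h2
    simp only [ContMDiffMap.coe_sub, Pi.sub_apply, sub_mul]
    rw [h3, h1, sub_self])
  filter_upwards [h] with r hr
  simpa [sub_eq_zero] using hr

theorem apply_eq_sum_coef (u : logVF n Z) (f : SmoothFun n M) {q : M} (hq : q ∈ F.U) :
    (u : VField n M) f q = ∑ k, F.coef u k q * (F.E k : VField n M) f q := by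
  rw [← derivAlong_valAt, F.derivAlong_eq q hq]
  refine Finset.sum_congr rfl fun k _ => ?_
  rcases k with i | j
  · rw [derivAlong_valAt, ← F.coef_inl_mul u i hq, E_inl_apply, mul_assoc]
  · rfl

theorem logOneForm_eq_sum (α : LogOneForm n Z) (u : logVF n Z) {q : M} (hq : q ∈ F.U) :
    α u q = ∑ k, F.coef u k q * α (F.E k) q := by
  rw [logOneForm_congr α (v := ∑ k, F.coef u k • F.E k) (q := q) (by
    filter_upwards [F.mem_nhds hq] with r hr f
    rw [F.apply_eq_sum_coef u f hr, logVF_sum_apply]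
    rfl), map_sum, SmoothFun.sum_apply]
  refine Finset.sum_congr rfl fun k _ => ?_
  rw [map_smul]
  rfl

/-- A log form at `q` sees only the frame coefficients at `q`. These, rather than `valAt u q`, are
the coordinates on the fibre of the log tangent bundle: on `Z i` the value loses the `E i`
component. -/
theorem logOneForm_congr_coef (α : LogOneForm n Z) {u v : logVF n Z} {q : M} (hq : q ∈ F.U)
    (h : ∀ k, F.coef u k q = F.coef v k q) : α u q = α v q := by
  rw [F.logOneForm_eq_sum α u hq, F.logOneForm_eq_sum α v hq]
  simp only [h]

-- For another defining function `x = g * y`, the quotient `E(x)/x` differs from `E(y)/y` by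
-- `E(g)/g`, which vanishes at `q` because `E` does. Hence the normalisation does not depend on the
-- defining function.
open Classical in
theorem isEulerAt_E {q : M} (hq : q ∈ F.U) (i : T) (hi : q ∈ Z i) :
    IsEulerAt Z i q (F.E (Sum.inl i)) := by
  have hyi := (F.mem_iff q hq i).1 hi
  constructor
  · apply TVec.ext_derivAlong
    intro f
    rw [derivAlong_valAt, E_inl_apply, hyi, zero_mul]
    rfl
  · intro t ht x hx
    have htT := F.mem_of_mem hq ht
    obtain ⟨g, hg, hgx⟩ := F.exists_unit_mul hq (i := ⟨t, htT⟩) ht hx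
    obtain ⟨g', hg'⟩ := exists_inv_eventually hg
    have hδ : ∃ δ : SmoothFun n M, (∀ r ∈ F.U, (F.E (Sum.inl i) : VField n M)
        (F.y (Sum.inl ⟨t, htT⟩)) r = δ r * F.y (Sum.inl ⟨t, htT⟩) r) ∧
        δ q = if t = (i : ι) then 1 else 0 := by
      by_cases hti : t = i
      · subst hti
        refine ⟨1, fun r hr => ?_, by simp⟩
        rw [E_inl_apply, F.D_self r hr]
        simp
      · refine ⟨0, fun r hr => ?_, by simp [hti]⟩
        rw [E_inl_apply, F.D_ne r hr _ _ (by simpa [Subtype.ext_iff] using Ne.symm hti)]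
        simp
    obtain ⟨δ, hδ, hδq⟩ := hδ
    refine ⟨δ + (F.E (Sum.inl i) : VField n M) g * g', ?_, ?_⟩
    · filter_upwards [hgx.eventually_nhds, hg', F.mem_nhds hq] with r h1 h2 h3
      rw [VField.apply_congr _ (f := x) (g := g * F.y (Sum.inl ⟨t, htT⟩)) h1]
      rw [← derivAlong_valAt, derivAlong_mul, derivAlong_valAt, derivAlong_valAt, hδ r h3,
        h1.self_of_nhds]
      simp only [ContMDiffMap.coe_add, Pi.add_apply, ContMDiffMap.coe_mul, Pi.mul_apply]
      linear_combination (-(F.E (Sum.inl i) : VField n M) g r * F.y (Sum.inl ⟨t, htT⟩) r) * h2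
    · simp [hδq, E_inl_apply, hyi]

-- On the hypersurfaces through `q` the normalisation fixes the coefficients. The others vanish
-- because `e` does at `q`. An Euler element is thus unique in the fibre, which makes `cCoeff`
-- independent of its choice.
open Classical in
theorem coef_of_isEulerAt {q : M} (hq : q ∈ F.U) {s : ι} {e : logVF n Z} (he : IsEulerAt Z s q e) :
    (∀ t : T, F.coef e (Sum.inl t) q = if (t : ι) = s ∧ q ∈ Z t then 1 else 0) ∧
      ∀ j, F.coef e (Sum.inr j) q = 0 := by
  constructor
  · intro t
    by_cases ht : q ∈ Z t
    · obtain ⟨k, hk, hkq⟩ := he.2 t ht _ (F.isDefiningNear hq t)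
      have := (F.coef_inl_eq hq hk).self_of_nhds
      rw [this, hkq]
      simp [ht]
    · have h1 : F.y (Sum.inl t) q ≠ 0 := fun h => ht ((F.mem_iff q hq t).2 h)
      have h2 := F.coef_inl_mul e t hq
      rw [← derivAlong_valAt, he.1] at h2
      have h3 := (mul_eq_zero.1 (h2.trans rfl)).resolve_right h1
      rw [h3]
      simp [ht]
  · intro j
    rw [coef_inr, ← derivAlong_valAt, he.1]
    rfl

end AdaptedFrame

theorem IsLogSymplectic.skew {om : LogBilin n Z} (hom : IsLogSymplectic Z om) (u v : logVF n Z) :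
    om u v = -om v u := by
  have h := hom.alt (u + v)
  simp only [map_add, LinearMap.add_apply, hom.alt] at h
  rw [eq_neg_iff_add_eq_zero]
  rw [← h]
  abel

variable [Fintype ι]

theorem IsNormalCrossing.exists_isEulerAt (hZ : IsNormalCrossing n Z) {s : ι} {q : M}
    (hq : q ∈ Z s) : ∃ e : logVF n Z, IsEulerAt Z s q e := by
  obtain ⟨T, d, F, hqU, hT⟩ := hZ.exists_adaptedFrame_of_mem q
  exact ⟨_, F.isEulerAt_E hqU ⟨s, (hT s).1 hq⟩ hq⟩

theorem IsNormalCrossing.eq_of_isEulerAt (hZ : IsNormalCrossing n Z) {s : ι} {q : M}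
    {e e' : logVF n Z} (he : IsEulerAt Z s q e) (he' : IsEulerAt Z s q e') (α : LogOneForm n Z) :
    α e q = α e' q := by
  obtain ⟨T, d, F, hqU, hT⟩ := hZ.exists_adaptedFrame_of_mem q
  apply F.logOneForm_congr_coef α hqU
  have h1 := F.coef_of_isEulerAt hqU he
  have h2 := F.coef_of_isEulerAt hqU he'
  rintro (t | j)
  · rw [h1.1, h2.1]
  · rw [h1.2, h2.2]

theorem IsNormalCrossing.cCoeff_eq (hZ : IsNormalCrossing n Z) (om : LogBilin n Z)
    {s t : ι} {q : M} {e e' : logVF n Z} (he : IsEulerAt Z s q e) (he' : IsEulerAt Z t q e') :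
    cCoeff om s t q = om e e' q := by
  have h : ∃ e : logVF n Z × logVF n Z, IsEulerAt Z s q e.1 ∧ IsEulerAt Z t q e.2 :=
    ⟨(e, e'), he, he'⟩
  rw [cCoeff, dif_pos h]
  rw [hZ.eq_of_isEulerAt h.choose_spec.2 he' (om h.choose.1)]
  exact hZ.eq_of_isEulerAt h.choose_spec.1 he (om.flip e')

end Tensoriality

section Dlog

universe u

variable {n : ℕ} {M : Type*} [TopologicalSpace M]
  [ChartedSpace (EuclideanSpace ℝ (Fin (2 * n))) M] {ι : Type u} {Z : ι → Set M}

/-! ### The chain rule for derivations -/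

/-- The composition of a smooth function on `M` with a smooth function of a real variable. -/
def SmoothFun.post (φ : ℝ → ℝ) (hφ : ContDiff ℝ ∞ φ) (g : SmoothFun n M) : SmoothFun n M :=
  ⟨fun q => φ (g q), hφ.contMDiff.comp g.contMDiff⟩

/-- The chain rule, deduced from Hadamard's expansion of `φ` at `g q` and the Leibniz rule. -/
theorem derivAlong_post {φ : ℝ → ℝ} (hφ : ContDiff ℝ ∞ φ) (g : SmoothFun n M) {q : M}
    (w : TVec n q) : derivAlong w (g.post φ hφ) = deriv φ (g q) * derivAlong w g := by
  obtain ⟨H, hH, h1, h2⟩ := exists_contDiff_sub_eq hφ (a := fun _ => g q) contDiff_const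
  have h3 : g.post φ hφ = algebraMap ℝ (SmoothFun n M) (φ (g q)) +
      (g - algebraMap ℝ (SmoothFun n M) (g q)) *
        g.post (fun t => H t 1) (hH.clm_apply contDiff_const) := by
    ext r
    change φ (g r) = φ (g q) + (g r - g q) * H (g r) 1
    rw [h1 (g r), ← smul_eq_mul (g r - g q), ← map_smul, smul_eq_mul, mul_one]
  rw [h3, derivAlong_add, derivAlong_algebraMap, derivAlong_mul, derivAlong_sub,
    derivAlong_algebraMap]
  change 0 + ((g q - g q) * _ + H (g q) 1 * _) = _
  rw [h2 _ rfl, fderiv_apply_one_eq_deriv]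
  ring

/-- The exponential of a smooth function. -/
def SmoothFun.exp (g : SmoothFun n M) : SmoothFun n M :=
  g.post Real.exp Real.contDiff_exp

theorem SmoothFun.exp_apply (g : SmoothFun n M) (q : M) : g.exp q = Real.exp (g q) :=
  rfl

theorem derivAlong_exp (g : SmoothFun n M) {q : M} (w : TVec n q) :
    derivAlong w g.exp = Real.exp (g q) * derivAlong w g := by
  rw [SmoothFun.exp, derivAlong_post, Real.deriv_exp]

variable (Z) in
/-- The differential of a function, as a log 1-form. -/
def logDiff (g : SmoothFun n M) : LogOneForm n Z where
  toFun u := (u : VField n M) g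
  map_add' _ _ := rfl
  map_smul' _ _ := rfl

/-! ### The forms `dx/x` -/

variable [T2Space M] [IsManifold (𝓡 (2 * n)) ∞ M]

/-- Rescaling `x` by `exp g` adds `dg` to `dx/x`. This is the freedom that absorbs the exact part of
a residue. -/
theorem IsDlogDefining.mul_exp {s : ι} {ρ : M → ℝ} {lam : LogOneForm n Z}
    (h : IsDlogDefining Z s ρ lam) (g : SmoothFun n M) :
    IsDlogDefining Z s (fun q => ρ q * Real.exp (g q)) (lam + logDiff Z g) := by
  intro p
  obtain ⟨x, hx, hρ, hlam⟩ := h p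
  refine ⟨g.exp * x, hx.mul_left (Real.exp_pos _).ne', ?_, fun u => ?_⟩
  · filter_upwards [hρ] with q hq
    rw [ContMDiffMap.coe_mul, Pi.mul_apply, abs_mul, g.exp_apply, abs_of_pos (Real.exp_pos _), hq,
      mul_comm]
  · filter_upwards [hlam u] with q hq
    rw [← derivAlong_valAt, derivAlong_mul, derivAlong_exp, derivAlong_valAt, derivAlong_valAt, ← hq]
    change (lam u q + (u : VField n M) g q) * (Real.exp (g q) * x q) =
      Real.exp (g q) * _ + x q * _
    ring

variable [Fintype ι]

/-- The modulus `ρ` determines `lam`: two functions with the same absolute value have the same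
square, and differentiating the squares before cancelling `x` removes the sign ambiguity. -/
theorem IsNormalCrossing.dlog_mul_eq (hZ : IsNormalCrossing n Z) {s : ι} {ρ : M → ℝ}
    {lam : LogOneForm n Z} (h : IsDlogDefining Z s ρ lam) {p : M} {x : SmoothFun n M}
    (hx : IsDefiningNear (Z s) p x) (hρ : ∀ᶠ q in 𝓝 p, ρ q = |x q|) (u : logVF n Z) :
    ∀ᶠ q in 𝓝 p, (u : VField n M) x q = lam u q * x q := by
  obtain ⟨x', -, hρ', hlam⟩ := h p
  have hsq : ∀ᶠ q in 𝓝 p, (x * x) q = (x' * x') q := by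
    filter_upwards [hρ, hρ'] with q h1 h2
    change x q * x q = x' q * x' q
    rw [← abs_mul_abs_self, ← h1, h2, abs_mul_abs_self]
  have h1 : ∀ᶠ q in 𝓝 p, ((u : VField n M) x - lam u * x) q * x q = 0 := by
    filter_upwards [hsq.eventually_nhds, hlam u] with q h2 h3
    have h4 := derivAlong_congr (valAt (u : VField n M) q) h2
    rw [derivAlong_mul, derivAlong_mul, derivAlong_valAt, derivAlong_valAt, ← h3] at h4
    have h5 : x q * x q = x' q * x' q := h2.self_of_nhds
    change ((u : VField n M) x q - lam u q * x q) * x q = 0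
    linear_combination h4 / 2 - lam u q * h5
  filter_upwards [hZ.eventually_eq_zero_of_mul hx h1] with q hq
  exact sub_eq_zero.1 hq

theorem AdaptedFrame.coef_inl_eq_dlog (hZ : IsNormalCrossing n Z) {T : Finset ι} {d : ℕ}
    (F : AdaptedFrame n Z T d) {q : M} (hq : q ∈ F.U) {s : T} {ρ : M → ℝ} {lam : LogOneForm n Z}
    (h : IsDlogDefining Z s ρ lam) (hρ : ∀ᶠ r in 𝓝 q, ρ r = |F.y (Sum.inl s) r|)
    (u : logVF n Z) : ∀ᶠ r in 𝓝 q, F.coef u (Sum.inl s) r = lam u r :=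
  F.coef_inl_eq hq (hZ.dlog_mul_eq h (F.isDefiningNear hq s) hρ u)

open Classical in
theorem IsNormalCrossing.dlog_isEulerAt (hZ : IsNormalCrossing n Z) {t : ι} {ρ : M → ℝ}
    {lam : LogOneForm n Z} (h : IsDlogDefining Z t ρ lam) {s : ι} {q : M} {e : logVF n Z}
    (he : IsEulerAt Z s q e) (hq : q ∈ Z s) : lam e q = if t = s then 1 else 0 := by
  obtain ⟨x, hx, hρ, hlam⟩ := h q
  by_cases ht : q ∈ Z t
  · obtain ⟨T, d, F, htT, hqU, rfl⟩ := hZ.exists_adaptedFrame_of_isDefiningNear ht hx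
    rw [← (F.coef_inl_eq_dlog hZ hqU (s := ⟨t, htT⟩) h hρ e).self_of_nhds,
      (F.coef_of_isEulerAt hqU he).1]
    simp [ht]
  · have h1 := (hlam e).self_of_nhds
    rw [← derivAlong_valAt, he.1] at h1
    have h2 : x q ≠ 0 := fun h => ht (hx.1.self_of_nhds.2 h)
    rw [(mul_eq_zero.1 (h1.trans rfl)).resolve_right h2, if_neg]
    rintro rfl
    exact ht hq

theorem IsNormalCrossing.exists_unit_mul (hZ : IsNormalCrossing n Z) {s : ι} {q : M}
    {x x' : SmoothFun n M} (hx : IsDefiningNear (Z s) q x) (hx' : IsDefiningNear (Z s) q x') :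
    ∃ g : SmoothFun n M, g q ≠ 0 ∧ ∀ᶠ r in 𝓝 q, x r = g r * x' r := by
  by_cases hq : q ∈ Z s
  · obtain ⟨T, d, F, hsT, hqU, rfl⟩ := hZ.exists_adaptedFrame_of_isDefiningNear hq hx'
    exact F.exists_unit_mul hqU (i := ⟨s, hsT⟩) hq hx
  · have h1 : x q ≠ 0 := fun h => hq (hx.1.self_of_nhds.2 h)
    have h2 : x' q ≠ 0 := fun h => hq (hx'.1.self_of_nhds.2 h)
    obtain ⟨g, hg⟩ := exists_inv_eventually h2
    refine ⟨x * g, mul_ne_zero h1 fun h => ?_, ?_⟩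
    · have := hg.self_of_nhds
      simp [h] at this
    · filter_upwards [hg] with r hr
      change x r = x r * g r * x' r
      linear_combination -x r * hr

theorem IsNormalCrossing.exists_eventually_isDefiningNear (hZ : IsNormalCrossing n Z) (s : ι)
    (p : M) : ∃ x : SmoothFun n M, ∀ᶠ q in 𝓝 p, IsDefiningNear (Z s) q x := by
  by_cases hp : p ∈ Z s
  · obtain ⟨T, d, F, hpU, hT⟩ := hZ.exists_adaptedFrame_of_mem p
    refine ⟨F.y (Sum.inl ⟨s, (hT s).1 hp⟩), ?_⟩
    filter_upwards [F.mem_nhds hpU] with q hq using F.isDefiningNear hq ⟨s, (hT s).1 hp⟩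
  · refine ⟨1, ?_⟩
    have h1 : (Z s)ᶜ ∈ 𝓝 p := (hZ.1 s).isOpen_compl.mem_nhds hp
    filter_upwards [eventually_mem_nhds_iff.2 h1] with q hq
    refine ⟨?_, fun h => absurd h (mem_of_mem_nhds hq)⟩
    filter_upwards [hq] with r hr
    simpa using hr

/-- Defining functions need not glue, but their squares do up to positive factors. A partition of
unity gives locally `h * x' ^ 2` with `h > 0`, the square of the defining function `√h * x'`. -/
theorem IsNormalCrossing.exists_eventually_eq_sq [SecondCountableTopology M]
    (hZ : IsNormalCrossing n Z) (s : ι) : ∃ f : SmoothFun n M, ∀ q, ∃ x : SmoothFun n M,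
      IsDefiningNear (Z s) q x ∧ ∀ᶠ r in 𝓝 q, f r = x r * x r := by
  have : LocallyCompactSpace M :=
    ChartedSpace.locallyCompactSpace (EuclideanSpace ℝ (Fin (2 * n))) M
  choose x hx using hZ.exists_eventually_isDefiningNear s
  choose U hUx hUo hpU using fun p => eventually_nhds_iff.1 (hx p)
  obtain ⟨φ, hφ⟩ := SmoothPartitionOfUnity.exists_isSubordinate (𝓡 (2 * n)) (isClosed_univ (X := M)) U
    hUo (fun p _ => Set.mem_iUnion.2 ⟨p, hpU p⟩)
  let f : SmoothFun n M := ⟨fun q => ∑ᶠ p, φ p q • (x p * x p) q,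
    φ.contMDiff_finsum_smul fun p q _ => (x p * x p).contMDiff.contMDiffAt⟩
  refine ⟨f, fun q => ?_⟩
  obtain ⟨x', hx'⟩ := hZ.exists_eventually_isDefiningNear s q
  have hx'q := hx'.self_of_nhds
  have hg : ∀ p ∈ φ.fintsupport q, ∃ g : SmoothFun n M, g q ≠ 0 ∧
      ∀ᶠ r in 𝓝 q, x p r = g r * x' r := fun p hp =>
    hZ.exists_unit_mul (hUx p q (hφ p ((φ.mem_fintsupport_iff q p).1 hp))) hx'q
  choose! g hg0 hgx using hg
  let h : SmoothFun n M := ∑ p ∈ φ.fintsupport q, φ p * (g p * g p)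
  have hh : ∀ r, h r = ∑ p ∈ φ.fintsupport q, φ p r * (g p r * g p r) := fun r =>
    SmoothFun.sum_apply _ _ _
  have hfh : ∀ᶠ r in 𝓝 q, f r = h r * (x' r * x' r) := by
    have h1 : ∀ᶠ r in 𝓝 q, ∀ p ∈ φ.fintsupport q, x p r = g p r * x' r :=
      (Filter.eventually_all_finset _).2 hgx
    filter_upwards [h1, φ.eventually_finsupport_subset q] with r h2 h3
    have h4 : f r = ∑ p ∈ φ.fintsupport q, φ p r • (x p * x p) r := by
      refine finsum_eq_sum_of_support_subset _ fun p hp => h3 ?_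
      rw [φ.mem_finsupport]
      exact fun h0 => hp (by simp [h0])
    rw [h4, hh, Finset.sum_mul]
    refine Finset.sum_congr rfl fun p hp => ?_
    change φ p r * (x p r * x p r) = _
    rw [h2 p hp]
    ring
  have hpos : 0 < h q := by
    rw [hh]
    obtain ⟨p, hp⟩ := φ.exists_pos_of_mem (Set.mem_univ q)
    have hpf : p ∈ φ.fintsupport q := φ.finsupport_subset_fintsupport q (by
      rw [φ.mem_finsupport]
      exact hp.ne')
    refine Finset.sum_pos' (fun p' _ => mul_nonneg (φ.nonneg p' q) (mul_self_nonneg _))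
      ⟨p, hpf, mul_pos hp ?_⟩
    exact mul_self_pos.2 (hg0 p hpf)
  have hO : IsOpen {r | 0 < h r} := isOpen_lt continuous_const h.contMDiff.continuous
  obtain ⟨k, hk⟩ := exists_smoothFun_eventuallyEq (n := n) hO hpos (f := fun r => √(h r))
    fun r hr => ((Real.contDiffAt_sqrt hr.ne').contMDiffAt.comp r
      h.contMDiff.contMDiffAt).contMDiffWithinAt
  refine ⟨k * x', hx'q.mul_left ?_, ?_⟩
  · rw [hk.self_of_nhds]
    exact (Real.sqrt_pos.2 hpos).ne'
  · filter_upwards [hk, hfh, hO.mem_nhds hpos] with r h1 h2 h3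
    change f r = k r * x' r * (k r * x' r)
    rw [h2, h1, ← Real.mul_self_sqrt h3.le, Real.mul_self_sqrt h3.le]
    nlinarith [Real.mul_self_sqrt h3.le]

/-- With `f` locally `x ^ 2`, take `ρ = √f` and `lam u = u(f) / (2 f)`; the quotient extends
smoothly because `u` is tangent to `Z s`. -/
theorem IsNormalCrossing.exists_isDlogDefining [SecondCountableTopology M]
    (hZ : IsNormalCrossing n Z) (s : ι) :
    ∃ (ρ : M → ℝ) (lam : LogOneForm n Z), IsDlogDefining Z s ρ lam := by
  obtain ⟨f, hf⟩ := hZ.exists_eventually_eq_sq s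
  have hcancel : ∀ (q : M) (k : SmoothFun n M), (∀ᶠ r in 𝓝 q, k r * f r = 0) →
      ∀ᶠ r in 𝓝 q, k r = 0 := by
    intro q k hk
    obtain ⟨x, hx, hfx⟩ := hf q
    refine hZ.eventually_eq_zero_of_mul hx (hZ.eventually_eq_zero_of_mul (f := k * x) hx ?_)
    filter_upwards [hk, hfx] with r h1 h2
    change k r * x r * x r = 0
    rw [mul_assoc, ← h2, h1]
  have huniq : ∀ (q : M) (k k' : SmoothFun n M), (∀ᶠ r in 𝓝 q, k r * f r = k' r * f r) →
      ∀ᶠ r in 𝓝 q, k r = k' r := by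
    intro q k k' hk
    filter_upwards [hcancel q (k - k') (by
      filter_upwards [hk] with r hr
      change (k r - k' r) * f r = 0
      rw [sub_mul, hr, sub_self])] with r hr
    exact sub_eq_zero.1 hr
  have hloc : ∀ (u : logVF n Z) (q : M), ∃ k : SmoothFun n M,
      ∀ᶠ r in 𝓝 q, (u : VField n M) f r = 2 * (k r * f r) := by
    intro u q
    obtain ⟨x, hx, hfx⟩ := hf q
    obtain ⟨k, hk⟩ := hZ.exists_apply_eq_mul hx u
    refine ⟨k, ?_⟩
    filter_upwards [hfx.eventually_nhds, hk] with r h1 h2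
    rw [VField.apply_congr _ (f := f) (g := x * x) h1, ← derivAlong_valAt, derivAlong_mul,
      derivAlong_valAt, h2, h1.self_of_nhds]
    ring
  have hglob : ∀ u : logVF n Z, ∃ k : SmoothFun n M,
      ∀ r, (u : VField n M) f r = 2 * (k r * f r) := by
    intro u
    choose k hk using hloc u
    -- Local quotients are unique, so they agree on overlaps and the diagonal function `r ↦ k r r`
    -- is smooth.
    have h1 : ∀ q, ∀ᶠ r in 𝓝 q, k r r = k q r := by
      intro q
      filter_upwards [(hk q).eventually_nhds] with r hr
      refine (huniq r (k r) (k q) ?_).self_of_nhds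
      filter_upwards [hr, hk r] with r' h2 h3
      linarith
    refine ⟨⟨fun r => k r r, fun q => ?_⟩, fun r => (hk r).self_of_nhds⟩
    exact ((k q).contMDiff.contMDiffAt).congr_of_eventuallyEq (h1 q)
  choose k hk using hglob
  have hext : ∀ k k' : SmoothFun n M, (∀ r, k r * f r = k' r * f r) → k = k' := by
    intro k k' h
    ext q
    exact (huniq q k k' (.of_forall h)).self_of_nhds
  let lam : LogOneForm n Z :=
    { toFun := k
      map_add' := fun u v => hext _ _ fun r => by
        have h1 := hk (u + v) r
        rw [logVF_add_apply, hk u, hk v] at h1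
        change _ = (k u r + k v r) * f r
        linarith
      map_smul' := fun g u => hext _ _ fun r => by
        have h1 := hk (g • u) r
        rw [logVF_smul_apply, hk u] at h1
        change _ = g r * k u r * f r
        linarith }
  refine ⟨fun q => √(f q), lam, fun q => ?_⟩
  obtain ⟨x, hx, hfx⟩ := hf q
  refine ⟨x, hx, ?_, fun u => ?_⟩
  · filter_upwards [hfx] with r hr
    rw [hr, Real.sqrt_mul_self_eq_abs]
  · have h1 : ∀ᶠ r in 𝓝 q, (k u * x - (u : VField n M) x) r * x r = 0 := by
      filter_upwards [hfx.eventually_nhds] with r h2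
      have h3 := hk u r
      rw [VField.apply_congr _ (f := f) (g := x * x) h2, ← derivAlong_valAt, derivAlong_mul,
        derivAlong_valAt, h2.self_of_nhds] at h3
      change (k u r * x r - (u : VField n M) x r) * x r = 0
      linarith
    filter_upwards [hZ.eventually_eq_zero_of_mul hx h1] with r hr
    exact sub_eq_zero.1 hr

end Dlog

section Pairs

universe u

variable {n : ℕ} {M : Type*} [TopologicalSpace M]
  [ChartedSpace (EuclideanSpace ℝ (Fin (2 * n))) M] {ι : Type u} {Z : ι → Set M}
  [T2Space M] [IsManifold (𝓡 (2 * n)) ∞ M] [Fintype ι]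

/-! ### Nondegeneracy at a point -/

/-- In an adapted frame `om` at `p` becomes an alternating form `B` on the coefficient space, of
dimension `2 * n`, and the linear algebra of top powers applies to `B`. -/
theorem IsLogSymplectic.eq_zero_of_forall_eq_zero (hZ : IsNormalCrossing n Z) {om : LogBilin n Z}
    (hom : IsLogSymplectic Z om) {p : M} {u : logVF n Z} (hu : ∀ v, om u v p = 0)
    (α : LogOneForm n Z) : α u p = 0 := by
  classical
  let T : Finset ι := {i | p ∈ Z i}
  obtain ⟨d, F, hd, hpU, -⟩ := hZ.exists_adaptedFrame_aux (T := T) (p := p) (by simp [T])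
  let m : Matrix (T ⊕ Fin d) (T ⊕ Fin d) ℝ := fun k l => om (F.E k) (F.E l) p
  let B : (T ⊕ Fin d → ℝ) →ₗ[ℝ] (T ⊕ Fin d → ℝ) →ₗ[ℝ] ℝ := Matrix.toLinearMap₂' ℝ m
  have hB : ∀ a b, B a b = ∑ k, ∑ l, a k * (b l * m k l) := by
    intro a b
    simp [B, Matrix.toLinearMap₂'_apply]
  have hm : ∀ k l, m k l = -m l k := fun k l => by
    simp only [m]
    rw [hom.skew]
    rfl
  have hBu : ∀ (u : logVF n Z) (b : T ⊕ Fin d → ℝ),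
      B (fun k => F.coef u k p) b = ∑ l, b l * om u (F.E l) p := by
    intro u b
    rw [hB, Finset.sum_comm]
    refine Finset.sum_congr rfl fun l _ => ?_
    have h1 := F.logOneForm_eq_sum (om.flip (F.E l)) u hpU
    simp only [LinearMap.flip_apply] at h1
    rw [h1, Finset.mul_sum]
    refine Finset.sum_congr rfl fun k _ => ?_
    simp only [m]
    ring
  have hBuv : ∀ u v : logVF n Z, B (fun k => F.coef u k p) (fun k => F.coef v k p) = om u v p := by
    intro u v
    rw [hBu, F.logOneForm_eq_sum (om u) v hpU]
  have halt : ∀ a, B a a = 0 := by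
    intro a
    have h1 : B a a = -B a a := by
      conv_lhs => rw [hB, Finset.sum_comm]
      rw [hB, ← Finset.sum_neg_distrib]
      refine Finset.sum_congr rfl fun k _ => ?_
      rw [← Finset.sum_neg_distrib]
      refine Finset.sum_congr rfl fun l _ => ?_
      rw [hm l k]
      ring
    linarith
  obtain ⟨v, hv⟩ := hom.nondegenerate p
  have hv' : wedgeEval (m := n) (fun j : Empty => j.elim) (fun a b => B a b)
      (fun x k => F.coef (v x) k p) ≠ 0 := by
    simp only [wedgeEval, hBuv, Finset.univ_eq_empty, Finset.prod_empty, mul_one] at hv ⊢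
    exact hv
  have h0 := eq_zero_of_wedgeEval_ne_zero (by simpa using hd) halt hv'
    (e := fun k => F.coef u k p) (fun b => by rw [hBu]; simp [hu])
  rw [F.logOneForm_eq_sum α u hpU]
  exact Finset.sum_eq_zero fun k _ => by rw [show F.coef u k p = 0 from congrFun h0 k, zero_mul]

/-- Fermat's principle for log vector fields: frame fields normal to the intersection carry a factor
`y i = 0`, and the others are tangent to it. It serves at maxima and for functions locally constant
on the intersection. -/
theorem IsNormalCrossing.apply_eq_zero_of_isLocalMaxOn (hZ : IsNormalCrossing n Z) {p : M}
    {T' : Set ι} (hp : ∀ i ∈ T', p ∈ Z i) {f : SmoothFun n M}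
    (hf : IsLocalMaxOn f {r | ∀ i ∈ T', r ∈ Z i} p) (u : logVF n Z) :
    (u : VField n M) f p = 0 := by
  obtain ⟨T, d, F, hpU, hT⟩ := hZ.exists_adaptedFrame_of_mem p
  rw [F.apply_eq_sum_coef u f hpU]
  refine Finset.sum_eq_zero fun k _ => ?_
  rcases k with i | j
  · rw [F.E_inl_apply]
    by_cases hi : (i : ι) ∈ T'
    · rw [(F.mem_iff p hpU i).1 (hp i hi)]
      ring
    · rw [F.D_eq_zero p hpU _ T' f hp (by rintro i' hi'; cases hi'; exact hi) hf]
      ring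
  · rw [F.E_inr_apply, F.D_eq_zero p hpU _ T' f hp (by simp) hf, mul_zero]

/-! ### The pairs of hypersurfaces with nonzero coefficient -/

theorem IsDlogDefining.exists_log {t : ι} {ρ : M → ℝ} {lam : LogOneForm n Z}
    (h : IsDlogDefining Z t ρ lam) {p : M} (hp : p ∉ Z t) :
    ∃ ℓ : SmoothFun n M, (∀ᶠ q in 𝓝 p, ℓ q = Real.log (ρ q)) ∧
      ∀ v : logVF n Z, (v : VField n M) ℓ p = lam v p := by
  obtain ⟨x, hx, hρ, hlam⟩ := h p
  have hxp : x p ≠ 0 := fun h => hp (hx.1.self_of_nhds.2 h)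
  have hO : IsOpen {q | x q ≠ 0} := isOpen_ne_fun x.contMDiff.continuous continuous_const
  obtain ⟨ℓ, hℓ⟩ := exists_smoothFun_eventuallyEq (n := n) hO hxp (f := fun q => Real.log (x q))
    fun q hq => ((Real.contDiffAt_log.2 hq).contMDiffAt.comp q
      x.contMDiff.contMDiffAt).contMDiffWithinAt
  refine ⟨ℓ, ?_, fun v => ?_⟩
  · filter_upwards [hℓ, hρ] with q h1 h2
    rw [h1, h2, Real.log_abs]
  · have h1 : ∀ᶠ q in 𝓝 p, (ℓ + ℓ).exp q = (x * x) q := by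
      filter_upwards [hℓ, hO.mem_nhds hxp] with q h2 h3
      rw [SmoothFun.exp_apply]
      change Real.exp (ℓ q + ℓ q) = x q * x q
      have h4 : ℓ q + ℓ q = Real.log (x q * x q) := by rw [h2, Real.log_mul h3 h3]
      rw [h4, Real.exp_log (mul_self_pos.2 h3)]
    have h2 := derivAlong_congr (valAt (v : VField n M) p) h1
    have h3 : Real.exp ((ℓ + ℓ) p) = x p * x p := h1.self_of_nhds
    rw [derivAlong_exp, derivAlong_add, derivAlong_mul, h3, derivAlong_valAt, derivAlong_valAt,
      ← (hlam v).self_of_nhds] at h2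
    have h4 : x p * x p * (2 * ((v : VField n M) ℓ p - lam v p)) = 0 := by linarith
    have h5 := (mul_eq_zero.1 h4).resolve_left (mul_self_ne_zero.2 hxp)
    linarith

variable [SecondCountableTopology M]

/-- Prescribing values on `Y` is a convex condition, so local solutions glue by a partition of
unity. -/
theorem exists_smoothFun_eqOn {Y : Set M} (hY : IsClosed Y) {f : M → ℝ}
    (hf : ∀ p ∈ Y, ∃ g : SmoothFun n M, ∀ᶠ q in 𝓝 p, q ∈ Y → g q = f q) :
    ∃ g : SmoothFun n M, ∀ q ∈ Y, g q = f q := by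
  have : LocallyCompactSpace M :=
    ChartedSpace.locallyCompactSpace (EuclideanSpace ℝ (Fin (2 * n))) M
  refine exists_contMDiffMap_forall_mem_convex_of_local (𝓡 (2 * n))
    (t := fun q => {r | q ∈ Y → r = f q}) (fun q => ?_) fun p => ?_
  · intro a ha b hb c d _ _ hcd hq
    rw [ha hq, hb hq, ← add_smul, hcd, one_smul]
  · by_cases hp : p ∈ Y
    · obtain ⟨g, hg⟩ := hf p hp
      exact ⟨_, hg, g, g.contMDiff.contMDiffOn, fun q hq => hq⟩
    · exact ⟨_, hY.isOpen_compl.mem_nhds hp, 0, contMDiffOn_const, fun q hq h => absurd h hq⟩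

/-- On `Z s ∩ Z t` the class `b_s` contributes an exact form. All `c_{s,t'}` with `t' ≠ t` vanish,
so the other logarithmic terms are also differentials of smooth functions. Only `c * lam` can be
singular. -/
theorem IsPartitionable.exists_residue_eq (hZ : IsNormalCrossing n Z)
    {om : LogBilin n Z} (hpart : IsPartitionable om) {s t : ι} (hst : CNonzero om s t) :
    ∃ (ρ : M → ℝ) (lam : LogOneForm n Z) (c g : SmoothFun n M), IsDlogDefining Z t ρ lam ∧
      (∀ p ∈ Z s ∩ Z t, ∀ᶠ q in 𝓝 p, q ∈ Z s → c q = cCoeff om s t p) ∧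
      ∀ p ∈ Z s ∩ Z t, ∀ e v : logVF n Z, IsEulerAt Z s p e →
        om e v p = c p * lam v p + (v : VField n M) g p := by
  classical
  obtain ⟨⟨η, ⟨-, ρ, lam, c, hlam, hc, hη⟩, f, hf⟩, -, hj, -⟩ := hpart.of_c_ne_zero s t hst
  have hc0 : ∀ t', t' ≠ s → t' ≠ t → ∀ p ∈ Z s ∩ Z t', ∀ᶠ q in 𝓝 p, q ∈ Z s → c t' q = 0 := by
    intro t' hs ht p hp
    have h0 : cCoeff om s t' p = 0 := by
      by_contra h
      exact hj t' ht ⟨hs.symm, p, hp, h⟩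
    rw [← h0]
    exact hc t' hs p hp
  -- The product `c t' * log ρ t'` is smooth along `Z s`: near `Z t'`, where the logarithm blows up,
  -- `c t'` is zero on `Z s`.
  have hG : ∀ t', t' ≠ s → t' ≠ t → ∃ G : SmoothFun n M,
      ∀ q ∈ Z s, G q = c t' q * Real.log (ρ t' q) := by
    intro t' hs ht
    refine exists_smoothFun_eqOn (hZ.1 s) fun p hp => ?_
    by_cases hpt : p ∈ Z t'
    · refine ⟨0, ?_⟩
      filter_upwards [hc0 t' hs ht p ⟨hp, hpt⟩] with q hq hqs
      rw [hq hqs, zero_mul]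
      rfl
    · obtain ⟨ℓ, hℓ, -⟩ := (hlam t').exists_log hpt
      refine ⟨c t' * ℓ, ?_⟩
      filter_upwards [hℓ] with q hq _
      rw [← hq]
      rfl
  choose! G hG using hG
  have hGv : ∀ t', t' ≠ s → t' ≠ t → ∀ p ∈ Z s, ∀ v : logVF n Z,
      c t' p * lam t' v p + (v : VField n M) (c t') p * Real.log (ρ t' p) =
        (v : VField n M) (G t') p := by
    intro t' hs ht p hp v
    by_cases hpt : p ∈ Z t'
    · have h1 := hc0 t' hs ht p ⟨hp, hpt⟩
      rw [h1.self_of_nhds hp, logVF_apply_eq_zero v hp h1, logVF_apply_eq_zero v hp (f := G t')]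
      · ring
      · filter_upwards [h1] with q hq hqs
        rw [hG t' hs ht q hqs, hq hqs, zero_mul]
    · obtain ⟨ℓ, hℓ, hv⟩ := (hlam t').exists_log hpt
      have h1 : derivAlong (valAt (v : VField n M) p) (G t' - c t' * ℓ) = 0 := by
        refine logVF_apply_eq_zero v hp ?_
        filter_upwards [hℓ] with q hq hqs
        change G t' q - c t' q * ℓ q = 0
        rw [hG t' hs ht q hqs, hq, sub_self]
      rw [derivAlong_sub, derivAlong_mul, derivAlong_valAt, derivAlong_valAt, derivAlong_valAt,
        hv v, hℓ.self_of_nhds] at h1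
      linarith
  refine ⟨ρ t, lam t, c t, f + ∑ t' with t' ≠ s ∧ t' ≠ t, G t', hlam t, hc t hst.1.symm, ?_⟩
  rintro p ⟨hps, hpt⟩ e v he
  have hη' : η p ⟨valAt (v : VField n M) p, logVF_at_mem Z {s} p
      (fun _ hi => (Set.mem_singleton_iff.mp hi) ▸ hps) v⟩ = (v : VField n M) f p := by
    have hST : ∀ i ∈ ({s, t} : Set ι), p ∈ Z i := by
      rintro i (rfl | rfl) <;> assumption
    exact hf p hST _ _ (logVF_at_mem Z {s, t} p hST v)
  have hct : (v : VField n M) (c t) p = 0 := by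
    have h1 : derivAlong (valAt (v : VField n M) p)
        (c t - algebraMap ℝ (SmoothFun n M) (cCoeff om s t p)) = 0 := by
      refine logVF_apply_eq_zero v hps ?_
      filter_upwards [hc t hst.1.symm p ⟨hps, hpt⟩] with q hq hqs
      exact sub_eq_zero.2 (hq hqs)
    rwa [derivAlong_sub, derivAlong_algebraMap, sub_zero] at h1
  have hsum : ∑ t' with t' ≠ s,
      (c t' p * lam t' v p + (v : VField n M) (c t') p * Real.log (ρ t' p)) =
      c t p * lam t v p + ∑ t' with t' ≠ s ∧ t' ≠ t, (v : VField n M) (G t') p := by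
    have h1 : t ∈ Finset.univ.filter fun t' => t' ≠ s := by simp [hst.1.symm]
    rw [← Finset.add_sum_erase _ _ h1, hct, zero_mul, add_zero]
    congr 1
    have h2 : (Finset.univ.filter fun t' => t' ≠ s).erase t =
        Finset.univ.filter fun t' => t' ≠ s ∧ t' ≠ t := by
      ext t'
      simp [and_comm]
    rw [h2]
    refine Finset.sum_congr rfl fun t' ht' => ?_
    rw [Finset.mem_filter] at ht'
    exact hGv t' ht'.2.1 ht'.2.2 p hps v
  rw [hη p hps e v he, hη']
  have h3 : (v : VField n M) (f + ∑ t' with t' ≠ s ∧ t' ≠ t, G t') p =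
      (v : VField n M) f p + ∑ t' with t' ≠ s ∧ t' ≠ t, (v : VField n M) (G t') p := by
    rw [← derivAlong_valAt, derivAlong_add, derivAlong_sum]
    rfl
  rw [h3]
  have h4 : ∀ a b c d : ℝ, a = b + c → a + d = b + (d + c) := fun a b c d h => by rw [h]; ring
  refine h4 _ _ _ _ ?_
  convert hsum using 2

/-- In the compact case, a zero of `c` gives a nonempty compact set of zeros, open in `Z s ∩ Z t`.
Where `g` is maximal on it, `c * lam + dg` vanishes, so the Euler element of `Z s` is in the kernel
of `om`, although `dx_s/x_s` equals `1` on it. -/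
theorem IsPartitionable.cCoeff_ne_zero (hZ : IsNormalCrossing n Z) {om : LogBilin n Z}
    (hom : IsLogSymplectic Z om) (hpart : IsPartitionable om)
    (hc : CompactSpace M ∨
      ∀ s t, CNonzero om s t → ∀ p ∈ Z s ∩ Z t, cCoeff om s t p ≠ 0)
    {s t : ι} (hst : CNonzero om s t) {p : M} (hp : p ∈ Z s ∩ Z t) : cCoeff om s t p ≠ 0 := by
  rcases hc with hM | hc
  swap
  · exact hc s t hst p hp
  intro h0
  obtain ⟨ρ, lam, c, g, -, hcst, hres⟩ := hpart.exists_residue_eq hZ hst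
  have hc' : ∀ q ∈ Z s ∩ Z t, c q = cCoeff om s t q := fun q hq =>
    (hcst q hq).self_of_nhds hq.1
  let W : Set M := (Z s ∩ Z t) ∩ c ⁻¹' {0}
  have hW : IsClosed W :=
    ((hZ.1 s).inter (hZ.1 t)).inter (isClosed_singleton.preimage c.contMDiff.continuous)
  obtain ⟨q, hqW, hmax⟩ := hW.isCompact.exists_isMaxOn ⟨p, hp, by simp [hc' p hp, h0]⟩
    g.contMDiff.continuous.continuousOn
  have hq0 : cCoeff om s t q = 0 := by
    rw [← hc' q hqW.1]
    exact hqW.2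
  have hST : ∀ i ∈ ({s, t} : Set ι), q ∈ Z i := by
    rintro i (rfl | rfl)
    exacts [hqW.1.1, hqW.1.2]
  -- Since `c` is locally constant, `W` is open in the intersection, so a maximum on `W` is a local
  -- maximum on `Z s ∩ Z t`.
  have hloc : IsLocalMaxOn g {r | ∀ i ∈ ({s, t} : Set ι), r ∈ Z i} q := by
    filter_upwards [nhdsWithin_le_nhds (hcst q hqW.1), self_mem_nhdsWithin] with r h1 h2
    have hrs : r ∈ Z s := h2 s (by simp)
    exact hmax ⟨⟨hrs, h2 t (by simp)⟩, by simp [h1 hrs, hq0]⟩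
  obtain ⟨e, he⟩ := hZ.exists_isEulerAt hqW.1.1
  obtain ⟨ρ', lam', hlam'⟩ := hZ.exists_isDlogDefining s
  have h1 := hom.eq_zero_of_forall_eq_zero hZ (p := q) (u := e) (fun v => by
    rw [hres q hqW.1 e v he, show c q = 0 from hqW.2,
      hZ.apply_eq_zero_of_isLocalMaxOn hST hloc v]
    ring) lam'
  rw [hZ.dlog_isEulerAt hlam' he hqW.1.1] at h1
  simp at h1

/-- Multiplying the defining function of `Z t` by `exp (g / c)` changes `c * lam` by `dg`, because
`c` is locally constant on the intersection. -/
theorem IsPartitionable.exists_residue_eq_dlog (hZ : IsNormalCrossing n Z) {om : LogBilin n Z}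
    (hom : IsLogSymplectic Z om) (hpart : IsPartitionable om)
    (hc : CompactSpace M ∨
      ∀ s t, CNonzero om s t → ∀ p ∈ Z s ∩ Z t, cCoeff om s t p ≠ 0)
    {s t : ι} (hst : CNonzero om s t) :
    ∃ (ρ : M → ℝ) (lam : LogOneForm n Z), IsDlogDefining Z t ρ lam ∧
      ∀ p ∈ Z s ∩ Z t, ∀ e v : logVF n Z, IsEulerAt Z s p e →
        om e v p = cCoeff om s t p * lam v p := by
  obtain ⟨ρ, lam, c, g, hlam, hcst, hres⟩ := hpart.exists_residue_eq hZ hst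
  have hc' : ∀ q ∈ Z s ∩ Z t, c q = cCoeff om s t q := fun q hq =>
    (hcst q hq).self_of_nhds hq.1
  have hne : ∀ q ∈ Z s ∩ Z t, c q ≠ 0 := fun q hq =>
    hc' q hq ▸ hpart.cCoeff_ne_zero hZ hom hc hst hq
  -- `r` extends `1 / c` from the intersection to a smooth function on `M`; `c` itself may vanish
  -- elsewhere.
  obtain ⟨r, hr⟩ := exists_smoothFun_eqOn ((hZ.1 s).inter (hZ.1 t)) (f := fun q => (c q)⁻¹)
    fun p hp => by
      obtain ⟨g', hg'⟩ := exists_inv_eventually (hne p hp)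
      refine ⟨g', ?_⟩
      filter_upwards [hg'] with q hq _
      exact eq_inv_of_mul_eq_one_right hq
  refine ⟨_, _, hlam.mul_exp (g * r), fun p hp e v he => ?_⟩
  have hST : ∀ i ∈ ({s, t} : Set ι), p ∈ Z i := by
    rintro i (rfl | rfl)
    exacts [hp.1, hp.2]
  have hconst : ∀ f : SmoothFun n M, (∀ᶠ q in 𝓝 p, q ∈ Z s ∩ Z t → f q = f p) →
      (v : VField n M) f p = 0 := by
    intro f hf
    refine hZ.apply_eq_zero_of_isLocalMaxOn hST ?_ v
    filter_upwards [nhdsWithin_le_nhds hf, self_mem_nhdsWithin] with q h1 h2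
    exact (h1 ⟨h2 s (by simp), h2 t (by simp)⟩).le
  have hvr : (v : VField n M) r p = 0 := by
    refine hconst r ?_
    filter_upwards [hcst p hp] with q h1 h2
    rw [hr q h2, hr p hp, h1 h2.1, hc' p hp]
  have h1 : (lam + logDiff Z (g * r)) v p =
      lam v p + (g p * (v : VField n M) r p + r p * (v : VField n M) g p) := by
    change lam v p + derivAlong (valAt (v : VField n M) p) (g * r) = _
    rw [derivAlong_mul]
    rfl
  rw [h1, hres p hp e v he, hvr, hr p hp, ← hc' p hp]
  have := hne p hp
  field_simp
  ring

end Pairs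

section Strata

universe u

variable {n : ℕ} {M : Type*} [TopologicalSpace M]
  [ChartedSpace (EuclideanSpace ℝ (Fin (2 * n))) M] {ι : Type u} {Z : ι → Set M}

/-! ### The forms induced on a stratum, in adapted coordinates -/

/-- The differential of a function, as a 1-form. -/
def diffForm (g : SmoothFun n M) : VField n M →ₗ[SmoothFun n M] SmoothFun n M where
  toFun u := u g
  map_add' _ _ := rfl
  map_smul' _ _ := rfl

/-- The differential of a function, as a linear form on a tangent space. -/
def strDiff (Z : ι → Set M) (S : Set ι) (q : M) (g : SmoothFun n M) :
    strTangent (n := n) Z S q →ₗ[ℝ] ℝ where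
  toFun w := derivAlong (w : TVec n q) g
  map_add' _ _ := rfl
  map_smul' _ _ := rfl

theorem strDiff_apply (S : Set ι) (q : M) (g : SmoothFun n M)
    (w : strTangent (n := n) Z S q) : strDiff Z S q g w = derivAlong (w : TVec n q) g :=
  rfl

theorem strTangent_ext {S : Set ι} {q : M} {w w' : strTangent (n := n) Z S q}
    (h : ∀ f : SmoothFun n M, derivAlong (w : TVec n q) f = derivAlong (w' : TVec n q) f) :
    w = w' :=
  Subtype.ext (TVec.ext_derivAlong h)

variable [T2Space M] [IsManifold (𝓡 (2 * n)) ∞ M]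

namespace AdaptedFrame

variable {S : Finset ι} {d : ℕ} (F : AdaptedFrame n Z S d)

theorem y_inl_eq_zero {q : M} (hq : q ∈ F.U) (hX : q ∈ openStratum Z (S : Set ι)) (s : S) :
    F.y (Sum.inl s) q = 0 :=
  (F.mem_iff q hq s).1 ((hX s).2 s.2)

theorem derivAlong_y_inl {q : M} (hq : q ∈ F.U) {w : TVec n q}
    (hw : w ∈ strTangent Z (S : Set ι) q) (s : S) : derivAlong w (F.y (Sum.inl s)) = 0 :=
  derivAlong_eq_zero_of_mem_strTangent hw (Finset.mem_coe.2 s.2)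
    (Filter.mem_of_superset (F.mem_nhds hq) fun r hr => (F.mem_iff r hr s).1)

theorem derivAlong_eq_sum_inr {q : M} (hq : q ∈ F.U) {w : TVec n q}
    (hw : w ∈ strTangent Z (S : Set ι) q) (f : SmoothFun n M) :
    derivAlong w f = ∑ j, derivAlong w (F.y (Sum.inr j)) * F.D (Sum.inr j) f q := by
  rw [F.derivAlong_eq q hq, Fintype.sum_sum_type]
  simp [F.derivAlong_y_inl hq hw]

theorem exists_logVF {q : M} (hq : q ∈ F.U) (hX : q ∈ openStratum Z (S : Set ι)) (a : S → ℝ)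
    (b : Fin d → ℝ) : ∃ u : logVF n Z, (∀ s, F.coef u (Sum.inl s) q = a s) ∧
      ∀ f : SmoothFun n M, (u : VField n M) f q = ∑ j, b j * F.D (Sum.inr j) f q := by
  let u : S ⊕ Fin d → logVF n Z := fun k =>
    algebraMap ℝ (SmoothFun n M) (Sum.elim a b k) • F.E k
  have hu : ∀ k f r, (u k : VField n M) f r = Sum.elim a b k * (F.E k : VField n M) f r :=
    fun k f r => rfl
  refine ⟨∑ k, u k, fun s => ?_, fun f => ?_⟩
  · refine (F.coef_inl_eq hq (k := algebraMap ℝ (SmoothFun n M) (a s)) ?_).self_of_nhds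
    filter_upwards [F.mem_nhds hq] with r hr
    rw [logVF_sum_apply, Finset.sum_eq_single (Sum.inl s)]
    · rw [hu, F.E_inl_apply, F.D_self r hr, mul_one]
      rfl
    · rintro (t | j) - hne
      · rw [hu, F.E_inl_apply, F.D_ne r hr _ _ hne, mul_zero, mul_zero]
      · rw [hu, F.E_inr_apply, F.D_ne r hr _ _ hne, mul_zero]
    · simp
  · rw [logVF_sum_apply, Fintype.sum_sum_type]
    simp [hu, F.E_inl_apply, F.E_inr_apply, F.y_inl_eq_zero hq hX]

/-- The last coordinates of an adapted frame are linear coordinates on the tangent space. -/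
theorem finrank_strTangent {q : M} (hq : q ∈ F.U) (hX : q ∈ openStratum Z (S : Set ι)) :
    FiniteDimensional ℝ (strTangent (n := n) Z (S : Set ι) q) ∧
      Module.finrank ℝ (strTangent (n := n) Z (S : Set ι) q) = d := by
  let φ : strTangent (n := n) Z (S : Set ι) q →ₗ[ℝ] (Fin d → ℝ) :=
    LinearMap.pi fun j => strDiff Z S q (F.y (Sum.inr j))
  have hφ : Function.Bijective φ := by
    constructor
    · rw [injective_iff_map_eq_zero]
      intro w hw
      apply strTangent_ext
      intro f
      rw [F.derivAlong_eq_sum_inr hq w.2]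
      exact Finset.sum_eq_zero fun j _ => by
        rw [show derivAlong (w : TVec n q) (F.y (Sum.inr j)) = 0 from congrFun hw j, zero_mul]
    · intro b
      obtain ⟨u, -, hu⟩ := F.exists_logVF hq hX 0 b
      refine ⟨⟨_, logVF_at_mem Z S q (fun i hi => (hX i).mpr hi) u⟩, ?_⟩
      ext j
      change (u : VField n M) (F.y (Sum.inr j)) q = b j
      rw [hu, Finset.sum_eq_single j]
      · rw [F.D_self q hq, mul_one]
      · intro k _ hk
        rw [F.D_ne q hq _ _ (by simpa using hk), mul_zero]
      · simp
  let e := LinearEquiv.ofBijective φ hφ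
  exact ⟨Module.Finite.equiv e.symm, by rw [e.finrank_eq]; simp⟩

/-- The contraction of a log 2-form with the Euler field of `Z s`, on the stratum. -/
def thetaAt (om : LogBilin n Z) (s : S) (q : M) :
    strTangent (n := n) Z (S : Set ι) q →ₗ[ℝ] ℝ :=
  ∑ j, om (F.E (Sum.inl s)) (F.E (Sum.inr j)) q • strDiff Z S q (F.y (Sum.inr j))

/-- The restriction of a log 2-form to the stratum, in adapted coordinates. -/
def betaAt (om : LogBilin n Z) (q : M) :
    strTangent (n := n) Z (S : Set ι) q →ₗ[ℝ] strTangent (n := n) Z (S : Set ι) q →ₗ[ℝ] ℝ :=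
  ∑ j, ∑ k, om (F.E (Sum.inr j)) (F.E (Sum.inr k)) q •
    (strDiff Z S q (F.y (Sum.inr j))).smulRight (strDiff Z S q (F.y (Sum.inr k)))

theorem thetaAt_apply (om : LogBilin n Z) (s : S) (q : M)
    (w : strTangent (n := n) Z (S : Set ι) q) : F.thetaAt om s q w =
      ∑ j, om (F.E (Sum.inl s)) (F.E (Sum.inr j)) q * derivAlong (w : TVec n q) (F.y (Sum.inr j)) := by
  simp [thetaAt, strDiff_apply]

theorem betaAt_apply (om : LogBilin n Z) (q : M) (w w' : strTangent (n := n) Z (S : Set ι) q) :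
    F.betaAt om q w w' = ∑ j, ∑ k, om (F.E (Sum.inr j)) (F.E (Sum.inr k)) q *
      (derivAlong (w : TVec n q) (F.y (Sum.inr j)) *
        derivAlong (w' : TVec n q) (F.y (Sum.inr k))) := by
  simp [betaAt, strDiff_apply]

theorem apply_eq_of_coef {om : LogBilin n Z} (hom : IsLogSymplectic Z om) {q : M} (hq : q ∈ F.U)
    (u v : logVF n Z) {u' v' : strTangent (n := n) Z (S : Set ι) q}
    (hu : (u' : TVec n q) = valAt (u : VField n M) q)
    (hv : (v' : TVec n q) = valAt (v : VField n M) q) :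
    om u v q = (∑ s, ∑ t, F.coef u (Sum.inl s) q * F.coef v (Sum.inl t) q *
        om (F.E (Sum.inl s)) (F.E (Sum.inl t)) q) +
      (∑ s, (F.coef u (Sum.inl s) q * F.thetaAt om s q v' -
        F.coef v (Sum.inl s) q * F.thetaAt om s q u')) + F.betaAt om q u' v' := by
  have h1 := F.logOneForm_eq_sum (om.flip v) u hq
  simp only [LinearMap.flip_apply] at h1
  have h2 := fun k => F.logOneForm_eq_sum (om (F.E k)) v hq
  have hsk : ∀ k l, om (F.E k) (F.E l) q = -om (F.E l) (F.E k) q := fun k l => by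
    rw [hom.skew]
    rfl
  simp only [Fintype.sum_sum_type] at h1 h2
  rw [h1]
  simp only [h2, thetaAt_apply, betaAt_apply, hu, hv, derivAlong_valAt, coef_inr, mul_add,
    Finset.sum_add_distrib, Finset.sum_sub_distrib, Finset.mul_sum]
  have h3 : ∑ j, ∑ s, (u : VField n M) (F.y (Sum.inr j)) q *
      (F.coef v (Sum.inl s) q * om (F.E (Sum.inr j)) (F.E (Sum.inl s)) q) =
      -∑ s, ∑ j, F.coef v (Sum.inl s) q * (om (F.E (Sum.inl s)) (F.E (Sum.inr j)) q *
        (u : VField n M) (F.y (Sum.inr j)) q) := by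
    rw [Finset.sum_comm, ← Finset.sum_neg_distrib]
    refine Finset.sum_congr rfl fun s _ => ?_
    rw [← Finset.sum_neg_distrib]
    refine Finset.sum_congr rfl fun j _ => ?_
    rw [hsk]
    ring
  rw [h3]
  have h4 : ∀ a b c d a' b' d' : ℝ, a = a' → b = b' → d = d' →
      a + b + (-c + d) = a' + (b' - c) + d' := by
    rintro a b c d _ _ _ rfl rfl rfl
    ring
  refine h4 _ _ _ _ _ _ _ ?_ ?_ ?_
  · exact Finset.sum_congr rfl fun s _ => Finset.sum_congr rfl fun t _ => by ring
  · exact Finset.sum_congr rfl fun s _ => Finset.sum_congr rfl fun t _ => by ring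
  · exact Finset.sum_congr rfl fun s _ => Finset.sum_congr rfl fun t _ => by ring

/-- A description by lifts without components along the Euler fields; it allows comparison of
different frames. -/
theorem thetaAt_eq {om : LogBilin n Z} {q : M} (hq : q ∈ F.U) (s : S) (v : logVF n Z)
    {v' : strTangent (n := n) Z (S : Set ι) q}
    (hv : (v' : TVec n q) = valAt (v : VField n M) q) (h0 : ∀ t, F.coef v (Sum.inl t) q = 0) :
    F.thetaAt om s q v' = om (F.E (Sum.inl s)) v q := by
  rw [F.logOneForm_eq_sum (om (F.E (Sum.inl s))) v hq, Fintype.sum_sum_type, thetaAt_apply]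
  simp only [h0, zero_mul, Finset.sum_const_zero, zero_add]
  refine Finset.sum_congr rfl fun j _ => ?_
  rw [hv, derivAlong_valAt, coef_inr, mul_comm]

theorem betaAt_eq {om : LogBilin n Z} (hom : IsLogSymplectic Z om) {q : M} (hq : q ∈ F.U)
    (u v : logVF n Z) {u' v' : strTangent (n := n) Z (S : Set ι) q}
    (hu : (u' : TVec n q) = valAt (u : VField n M) q)
    (hv : (v' : TVec n q) = valAt (v : VField n M) q) (h0 : ∀ t, F.coef u (Sum.inl t) q = 0)
    (h0' : ∀ t, F.coef v (Sum.inl t) q = 0) : F.betaAt om q u' v' = om u v q := by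
  rw [F.apply_eq_of_coef hom hq u v hu hv]
  simp [h0, h0']

theorem exists_lift {q : M} (hq : q ∈ F.U) (hX : q ∈ openStratum Z (S : Set ι)) (a : S → ℝ)
    (w : strTangent (n := n) Z (S : Set ι) q) : ∃ u : logVF n Z,
      (w : TVec n q) = valAt (u : VField n M) q ∧ ∀ s, F.coef u (Sum.inl s) q = a s := by
  obtain ⟨u, h1, h2⟩ := F.exists_logVF hq hX a
    fun j => derivAlong (w : TVec n q) (F.y (Sum.inr j))
  refine ⟨u, TVec.ext_derivAlong fun f => ?_, h1⟩
  rw [derivAlong_valAt, h2, F.derivAlong_eq_sum_inr hq w.2]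

/-! ### Brackets of the frame -/

/-- The commutator of coordinate fields kills every coordinate, so it vanishes at `q`. -/
theorem D_D_eq {q : M} (hq : q ∈ F.U) (k l : S ⊕ Fin d) (f : SmoothFun n M) :
    F.D k (F.D l f) q = F.D l (F.D k f) q := by
  have h1 : ∀ k l m, F.D k (F.D l (F.y m)) q = 0 := by
    intro k l m
    have h2 : ∃ c : ℝ, ∀ᶠ r in 𝓝 q, F.D l (F.y m) r = algebraMap ℝ (SmoothFun n M) c r := by
      by_cases hlm : l = m
      · subst hlm
        exact ⟨1, Filter.mem_of_superset (F.mem_nhds hq) fun r hr => F.D_self r hr l⟩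
      · exact ⟨0, Filter.mem_of_superset (F.mem_nhds hq) fun r hr => F.D_ne r hr l m hlm⟩
    obtain ⟨c, hc⟩ := h2
    rw [VField.apply_congr _ hc, Derivation.map_algebraMap]
    rfl
  have h3 := F.derivAlong_eq q hq (valAt ⁅F.D k, F.D l⁆ q) f
  simp only [derivAlong_valAt, Derivation.commutator_apply, ContMDiffMap.coe_sub, Pi.sub_apply, h1,
    sub_self, zero_mul, Finset.sum_const_zero] at h3
  exact sub_eq_zero.1 h3

theorem bracket_E_inr (α : LogOneForm n Z) {q : M} (hq : q ∈ F.U) (k : S ⊕ Fin d) (j : Fin d) :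
    α ⁅F.E k, F.E (Sum.inr j)⁆ q = 0 := by
  apply logOneForm_eq_zero_of_eventually
  filter_upwards [F.mem_nhds hq] with r hr f
  rw [logVF_bracket_apply]
  rcases k with s | i
  · rw [E_inl_apply, E_inr_apply]
    change F.y (Sum.inl s) r * F.D (Sum.inl s) (F.D (Sum.inr j) f) r -
      F.D (Sum.inr j) (F.y (Sum.inl s) * F.D (Sum.inl s) f) r = 0
    have h1 : F.D (Sum.inr j) (F.y (Sum.inl s) * F.D (Sum.inl s) f) r =
        F.y (Sum.inl s) r * F.D (Sum.inr j) (F.D (Sum.inl s) f) r +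
          F.D (Sum.inl s) f r * F.D (Sum.inr j) (F.y (Sum.inl s)) r :=
      derivAlong_mul (valAt (F.D (Sum.inr j)) r) _ _
    rw [h1, F.D_ne r hr _ _ (by simp), F.D_D_eq hr]
    ring
  · change F.D (Sum.inr i) (F.D (Sum.inr j) f) r - F.D (Sum.inr j) (F.D (Sum.inr i) f) r = 0
    rw [F.D_D_eq hr, sub_self]

/-- This is `dom = 0` on `E s`, `∂_j`, `∂_k`: the brackets vanish, and the derivative along `E s =
y_s ∂_s` is zero on the stratum. -/
theorem D_apply_theta {om : LogBilin n Z} (hom : IsLogSymplectic Z om) {q : M} (hq : q ∈ F.U)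
    (hX : q ∈ openStratum Z (S : Set ι)) (s : S) (j k : Fin d) :
    F.D (Sum.inr j) (om (F.E (Sum.inl s)) (F.E (Sum.inr k))) q =
      F.D (Sum.inr k) (om (F.E (Sum.inl s)) (F.E (Sum.inr j))) q := by
  have h1 := congrArg (fun f : SmoothFun n M => f q)
    (hom.closed (F.E (Sum.inl s)) (F.E (Sum.inr j)) (F.E (Sum.inr k)))
  have h3 := F.bracket_E_inr (om.flip (F.E (Sum.inr k))) hq (Sum.inl s) j
  have h4 := F.bracket_E_inr (om.flip (F.E (Sum.inr j))) hq (Sum.inl s) k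
  have h5 := F.bracket_E_inr (om.flip (F.E (Sum.inl s))) hq (Sum.inr j) k
  simp only [LinearMap.flip_apply] at h3 h4 h5
  simp only [extDTwo, ContMDiffMap.coe_sub, ContMDiffMap.coe_add, Pi.sub_apply, Pi.add_apply, h3,
    h4, h5, E_inl_apply, E_inr_apply, F.y_inl_eq_zero hq hX] at h1
  change _ = (0 : ℝ) at h1
  linarith

theorem D_apply_beta {om : LogBilin n Z} (hom : IsLogSymplectic Z om) {q : M} (hq : q ∈ F.U)
    (i j k : Fin d) :
    F.D (Sum.inr i) (om (F.E (Sum.inr j)) (F.E (Sum.inr k))) q -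
      F.D (Sum.inr j) (om (F.E (Sum.inr i)) (F.E (Sum.inr k))) q +
      F.D (Sum.inr k) (om (F.E (Sum.inr i)) (F.E (Sum.inr j))) q = 0 := by
  have h1 := congrArg (fun f : SmoothFun n M => f q)
    (hom.closed (F.E (Sum.inr i)) (F.E (Sum.inr j)) (F.E (Sum.inr k)))
  have h3 := F.bracket_E_inr (om.flip (F.E (Sum.inr k))) hq (Sum.inr i) j
  have h4 := F.bracket_E_inr (om.flip (F.E (Sum.inr j))) hq (Sum.inr i) k
  have h5 := F.bracket_E_inr (om.flip (F.E (Sum.inr i))) hq (Sum.inr j) k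
  simp only [LinearMap.flip_apply] at h3 h4 h5
  simp only [extDTwo, ContMDiffMap.coe_sub, ContMDiffMap.coe_add, Pi.sub_apply, Pi.add_apply, h3,
    h4, h5, E_inr_apply] at h1
  change _ = (0 : ℝ) at h1
  linarith

end AdaptedFrame

end Strata

section Stratum

universe u

variable {n : ℕ} {M : Type*} [TopologicalSpace M]
  [ChartedSpace (EuclideanSpace ℝ (Fin (2 * n))) M] {ι : Type u} {Z : ι → Set M}
  [T2Space M] [IsManifold (𝓡 (2 * n)) ∞ M]

/-! ### Closedness of the induced forms -/

theorem VField.commutator_apply_eq (u v : VField n M) (f : SmoothFun n M) (q : M) :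
    (⁅u, v⁆ : VField n M) f q = u (v f) q - v (u f) q := by
  rw [Derivation.commutator_apply]
  rfl

theorem VField.map_mul_apply (u : VField n M) (f g : SmoothFun n M) (q : M) :
    u (f * g) q = f q * u g q + g q * u f q :=
  derivAlong_mul (valAt u q) f g

theorem VField.map_sum_apply (u : VField n M) {α : Type*} (s : Finset α) (f : α → SmoothFun n M)
    (q : M) : u (∑ i ∈ s, f i) q = ∑ i ∈ s, u (f i) q :=
  derivAlong_sum (valAt u q) s f

/-- The exterior derivative of `∑ a_j dy_j`. -/
theorem extDOne_sum_smul_diffForm {κ : Type*} [Fintype κ] (a y : κ → SmoothFun n M)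
    (u v : VField n M) (q : M) : extDOne id (∑ j, a j • diffForm (y j)) u v q =
      ∑ j, (u (a j) q * v (y j) q - v (a j) q * u (y j) q) := by
  have h1 : ∀ w : VField n M, (∑ j, a j • diffForm (y j)) w = ∑ j, a j * w (y j) := fun w => by
    rw [LinearMap.sum_apply]
    rfl
  simp only [extDOne, id, h1, ContMDiffMap.coe_sub, Pi.sub_apply, VField.map_sum_apply,
    VField.map_mul_apply, SmoothFun.sum_apply, ContMDiffMap.coe_mul, Pi.mul_apply,
    VField.commutator_apply_eq]
  rw [← Finset.sum_sub_distrib, ← Finset.sum_sub_distrib]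
  exact Finset.sum_congr rfl fun j _ => by ring

theorem sum_smul_diffForm_apply {κ : Type*} [Fintype κ] (b : κ → κ → SmoothFun n M)
    (y : κ → SmoothFun n M) (u v : VField n M) :
    (∑ j, ∑ k, b j k • (diffForm (y j)).smulRight (diffForm (y k))) u v =
      ∑ j, ∑ k, b j k * (u (y j) * v (y k)) := by
  simp only [LinearMap.sum_apply]
  rfl

/-- The exterior derivative of `½ ∑ b_jk dy_j ∧ dy_k`. -/
theorem extDTwo_sum_smul_diffForm {κ : Type*} [Fintype κ] (b : κ → κ → SmoothFun n M)
    (hb : ∀ j k, b j k = -b k j) (y : κ → SmoothFun n M) (u v w : VField n M) (q : M) :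
    extDTwo id (∑ j, ∑ k, b j k • (diffForm (y j)).smulRight (diffForm (y k))) u v w q =
      ∑ j, ∑ k, (u (b j k) q * (v (y j) q * w (y k) q) - v (b j k) q * (u (y j) q * w (y k) q) +
        w (b j k) q * (u (y j) q * v (y k) q)) := by
  have hb' : ∀ j k, b j k q = -b k j q := fun j k => by rw [hb]; rfl
  simp only [extDTwo, id, sum_smul_diffForm_apply, ContMDiffMap.coe_sub, ContMDiffMap.coe_add,
    Pi.sub_apply, Pi.add_apply, VField.map_sum_apply,
    VField.map_mul_apply, SmoothFun.sum_apply, ContMDiffMap.coe_mul, Pi.mul_apply,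
    VField.commutator_apply_eq, mul_add, mul_sub, sub_mul, Finset.sum_add_distrib,
    Finset.sum_sub_distrib]
  have hsw : ∀ f g : κ → ℝ, ∑ j, ∑ k, b j k q * (f j * g k) =
      -∑ j, ∑ k, b j k q * (g j * f k) := by
    intro f g
    rw [Finset.sum_comm, ← Finset.sum_neg_distrib]
    refine Finset.sum_congr rfl fun j _ => ?_
    rw [← Finset.sum_neg_distrib]
    refine Finset.sum_congr rfl fun k _ => ?_
    rw [hb']
    ring
  have h1 := hsw (fun j => u (v (y j)) q) fun k => w (y k) q
  have h2 := hsw (fun j => v (u (y j)) q) fun k => w (y k) q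
  have h3 := hsw (fun j => u (w (y j)) q) fun k => v (y k) q
  have h4 := hsw (fun j => w (u (y j)) q) fun k => v (y k) q
  have h5 := hsw (fun j => v (w (y j)) q) fun k => u (y k) q
  have h6 := hsw (fun j => w (v (y j)) q) fun k => u (y k) q
  have e' : ∀ (f g : κ → ℝ) (c : κ → κ → ℝ), ∑ j, ∑ k, f j * g k * c j k =
     ∑ j, ∑ k, c j k * (f j * g k) := fun f g c =>
    Finset.sum_congr rfl fun j _ => Finset.sum_congr rfl fun k _ => by ring
  have e2 : ∀ (f g : κ → ℝ) (c : κ → κ → ℝ), ∑ j, ∑ k, c j k * (g k * f j) =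
     ∑ j, ∑ k, c j k * (f j * g k) := fun f g c =>
    Finset.sum_congr rfl fun j _ => Finset.sum_congr rfl fun k _ => by ring
  simp only [e', e2 (fun j => u (v (y j)) q), e2 (fun j => v (u (y j)) q),
    e2 (fun j => w (u (y j)) q)]
  linarith

namespace AdaptedFrame

variable {S : Finset ι} {d : ℕ} (F : AdaptedFrame n Z S d)

/-- A 1-form whose restriction to the stratum is `thetaAt`. -/
def thetaForm (om : LogBilin n Z) (s : S) : VField n M →ₗ[SmoothFun n M] SmoothFun n M :=
  ∑ j, om (F.E (Sum.inl s)) (F.E (Sum.inr j)) • diffForm (F.y (Sum.inr j))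

/-- A 2-form whose restriction to the stratum is `betaAt`. -/
def betaForm (om : LogBilin n Z) :
    VField n M →ₗ[SmoothFun n M] VField n M →ₗ[SmoothFun n M] SmoothFun n M :=
  ∑ j, ∑ k, om (F.E (Sum.inr j)) (F.E (Sum.inr k)) •
    (diffForm (F.y (Sum.inr j))).smulRight (diffForm (F.y (Sum.inr k)))

theorem thetaForm_apply (om : LogBilin n Z) (s : S) (q : M) (u : VField n M)
    (hu : valAt u q ∈ strTangent Z (S : Set ι) q) :
    F.thetaForm om s u q = F.thetaAt om s q ⟨valAt u q, hu⟩ := by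
  rw [thetaAt_apply, thetaForm, LinearMap.sum_apply, SmoothFun.sum_apply]
  rfl

theorem betaForm_apply (om : LogBilin n Z) (q : M) (u v : VField n M)
    (hu : valAt u q ∈ strTangent Z (S : Set ι) q) (hv : valAt v q ∈ strTangent Z (S : Set ι) q) :
    F.betaForm om u v q = F.betaAt om q ⟨valAt u q, hu⟩ ⟨valAt v q, hv⟩ := by
  rw [betaAt_apply, betaForm, sum_smul_diffForm_apply]
  simp only [SmoothFun.sum_apply]
  rfl

theorem betaForm_self {om : LogBilin n Z} (hom : IsLogSymplectic Z om) (u : VField n M) :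
    F.betaForm om u u = 0 := by
  have h : F.betaForm om u u = -F.betaForm om u u := by
    conv_lhs => rw [betaForm, sum_smul_diffForm_apply, Finset.sum_comm]
    rw [betaForm, sum_smul_diffForm_apply, ← Finset.sum_neg_distrib]
    refine Finset.sum_congr rfl fun j _ => ?_
    rw [← Finset.sum_neg_distrib]
    refine Finset.sum_congr rfl fun k _ => ?_
    rw [hom.skew]
    ring
  ext q
  have h' : F.betaForm om u u q = -F.betaForm om u u q :=
    congrArg (fun f : SmoothFun n M => f q) h
  change _ = (0 : ℝ)
  linarith

theorem extDOne_thetaForm {om : LogBilin n Z} (hom : IsLogSymplectic Z om) (s : S) {q : M}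
    (hq : q ∈ F.U) (hX : q ∈ openStratum Z (S : Set ι)) {u v : VField n M}
    (hu : valAt u q ∈ strTangent Z (S : Set ι) q) (hv : valAt v q ∈ strTangent Z (S : Set ι) q) :
    extDOne id (F.thetaForm om s) u v q = 0 := by
  have hu' := F.derivAlong_eq_sum_inr hq hu
  have hv' := F.derivAlong_eq_sum_inr hq hv
  simp only [derivAlong_valAt] at hu' hv'
  rw [thetaForm, extDOne_sum_smul_diffForm, Finset.sum_sub_distrib, sub_eq_zero]
  simp only [hu' (om _ _), hv' (om _ _), Finset.sum_mul]
  rw [Finset.sum_comm]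
  refine Finset.sum_congr rfl fun j _ => Finset.sum_congr rfl fun k _ => ?_
  rw [F.D_apply_theta hom hq hX]
  ring

theorem extDTwo_betaForm {om : LogBilin n Z} (hom : IsLogSymplectic Z om) {q : M}
    (hq : q ∈ F.U) {u v w : VField n M}
    (hu : valAt u q ∈ strTangent Z (S : Set ι) q) (hv : valAt v q ∈ strTangent Z (S : Set ι) q)
    (hw : valAt w q ∈ strTangent Z (S : Set ι) q) :
    extDTwo id (F.betaForm om) u v w q = 0 := by
  have hu' := F.derivAlong_eq_sum_inr hq hu
  have hv' := F.derivAlong_eq_sum_inr hq hv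
  have hw' := F.derivAlong_eq_sum_inr hq hw
  simp only [derivAlong_valAt] at hu' hv' hw'
  rw [betaForm, extDTwo_sum_smul_diffForm _ fun j k => hom.skew _ _]
  simp only [hu' (om _ _), hv' (om _ _), hw' (om _ _), Finset.sum_mul, Finset.sum_add_distrib,
    Finset.sum_sub_distrib]
  generalize hU : (fun j : Fin d => u (F.y (Sum.inr j)) q) = U
  generalize hV : (fun j : Fin d => v (F.y (Sum.inr j)) q) = V
  generalize hW : (fun j : Fin d => w (F.y (Sum.inr j)) q) = W
  have hU' : ∀ j, u (F.y (Sum.inr j)) q = U j := congrFun hU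
  have hV' : ∀ j, v (F.y (Sum.inr j)) q = V j := congrFun hV
  have hW' : ∀ j, w (F.y (Sum.inr j)) q = W j := congrFun hW
  simp only [hU', hV', hW']
  -- Second derivatives of coordinates have cancelled. Renaming indices collects the derivatives of
  -- the coefficients into the combination killed by `D_apply_beta`.
  let B : Fin d → Fin d → Fin d → ℝ := fun i j k =>
    F.D (Sum.inr i) (om (F.E (Sum.inr j)) (F.E (Sum.inr k))) q
  change (∑ j, ∑ k, ∑ i, U i * B i j k * (V j * W k)) - (∑ j, ∑ k, ∑ i, V i * B i j k * (U j * W k))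
    + (∑ j, ∑ k, ∑ i, W i * B i j k * (U j * V k)) = 0
  have h1 : (∑ j, ∑ k, ∑ i, U i * B i j k * (V j * W k)) =
      ∑ i, ∑ j, ∑ k, B i j k * (U i * V j * W k) := by
    calc _ = ∑ j, ∑ i, ∑ k, U i * B i j k * (V j * W k) :=
          Finset.sum_congr rfl fun j _ => Finset.sum_comm
      _ = ∑ i, ∑ j, ∑ k, U i * B i j k * (V j * W k) := Finset.sum_comm
      _ = _ := Finset.sum_congr rfl fun i _ => Finset.sum_congr rfl fun j _ =>
          Finset.sum_congr rfl fun k _ => by ring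
  have h2 : (∑ j, ∑ k, ∑ i, V i * B i j k * (U j * W k)) =
      ∑ i, ∑ j, ∑ k, B j i k * (U i * V j * W k) := by
    refine Finset.sum_congr rfl fun i _ => ?_
    rw [Finset.sum_comm]
    exact Finset.sum_congr rfl fun j _ => Finset.sum_congr rfl fun k _ => by
      ring
  have h3 : (∑ j, ∑ k, ∑ i, W i * B i j k * (U j * V k)) =
      ∑ i, ∑ j, ∑ k, B k i j * (U i * V j * W k) :=
    Finset.sum_congr rfl fun i _ => Finset.sum_congr rfl fun j _ =>
      Finset.sum_congr rfl fun k _ => by ring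
  rw [h1, h2, h3, ← Finset.sum_sub_distrib, ← Finset.sum_add_distrib]
  refine Finset.sum_eq_zero fun i _ => ?_
  rw [← Finset.sum_sub_distrib, ← Finset.sum_add_distrib]
  refine Finset.sum_eq_zero fun j _ => ?_
  rw [← Finset.sum_sub_distrib, ← Finset.sum_add_distrib]
  refine Finset.sum_eq_zero fun k _ => ?_
  rw [← sub_mul, ← add_mul, F.D_apply_beta hom hq i j k, zero_mul]

end AdaptedFrame

end Stratum

section Induced

universe u

variable {n : ℕ} {M : Type*} [TopologicalSpace M]
  [ChartedSpace (EuclideanSpace ℝ (Fin (2 * n))) M] {ι : Type u} {Z : ι → Set M}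
  [T2Space M] [IsManifold (𝓡 (2 * n)) ∞ M] {S : Finset ι}

/-! ### The forms induced on a stratum by a choice of forms `dx/x` -/

/-- At `q`, the forms `dx/x` of the first coordinates are the given ones. -/
def AdaptedFrame.IsCompatible {d : ℕ} (F : AdaptedFrame n Z S d) (lam : ι → LogOneForm n Z)
    (q : M) : Prop :=
  q ∈ F.U ∧ ∀ (s : S) (u : logVF n Z), F.coef u (Sum.inl s) q = lam s u q

open Classical in
/-- The contraction of `om` with the Euler field of `Z s`, on the stratum. -/
def strTheta (om : LogBilin n Z) (lam : ι → LogOneForm n Z) (s : S) :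
    StrOneForm n Z (S : Set ι) := fun q =>
  if h : ∃ F : AdaptedFrame n Z S (2 * n - S.card), F.IsCompatible lam q then
    h.choose.thetaAt om s q
  else 0

open Classical in
/-- The smooth part of `om` on the stratum. -/
def strBeta (om : LogBilin n Z) (lam : ι → LogOneForm n Z) : StrBilin n Z (S : Set ι) := fun q =>
  if h : ∃ F : AdaptedFrame n Z S (2 * n - S.card), F.IsCompatible lam q then
    h.choose.betaAt om q
  else 0

variable [Fintype ι]

theorem IsNormalCrossing.exists_isCompatible (hZ : IsNormalCrossing n Z) {ρ : ι → M → ℝ}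
    {lam : ι → LogOneForm n Z} (hlam : ∀ s, IsDlogDefining Z s (ρ s) (lam s)) {p : M}
    (hp : p ∈ openStratum Z (S : Set ι)) :
    S.card + (2 * n - S.card) = 2 * n ∧
      ∃ F : AdaptedFrame n Z S (2 * n - S.card), ∀ᶠ q in 𝓝 p, F.IsCompatible lam q := by
  choose x hx hρ _ using fun s : S => hlam s p
  obtain ⟨d, F, hd, hpU, hy⟩ := hZ.exists_adaptedFrame (fun i => (hp i).trans Finset.mem_coe) hx
  -- Fixing the number of free coordinates as `2 * n - S.card` gives all compatible frames one type;
  -- the truncated subtraction is exact by `hd`.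
  obtain rfl : d = 2 * n - S.card := by omega
  refine ⟨hd, F, ?_⟩
  have h1 : ∀ᶠ q in 𝓝 p, ∀ s : S, ∀ᶠ r in 𝓝 q, ρ s r = |F.y (Sum.inl s) r| := by
    refine Filter.eventually_all.2 fun s => ?_
    rw [hy]
    exact (hρ s).eventually_nhds
  filter_upwards [F.mem_nhds hpU, h1] with q hq h
  exact ⟨hq, fun s u => (F.coef_inl_eq_dlog hZ hq (hlam s) (h s) u).self_of_nhds⟩

section Compatible

variable {d : ℕ} {F : AdaptedFrame n Z S d} {lam : ι → LogOneForm n Z} {q : M}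
  {om : LogBilin n Z}

theorem AdaptedFrame.IsCompatible.thetaAt_eq (hF : F.IsCompatible lam q)
    (hZ : IsNormalCrossing n Z)
    (hX : q ∈ openStratum Z (S : Set ι)) (s : S) {e : logVF n Z} (he : IsEulerAt Z s q e)
    (v : logVF n Z) {v' : strTangent (n := n) Z (S : Set ι) q}
    (hv : (v' : TVec n q) = valAt (v : VField n M) q) (h0 : ∀ t : S, lam t v q = 0) :
    F.thetaAt om s q v' = om e v q := by
  rw [F.thetaAt_eq hF.1 s v hv fun t => (hF.2 t v).trans (h0 t)]
  exact hZ.eq_of_isEulerAt (F.isEulerAt_E hF.1 s ((hX s).2 s.2)) he (om.flip v)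

theorem AdaptedFrame.IsCompatible.exists_lift (hF : F.IsCompatible lam q)
    (hX : q ∈ openStratum Z (S : Set ι)) (a : S → ℝ)
    (w : strTangent (n := n) Z (S : Set ι) q) : ∃ u : logVF n Z,
      (w : TVec n q) = valAt (u : VField n M) q ∧ ∀ s : S, lam s u q = a s := by
  obtain ⟨u, h1, h2⟩ := F.exists_lift hF.1 hX a w
  exact ⟨u, h1, fun s => (hF.2 s u).symm.trans (h2 s)⟩

theorem AdaptedFrame.IsCompatible.betaAt_eq (hF : F.IsCompatible lam q)
    (hom : IsLogSymplectic Z om)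
    (u v : logVF n Z) {u' v' : strTangent (n := n) Z (S : Set ι) q}
    (hu : (u' : TVec n q) = valAt (u : VField n M) q)
    (hv : (v' : TVec n q) = valAt (v : VField n M) q) (h0 : ∀ t : S, lam t u q = 0)
    (h0' : ∀ t : S, lam t v q = 0) : F.betaAt om q u' v' = om u v q :=
  F.betaAt_eq hom hF.1 u v hu hv (fun t => (hF.2 t u).trans (h0 t))
    fun t => (hF.2 t v).trans (h0' t)

end Compatible

section Independence

variable {F : AdaptedFrame n Z S (2 * n - S.card)} {lam : ι → LogOneForm n Z} {q : M}
  {om : LogBilin n Z}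

/-- Every compatible frame computes `om e v` on a lift `v` of `w` annihilated by all `lam t`. So the
pointwise choice in `strTheta` is harmless and a single frame describes it nearby. -/
theorem AdaptedFrame.IsCompatible.strTheta_eq (hF : F.IsCompatible lam q)
    (hZ : IsNormalCrossing n Z) (hX : q ∈ openStratum Z (S : Set ι)) (s : S) :
    strTheta om lam s q = F.thetaAt om s q := by
  have h : ∃ F : AdaptedFrame n Z S (2 * n - S.card), F.IsCompatible lam q := ⟨F, hF⟩
  rw [strTheta, dif_pos h]
  ext w
  obtain ⟨v, hv, hv0⟩ := hF.exists_lift hX 0 w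
  obtain ⟨e, he⟩ := hZ.exists_isEulerAt ((hX s).2 s.2)
  rw [hF.thetaAt_eq hZ hX s he v hv hv0, h.choose_spec.thetaAt_eq hZ hX s he v hv hv0]

theorem AdaptedFrame.IsCompatible.strBeta_eq (hF : F.IsCompatible lam q)
    (hom : IsLogSymplectic Z om) (hX : q ∈ openStratum Z (S : Set ι)) :
    strBeta om lam q = F.betaAt om q := by
  have h : ∃ F : AdaptedFrame n Z S (2 * n - S.card), F.IsCompatible lam q := ⟨F, hF⟩
  rw [strBeta, dif_pos h]
  ext w w'
  obtain ⟨u, hu, hu0⟩ := hF.exists_lift hX 0 w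
  obtain ⟨v, hv, hv0⟩ := hF.exists_lift hX 0 w'
  rw [hF.betaAt_eq hom u v hu hv hu0 hv0, h.choose_spec.betaAt_eq hom u v hu hv hu0 hv0]

end Independence

/-! ### Closedness, paired log forms and nondegeneracy on the stratum -/

theorem isClosedOneFormOn_strTheta (hZ : IsNormalCrossing n Z) {om : LogBilin n Z}
    (hom : IsLogSymplectic Z om) {ρ : ι → M → ℝ} {lam : ι → LogOneForm n Z}
    (hlam : ∀ s, IsDlogDefining Z s (ρ s) (lam s)) (s : S) :
    IsClosedOneFormOn Z (S : Set ι) (openStratum Z S) (strTheta om lam s) := by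
  intro p hp
  obtain ⟨-, F, hF⟩ := hZ.exists_isCompatible hlam hp
  refine ⟨F.thetaForm om s, ?_⟩
  filter_upwards [hF] with q hq hX
  refine ⟨fun u hu => ?_, fun u v hu hv => F.extDOne_thetaForm hom s hq.1 hX hu hv⟩
  rw [hq.strTheta_eq hZ hX, F.thetaForm_apply]

theorem isClosedTwoFormOn_strBeta (hZ : IsNormalCrossing n Z) {om : LogBilin n Z}
    (hom : IsLogSymplectic Z om) {ρ : ι → M → ℝ} {lam : ι → LogOneForm n Z}
    (hlam : ∀ s, IsDlogDefining Z s (ρ s) (lam s)) :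
    IsClosedTwoFormOn Z (S : Set ι) (openStratum Z S) (strBeta om lam) := by
  refine ⟨fun p hp w => ?_, fun p hp => ?_⟩
  · obtain ⟨-, F, hF⟩ := hZ.exists_isCompatible hlam hp
    obtain ⟨u, hu, hu0⟩ := hF.self_of_nhds.exists_lift hp 0 w
    rw [hF.self_of_nhds.strBeta_eq hom hp, hF.self_of_nhds.betaAt_eq hom u u hu hu hu0 hu0, hom.alt]
    rfl
  · obtain ⟨-, F, hF⟩ := hZ.exists_isCompatible hlam hp
    refine ⟨F.betaForm om, F.betaForm_self hom, ?_⟩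
    filter_upwards [hF] with q hq hX
    refine ⟨fun u v hu hv => ?_, fun u v w hu hv hw => F.extDTwo_betaForm hom hq.1 hu hv hw⟩
    rw [hq.strBeta_eq hom hX, F.betaForm_apply]

/-- The forms `dx/x` are chosen such that residues along the partners are multiples of them. -/
def IsPairDlog (om : LogBilin n Z) (lam : ι → LogOneForm n Z) : Prop :=
  ∀ s t, CNonzero om s t → ∀ p ∈ Z s ∩ Z t, ∀ e v : logVF n Z, IsEulerAt Z s p e →
    om e v p = cCoeff om s t p * lam t v p

theorem IsPartitionable.exists_isPairDlog [SecondCountableTopology M] (hZ : IsNormalCrossing n Z)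
    {om : LogBilin n Z} (hom : IsLogSymplectic Z om) (hpart : IsPartitionable om)
    (hc : CompactSpace M ∨
      ∀ s t, CNonzero om s t → ∀ p ∈ Z s ∩ Z t, cCoeff om s t p ≠ 0) :
    ∃ (ρ : ι → M → ℝ) (lam : ι → LogOneForm n Z),
      (∀ t, IsDlogDefining Z t (ρ t) (lam t)) ∧ IsPairDlog om lam := by
  have h : ∀ t, ∃ (ρ : M → ℝ) (lam : LogOneForm n Z), IsDlogDefining Z t ρ lam ∧
      ∀ s, CNonzero om s t → ∀ p ∈ Z s ∩ Z t, ∀ e v : logVF n Z, IsEulerAt Z s p e →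
        om e v p = cCoeff om s t p * lam v p := by
    intro t
    by_cases hs : ∃ s, CNonzero om s t
    · obtain ⟨s, hs⟩ := hs
      obtain ⟨ρ, lam, h1, h2⟩ := hpart.exists_residue_eq_dlog hZ hom hc hs
      refine ⟨ρ, lam, h1, fun s' hs' => ?_⟩
      -- At most one `s` is paired with `t`, so a single modification of `x_t` suffices.
      obtain rfl : s' = s := by
        by_contra hne
        exact (hpart.of_c_ne_zero s t hs).2.2.2 s' hne hs'
      exact h2
    · obtain ⟨ρ, lam, h1⟩ := hZ.exists_isDlogDefining t
      exact ⟨ρ, lam, h1, fun s hs' => absurd ⟨s, hs'⟩ hs⟩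
  choose ρ lam h1 h2 using h
  exact ⟨ρ, lam, h1, fun s t => h2 t s⟩

/-- If `s` has its partner `t` in `S`, the residue along `Z s` is a multiple of `lam t`, which
annihilates the lifts used to compute `strTheta`. -/
theorem strTheta_eq_zero (hZ : IsNormalCrossing n Z) {om : LogBilin n Z} {ρ : ι → M → ℝ}
    {lam : ι → LogOneForm n Z} (hlam : ∀ s, IsDlogDefining Z s (ρ s) (lam s))
    (hpair : IsPairDlog om lam) {q : M} (hX : q ∈ openStratum Z (S : Set ι)) (s : S)
    (hs : (s : ι) ∉ typeZ om S) : strTheta om lam s q = 0 := by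
  classical
  simp only [typeZ, Finset.mem_filter, s.2, true_and, not_forall, not_not] at hs
  obtain ⟨t, ht, hst⟩ := hs
  obtain ⟨-, F, hF⟩ := hZ.exists_isCompatible hlam hX
  have hF := hF.self_of_nhds
  ext w
  obtain ⟨v, hv, hv0⟩ := hF.exists_lift hX 0 w
  obtain ⟨e, he⟩ := hZ.exists_isEulerAt ((hX s).2 s.2)
  rw [hF.strTheta_eq hZ hX, hF.thetaAt_eq hZ hX s he v hv hv0,
    hpair s t hst q ⟨(hX s).2 s.2, (hX t).2 ht⟩ e v he, hv0 ⟨t, ht⟩]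
  exact mul_zero _

theorem typeZ_subset (om : LogBilin n Z) : typeZ om S ⊆ S := by
  intro s hs
  simp only [typeZ, Finset.mem_filter] at hs
  exact hs.1

/-- The forms on the stratum for the hypersurfaces of type `z`. -/
def typeZTheta (om : LogBilin n Z) (lam : ι → LogOneForm n Z) (j : typeZ om S) :
    StrOneForm n Z (S : Set ι) :=
  strTheta om lam ⟨j, typeZ_subset om j.2⟩

theorem sum_typeZ_eq (hZ : IsNormalCrossing n Z) {om : LogBilin n Z} {ρ : ι → M → ℝ}
    {lam : ι → LogOneForm n Z} (hlam : ∀ s, IsDlogDefining Z s (ρ s) (lam s))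
    (hpair : IsPairDlog om lam) {q : M} (hX : q ∈ openStratum Z (S : Set ι)) (a : ι → ℝ)
    (w : strTangent (n := n) Z (S : Set ι) q) :
    ∑ s : S, a s * strTheta om lam s q w = ∑ j : typeZ om S, a j * typeZTheta om lam j q w := by
  symm
  refine Finset.sum_of_injOn (fun j : typeZ om S => (⟨j, typeZ_subset om j.2⟩ : S)) ?_ ?_ ?_ ?_
  · intro i _ j _ h
    exact Subtype.ext (congrArg (fun z : S => (z : ι)) h)
  · simp
  · intro s _ hs
    rw [strTheta_eq_zero hZ hlam hpair hX s, LinearMap.zero_apply, mul_zero]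
    intro h
    exact hs ⟨⟨s, h⟩, by simp, rfl⟩
  · intro j _
    rfl

-- The expansion in a compatible frame loses the coefficients `c_{s,t}` of unpaired indices and the
-- contractions of paired ones. Both orders of a pair occur in the double sum, which together give
-- its wedge term.
open Classical in
theorem IsPairDlog.apply_eq {om : LogBilin n Z} {lam : ι → LogOneForm n Z}
    (hpair : IsPairDlog om lam) (hZ : IsNormalCrossing n Z) (hom : IsLogSymplectic Z om)
    {ρ : ι → M → ℝ} (hlam : ∀ s, IsDlogDefining Z s (ρ s) (lam s)) {q : M}
    (hX : q ∈ openStratum Z (S : Set ι)) (u v : logVF n Z)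
    {u' v' : strTangent (n := n) Z (S : Set ι) q}
    (hu : (u' : TVec n q) = valAt (u : VField n M) q)
    (hv : (v' : TVec n q) = valAt (v : VField n M) q) :
    om u v q =
      (∑ s ∈ S, ∑ t ∈ S with CNonzero om s t, cCoeff om s t q * (lam s u q * lam t v q)) +
      (∑ j : typeZ om S, (lam j u q * typeZTheta om lam j q v' -
        lam j v q * typeZTheta om lam j q u')) + strBeta om lam q u' v' := by
  obtain ⟨-, F, hF⟩ := hZ.exists_isCompatible hlam hX
  have hF := hF.self_of_nhds
  rw [F.apply_eq_of_coef hom hF.1 u v hu hv, hF.strBeta_eq hom hX]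
  congr 1
  congr 1
  · rw [← Finset.sum_coe_sort S]
    refine Finset.sum_congr rfl fun s _ => ?_
    rw [Finset.sum_filter, ← Finset.sum_coe_sort S]
    refine Finset.sum_congr rfl fun t _ => ?_
    have h1 : om (F.E (Sum.inl s)) (F.E (Sum.inl t)) q = cCoeff om s t q :=
      (hZ.cCoeff_eq om (F.isEulerAt_E hF.1 s ((hX s).2 s.2))
        (F.isEulerAt_E hF.1 t ((hX t).2 t.2))).symm
    split_ifs with hst
    · rw [h1, hF.2, hF.2, mul_comm]
    · have h2 : om (F.E (Sum.inl s)) (F.E (Sum.inl t)) q = 0 := by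
        by_cases hst' : s = t
        · rw [hst', hom.alt]
          rfl
        · rw [h1]
          by_contra h
          exact hst ⟨fun h' => hst' (Subtype.ext h'), q, ⟨(hX s).2 s.2, (hX t).2 t.2⟩, h⟩
      rw [h2, mul_zero]
  · rw [Finset.sum_sub_distrib, Finset.sum_sub_distrib,
      ← sum_typeZ_eq hZ hlam hpair hX (fun s => lam s u q),
      ← sum_typeZ_eq hZ hlam hpair hX (fun s => lam s v q)]
    simp only [hF.strTheta_eq hZ hX, hF.2]

/-- A relation `∑ a_j θ_j + β(w, ·) = 0` with all `θ_j(w) = 0` lifts to a log vector in the kernel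
of `om`, hence is trivial. -/
theorem IsPairDlog.exists_wedgeEval_ne_zero {om : LogBilin n Z} {lam : ι → LogOneForm n Z}
    (hpair : IsPairDlog om lam) (hZ : IsNormalCrossing n Z) (hom : IsLogSymplectic Z om)
    {ρ : ι → M → ℝ} (hlam : ∀ s, IsDlogDefining Z s (ρ s) (lam s)) {q : M}
    (hX : q ∈ openStratum Z (S : Set ι)) :
    Module.finrank ℝ (strTangent (n := n) Z (S : Set ι) q) = 2 * n - S.card ∧
    ∃ m : ℕ, Module.finrank ℝ (strTangent (n := n) Z (S : Set ι) q) =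
        Fintype.card (typeZ om S) + 2 * m ∧
      ∃ v : typeZ om S ⊕ (Fin m × Fin 2) → strTangent (n := n) Z (S : Set ι) q,
        wedgeEval (fun j w => typeZTheta om lam j q w) (fun w w' => strBeta om lam q w w') v ≠ 0 := by
  classical
  obtain ⟨-, F, hF⟩ := hZ.exists_isCompatible hlam hX
  have hF := hF.self_of_nhds
  obtain ⟨hfin, hrank⟩ := F.finrank_strTangent hF.1 hX
  refine ⟨hrank, _root_.exists_wedgeEval_ne_zero
    (fun w => (isClosedTwoFormOn_strBeta hZ hom hlam).1 q hX w) fun a w h1 h2 => ?_⟩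
  -- The lift gets component `0` along paired indices, so the `c_{s,t}` terms of `om u v` disappear.
  let a' : ι → ℝ := fun s => if h : s ∈ typeZ om S then a ⟨s, h⟩ else 0
  have ha' : ∀ j : typeZ om S, a' j = a j := fun j => dif_pos j.2
  obtain ⟨u, hu, hua⟩ := hF.exists_lift hX (fun s => a' s) w
  have hom0 : ∀ v, om u v q = 0 := by
    intro v
    let v' : strTangent (n := n) Z (S : Set ι) q :=
      ⟨valAt (v : VField n M) q, logVF_at_mem Z S q (fun i hi => (hX i).mpr hi) v⟩
    rw [hpair.apply_eq hZ hom hlam hX u v (v' := v') hu rfl]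
    have h3 : ∑ s ∈ S, ∑ t ∈ S with CNonzero om s t,
        cCoeff om s t q * (lam s u q * lam t v q) = 0 := by
      refine Finset.sum_eq_zero fun s hs => Finset.sum_eq_zero fun t ht => ?_
      rw [Finset.mem_filter] at ht
      have h4 : s ∉ typeZ om S := by
        simp only [typeZ, Finset.mem_filter, not_and, not_forall, not_not]
        exact fun _ => ⟨t, ht.1, ht.2⟩
      rw [hua ⟨s, hs⟩, show a' s = 0 from dif_neg h4, zero_mul, mul_zero]
    rw [h3, zero_add, ← h1 v']
    congr 1
    refine Finset.sum_congr rfl fun j _ => ?_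
    rw [h2, mul_zero, sub_zero, hua ⟨j, typeZ_subset om j.2⟩, ha']
  have hz := hom.eq_zero_of_forall_eq_zero hZ hom0
  constructor
  · ext j
    rw [← ha', ← hua ⟨j, typeZ_subset om j.2⟩]
    exact hz _
  · apply strTangent_ext
    intro f
    rw [hu]
    exact hz (logDiff Z f)

end Induced

end

/-! ### The induced cosymplectic structure -/

theorem mainTheorem3 {n : ℕ} {M : Type*} [TopologicalSpace M] [T2Space M]
    [SecondCountableTopology M] [ChartedSpace (EuclideanSpace ℝ (Fin (2 * n))) M]
    [IsManifold (𝓡 (2 * n)) ∞ M] {ι : Type*} [Fintype ι] (Z : ι → Set M)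
    (hZ : IsNormalCrossing n Z) (om : LogBilin n Z) (hom : IsLogSymplectic Z om)
    (hpart : IsPartitionable om)
    (hc : CompactSpace M ∨
      ∀ s t, CNonzero om s t → ∀ p ∈ Z s ∩ Z t, cCoeff om s t p ≠ 0)
    (S : Finset ι) (hS : (⋂ s ∈ S, Z s).Nonempty) :
    ∃ (θ : typeZ om S → StrOneForm n Z S) (β : StrBilin n Z S),
      IsInducedOn om S θ β ∧ IsCosymplecticOn Z S (openStratum Z S) θ β := by
  obtain ⟨ρ, lam, hlam, hpair⟩ := hpart.exists_isPairDlog hZ hom hc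
  refine ⟨typeZTheta om lam, strBeta om lam, ⟨ρ, lam, fun s _ => hlam s, fun p hp u v => ?_⟩,
    fun j => isClosedOneFormOn_strTheta hZ hom hlam _, isClosedTwoFormOn_strBeta hZ hom hlam, ?_⟩
  · exact hpair.apply_eq hZ hom hlam hp u v rfl rfl
  -- The exponent must be the same at all points. On an empty stratum any `m` works; otherwise the
  -- constant dimension `2 * n - S.card` determines it.
  · rcases (openStratum Z (S : Set ι)).eq_empty_or_nonempty with hX | ⟨p, hp⟩
    · exact ⟨0, fun p hp => absurd hp (by simp [hX])⟩
    · obtain ⟨hd, m, hm, -⟩ := hpair.exists_wedgeEval_ne_zero hZ hom hlam hp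
      refine ⟨m, fun q hq => ?_⟩
      obtain ⟨hd', m', hm', h⟩ := hpair.exists_wedgeEval_ne_zero hZ hom hlam hq
      obtain rfl : m' = m := by omega
      exact ⟨hm', h⟩
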